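/- Let $k$ be a commutative ring containing $\mathbb{Q}$, and let $L=(L,d,[\cdot,\cdot])$ be a $\mathbb{Z}$-graded differential graded Lie algebra over $k$ with $d$ of degree $+1$. Let $\eta:L\to L$ be a $k$-linear map of degree $-1$ with $d\eta d=d$, $\eta^2=0$ and $\eta d\eta=\eta$. Put $[d,\eta]=d\eta+\eta d$, $H=\ker[d,\eta]$ (a graded submodule of $L$) and $g=\eta[\cdot,\cdot]$. *Notation.* The Koszul sign convention is used throughout. For homogeneous $a_1,\dots,a_n$ the sign $\chi(\sigma)$ is defined by $a_{\sigma(1)}\wedge\dots\wedge a_{\sigma(n)}=\chi(\sigma)\,a_1\wedge\dots\wedge a_n$ in the graded exterior algebra; $\alpha_n(a_1\otimes\dots\otimes a_n)=\sum_{\sigma\in\Sigma_n}\chi(\sigma)\,a_{\sigma(1)}\otimes\dots\otimes a_{\sigma(n)}$, and $\alpha_{k,n}$ is the same sum over the $(k,n)$-shuffles only. $\mathrm{Ot}(n)$ is the set of oriented (plane) binary trees with $n$ leaves. For $\phi\in\mathrm{Ot}(n)$ let $w_\phi(i)$ be the number of left turns on the path from the root to the $i$-th leaf, and $e(\phi)=(-1)^{w_\phi(1)+\dots+w_\phi(n)}$.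 For homogeneous bilinear maps $b_K$ attached to the internal vertices $K$ of $\phi$, the map $\phi((b_K)):L^{\otimes n}\to L$ is defined recursively: it is the identity for $n=1$, and $b_{0}\circ(\phi_1(B_1)\otimes\phi_2(B_2))$ if the root carries $b_0$ and $\phi_1,\phi_2$ are the left and right branches. In $\phi(b_0,g,\dots,g)$ the root carries $b_0$. An $L_\infty$-algebra is a graded module with graded antisymmetric maps $\mu_n$ of degree $2-n$ ($n\ge1$) such that $\sum_{k+l=n+1}(-1)^{k(l-1)}\mu_l\circ(\mu_k\otimes1\otimes\dots\otimes1)\circ\alpha_{k,n}=0$ for all $n$; $L$ is one, with $\mu_1=d$, $\mu_2=[\cdot,\cdot]$ and $\mu_n=0$ for $n\ge3$. An $L_\infty$-morphism $(V,\mu_*)\to(V',\mu'_*)$ is a sequence of graded antisymmetric maps $f_n:V^{\otimes n}\to V'$ of degree $1-n$ ($n\ge1$) such that for all $n$ $$\sum_{k=1}^n\ \sum_{i_1+\dots+i_k=n}\frac{(-1)^{k(k-1)/2+i_1(k-1)+\dots+i_{k-1}}}{i_1!\cdots i_k!\,k!}\,\mu'_k\circ(f_{i_1}\otimes\dots\otimes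 f_{i_k})\circ\alpha_n=\sum_{k+l=n+1}(-1)^{k(l-1)}f_l\circ(\mu_k\otimes1\otimes\dots\otimes1)\circ\alpha_{k,n},$$ where $i_1,\dots,i_k\ge1$. It is an $L_\infty$-quasi-isomorphism if $f_1$ induces an isomorphism on homology. **Theorem.** The maps $\mu_n:H^{\otimes n}\to H$ of degree $2-n$ given by $$\mu_1=0,\qquad \mu_n=-\Big(\frac12\Big)^{n-1}\sum_{\phi\in\mathrm{Ot}(n)}e(\phi)\,\phi\big((1-[d,\eta])[\cdot,\cdot],g,\dots,g\big)\circ\alpha_n\quad(n\ge2)$$ make $H$ an $L_\infty$-algebra, with $\mu_2=(1-d\eta)[\cdot,\cdot]$, and the maps $f_n:H^{\otimes n}\to L$ of degree $1-n$ given by $$f_1=\text{inclusion},\qquad f_n=\Big(\frac12\Big)^{n-1}\sum_{\phi\in\mathrm{Ot}(n)}e(\phi)\,\phi(g,\dots,g)\circ\alpha_n\quad(n\ge2)$$ define an $L_\infty$-quasi-isomorphism $(H,\mu_*)\to(L,d,[\cdot,\cdot])$; in particular $f_2=-g$. -/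

import Mathlib

open BinaryTree

namespace LInfinity

noncomputable section

/-! ### Signs -/

/-- The sign `χ(σ, a₁, …, aₙ)` for homogeneous `aᵢ` of degree `p i`, defined by
`a_{σ(1)} ∧ ⋯ ∧ a_{σ(n)} = χ(σ) a₁ ∧ ⋯ ∧ aₙ` in the graded exterior algebra
(where `a ∧ b = -(-1)^{|a||b|} b ∧ a`): every inversion of `σ` contributes
`-(-1)^{|a||b|}` for the two elements that it interchanges. -/
def chi {n : ℕ} (σ : Equiv.Perm (Fin n)) (p : Fin n → ℤ) : ℤˣ :=
  ∏ i : Fin n, ∏ j : Fin n,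
    if i < j ∧ σ j < σ i then -(p (σ i) * p (σ j)).negOnePow else 1

/-- The `(k, n)`-shuffles: permutations that are increasing on the first `k` and on the last
`n - k` positions. -/
def shuffles (k n : ℕ) : Finset (Equiv.Perm (Fin n)) :=
  Finset.univ.filter fun σ =>
    ∀ i j : Fin n, i < j → ((j : ℕ) < k ∨ k ≤ (i : ℕ)) → σ i < σ j

/-! ### Graded modules: degrees, Koszul twists, antisymmetrisation

A graded module is a module `L` with submodules `ℒ i` (`i : ℤ`) of which it is the direct sum. -/

section Graded

variable {k : Type*} [CommRing k]
variable {L : Type*} [AddCommGroup L] [Module k L]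
variable {M : Type*} [AddCommGroup M] [Module k M]

/-- `f : L^{⊗n} → M` is homogeneous of degree `m`. -/
def HasDegree (ℒ : ℤ → Submodule k L) (ℳ : ℤ → Submodule k M) {n : ℕ}
    (f : MultilinearMap k (fun _ : Fin n => L) M) (m : ℤ) : Prop :=
  ∀ (p : Fin n → ℤ) (a : Fin n → L), (∀ i, a i ∈ ℒ (p i)) → f a ∈ ℳ ((∑ i, p i) + m)

/-- `f : L^{⊗n} → M` is graded antisymmetric, i.e. it factors through the graded exterior
power. -/
def IsGradedAntisymmetric (ℒ : ℤ → Submodule k L) {n : ℕ}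
    (f : MultilinearMap k (fun _ : Fin n => L) M) : Prop :=
  ∀ (σ : Equiv.Perm (Fin n)) (p : Fin n → ℤ) (a : Fin n → L), (∀ i, a i ∈ ℒ (p i)) →
    f (fun i => a (σ i)) = chi σ p • f a

/-- The linear map `a ↦ (-1)^{m |a|} a`, the Koszul sign for moving something of degree `m`
past `a`. -/
def koszulTwist (ℒ : ℤ → Submodule k L) [DirectSum.Decomposition ℒ] (m : ℤ) : L →ₗ[k] L :=
  DirectSum.toModule k ℤ L (fun i => (m * i).negOnePow • (ℒ i).subtype) ∘ₗ
    (DirectSum.decomposeLinearEquiv ℒ).toLinearMap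

/-- The projection of `L` to its even part (`j = 0`) or its odd part (`j = 1`). -/
def parityPart (ℒ : ℤ → Submodule k L) [DirectSum.Decomposition ℒ] (j : Fin 2) : L →ₗ[k] L :=
  DirectSum.toModule k ℤ L
      (fun i => if i % 2 = ((j : ℕ) : ℤ) then (ℒ i).subtype else 0) ∘ₗ
    (DirectSum.decomposeLinearEquiv ℒ).toLinearMap

/-- `f ∘ αₙ`, where `αₙ (a₁ ⊗ ⋯ ⊗ aₙ) = ∑_σ χ(σ, a) a_{σ(1)} ⊗ ⋯ ⊗ a_{σ(n)}` for homogeneous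
`aᵢ`. As `χ` depends only on the parities of the `aᵢ`, the arguments are split into even and odd
parts. -/
def compAntisymm (ℒ : ℤ → Submodule k L) [DirectSum.Decomposition ℒ] {n : ℕ}
    (f : MultilinearMap k (fun _ : Fin n => L) M) : MultilinearMap k (fun _ : Fin n => L) M :=
  ∑ σ : Equiv.Perm (Fin n), ∑ p : Fin n → Fin 2,
    chi σ (fun i => ((p i : ℕ) : ℤ)) •
      (f.domDomCongr σ).compLinearMap (fun i => parityPart ℒ (p i))

theorem koszulTwist_of_mem (ℒ : ℤ → Submodule k L) [DirectSum.Decomposition ℒ] (m i : ℤ)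
    {x : L} (hx : x ∈ ℒ i) : koszulTwist ℒ m x = (m * i).negOnePow • x := by
  simp only [koszulTwist, LinearMap.comp_apply, LinearEquiv.coe_coe,
    DirectSum.decomposeLinearEquiv_apply, DirectSum.decompose_of_mem ℒ hx]
  have := DirectSum.toModule_lof k (φ := fun i => (m * i).negOnePow • (ℒ i).subtype) i ⟨x, hx⟩
  simpa [DirectSum.lof_eq_of] using this

theorem parityPart_of_mem (ℒ : ℤ → Submodule k L) [DirectSum.Decomposition ℒ] (j : Fin 2) (i : ℤ)
    {x : L} (hx : x ∈ ℒ i) :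
    parityPart ℒ j x = if i % 2 = ((j : ℕ) : ℤ) then x else 0 := by
  simp only [parityPart, LinearMap.comp_apply, LinearEquiv.coe_coe,
    DirectSum.decomposeLinearEquiv_apply, DirectSum.decompose_of_mem ℒ hx]
  have := DirectSum.toModule_lof k
    (φ := fun i => if i % 2 = ((j : ℕ) : ℤ) then (ℒ i).subtype else 0) i ⟨x, hx⟩
  rw [DirectSum.lof_eq_of] at this
  rw [this]
  split_ifs <;> simp

/-- On homogeneous elements `f ∘ αₙ` is given by the sum over all permutations. -/
theorem compAntisymm_of_mem (ℒ : ℤ → Submodule k L) [DirectSum.Decomposition ℒ] {n : ℕ} (f : MultilinearMap k (fun _ : Fin n => L) M)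
    (p : Fin n → ℤ) (a : Fin n → L) (h : ∀ i, a i ∈ ℒ (p i)) :
    compAntisymm ℒ f a = ∑ σ : Equiv.Perm (Fin n), chi σ p • f (fun i => a (σ i)) := by
  simp only [compAntisymm, sum_apply, smul_apply, MultilinearMap.compLinearMap_apply,
    MultilinearMap.domDomCongr_apply]
  refine Finset.sum_congr rfl fun σ _ => ?_
  let q : Fin n → Fin 2 := fun i => ⟨(p i % 2).toNat, by omega⟩
  have hq : ∀ i, ((q i : ℕ) : ℤ) = p i % 2 := fun i => by simp [q]; omega
  rw [Finset.sum_eq_single q]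
  · congr 1
    · unfold chi
      refine Finset.prod_congr rfl fun i _ => Finset.prod_congr rfl fun j _ => ?_
      simp only [hq]
      split_ifs with h
      · congr 1
        rw [Int.negOnePow_eq_iff]
        have : (p (σ i) * p (σ j)) % 2 = ((p (σ i) % 2) * (p (σ j)%2)) % 2 := Int.mul_emod _ _ _
        rw [Int.even_iff]
        omega
      · rfl
    · congr 1; ext i
      rw [parityPart_of_mem ℒ _ _ (h (σ i)), if_pos (hq _).symm]
  · intro b _ hb
    obtain ⟨i, hi⟩ := Function.ne_iff.1 hb
    rw [MultilinearMap.map_coord_zero f (σ.symm i), smul_zero]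
    simp only [Equiv.apply_symm_apply]
    rw [parityPart_of_mem ℒ _ _ (h i), if_neg]
    intro h'
    apply hi; apply Fin.ext; have := hq i; omega
  · simp

end Graded

/-! ### `L_∞`-algebras and their morphisms -/

section LInfinity

variable {k : Type*} [CommRing k]
variable {L : Type*} [AddCommGroup L] [Module k L]
variable {M : Type*} [AddCommGroup M] [Module k M]

/-- For homogeneous `a₁, …, aₙ` of degrees `p`, the value at `a₁ ⊗ ⋯ ⊗ aₙ` of
`∑_{r + l = n + 1} (-1)^{r (l - 1)} f_l ∘ (μ_r ⊗ 1 ⊗ ⋯ ⊗ 1) ∘ α_{r,n}`, that is of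
`∑_r ∑_{σ ∈ Sh(r,n)} (-1)^{r (l - 1)} χ(σ)
  f_l (μ_r (a_{σ(1)}, …, a_{σ(r)}), a_{σ(r+1)}, …, a_{σ(n)})`. -/
def insertionSum (f : ∀ n : ℕ, MultilinearMap k (fun _ : Fin n => L) M)
    (μ : ∀ n : ℕ, MultilinearMap k (fun _ : Fin n => L) L)
    (n : ℕ) (p : Fin n → ℤ) (a : Fin n → L) : M :=
  ∑ r : Fin (n + 1), ∑ σ ∈ shuffles r n,
    (((r : ℤ) * ((n : ℤ) - r)).negOnePow * chi σ p) •
      f (n - r + 1)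
        (Fin.cons (μ r (fun i : Fin r => a (σ ⟨i, by omega⟩)))
          (fun i : Fin (n - r) => a (σ ⟨r + i, by omega⟩)))

/-- `(L, μ₁, μ₂, …)` is an `L_∞`-algebra (with the convention `μ₀ = 0`): `L` is a graded module,
`μₙ` is graded antisymmetric of degree `2 - n`, and the generalised Jacobi identities hold. -/
structure IsLInfinityAlgebra (ℒ : ℤ → Submodule k L)
    (μ : ∀ n : ℕ, MultilinearMap k (fun _ : Fin n => L) L) : Prop where
  graded : DirectSum.IsInternal ℒ
  zero : μ 0 = 0
  degree : ∀ n, HasDegree ℒ ℒ (μ n) (2 - n)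
  antisymm : ∀ n, IsGradedAntisymmetric ℒ (μ n)
  jacobi : ∀ (n : ℕ) (p : Fin n → ℤ) (a : Fin n → L), (∀ i, a i ∈ ℒ (p i)) →
    insertionSum μ μ n p a = 0

/-- For `I = (i₁, …, i_k)` with `|I| = n` and homogeneous `a₁, …, aₙ` of degrees `p`, the value at
`a₁ ⊗ ⋯ ⊗ aₙ` of `μ_k ∘ f_I`, where `f_I = 1 / (I! k!) (f_{i₁} ⊗ ⋯ ⊗ f_{i_k}) ∘ αₙ`.
The factor depending on `s < t` is the Koszul sign for moving `f_{i_t}`, of degree `1 - i_t`,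
past the arguments of `f_{i_s}`. -/
def compMulti [Algebra ℚ k] (μ : ∀ n : ℕ, MultilinearMap k (fun _ : Fin n => M) M)
    (f : ∀ n : ℕ, MultilinearMap k (fun _ : Fin n => L) M)
    {n : ℕ} (I : Composition n) (p : Fin n → ℤ) (a : Fin n → L) : M :=
  algebraMap ℚ k (1 / ((∏ s, (I.blocksFun s).factorial : ℕ) * (I.length.factorial : ℕ))) •
    ∑ σ : Equiv.Perm (Fin n),
      (chi σ p *
        ∏ s : Fin I.length, ∏ t : Fin I.length,
          if s < t then
            ((1 - (I.blocksFun t : ℤ)) * ∑ x, p (σ (I.embedding s x))).negOnePow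
          else 1) •
        μ I.length (fun s => f (I.blocksFun s) (fun x => a (σ (I.embedding s x))))

/-- The maps `fₙ : L^{⊗n} → M`, `n ≥ 1` (with the convention `f₀ = 0`), form an `L_∞`-morphism
`(L, μ) → (M, μ')`: they are graded antisymmetric of degree `1 - n` and satisfy
`∑_k ∑_{I ∈ ℕ^k, |I| = n} (-1)^{k(k-1)/2 + i₁(k-1) + ⋯ + i_{k-1}} μ'_k ∘ f_I
  = ∑_{r+l=n+1} (-1)^{r(l-1)} f_l ∘ (μ_r ⊗ 1 ⊗ ⋯ ⊗ 1) ∘ α_{r,n}`. -/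
structure IsLInfinityMorphism [Algebra ℚ k] (ℒ : ℤ → Submodule k L) (ℳ : ℤ → Submodule k M)
    (μ : ∀ n : ℕ, MultilinearMap k (fun _ : Fin n => L) L)
    (μ' : ∀ n : ℕ, MultilinearMap k (fun _ : Fin n => M) M)
    (f : ∀ n : ℕ, MultilinearMap k (fun _ : Fin n => L) M) : Prop where
  source : IsLInfinityAlgebra ℒ μ
  target : IsLInfinityAlgebra ℳ μ'
  zero : f 0 = 0
  degree : ∀ n, HasDegree ℒ ℳ (f n) (1 - n)
  antisymm : ∀ n, IsGradedAntisymmetric ℒ (f n)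
  comm : ∀ (n : ℕ) (p : Fin n → ℤ) (a : Fin n → L), (∀ i, a i ∈ ℒ (p i)) →
    ∑ I : Composition n,
        ((-1 : ℤˣ) ^ (I.length * (I.length - 1) / 2 +
          ∑ s : Fin I.length, I.blocksFun s * (I.length - 1 - s))) • compMulti μ' f I p a
      = insertionSum f μ n p a

/-- A multilinear map in one variable as a linear map. -/
def unary (f : MultilinearMap k (fun _ : Fin 1 => L) M) : L →ₗ[k] M :=
  (MultilinearMap.ofSubsingleton k L M (0 : Fin 1)).symm f

/-- The (co)homology `ker d / im d`. -/
abbrev Homology (d : L →ₗ[k] L) : Type _ :=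
  LinearMap.ker d ⧸ (LinearMap.range d).submoduleOf (LinearMap.ker d)

/-- The map induced on homology by a linear map commuting with the differentials. -/
def homologyMap {d : L →ₗ[k] L} {d' : M →ₗ[k] M} (f : L →ₗ[k] M) (h : f ∘ₗ d = d' ∘ₗ f) :
    Homology d →ₗ[k] Homology d' :=
  Submodule.mapQ _ _
    (f.restrict (p := LinearMap.ker d) (q := LinearMap.ker d') (fun x hx => by
      have := LinearMap.congr_fun h x
      simp only [LinearMap.comp_apply, LinearMap.mem_ker.1 hx, map_zero] at this
      exact LinearMap.mem_ker.2 this.symm))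
    (by
      rintro ⟨x, hx⟩ ⟨y, hy⟩
      exact ⟨f y, by
        have := LinearMap.congr_fun h y
        simp only [LinearMap.comp_apply] at this
        simp only [Submodule.subtype_apply] at hy
        rw [← this, hy]; rfl⟩)

/-- An `L_∞`-quasi-isomorphism: an `L_∞`-morphism `f` such that `f₁` is a quasi-isomorphism of
differential graded modules `(L, μ₁) → (M, μ'₁)`. -/
structure IsLInfinityQuasiIso [Algebra ℚ k] (ℒ : ℤ → Submodule k L) (ℳ : ℤ → Submodule k M)
    (μ : ∀ n : ℕ, MultilinearMap k (fun _ : Fin n => L) L)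
    (μ' : ∀ n : ℕ, MultilinearMap k (fun _ : Fin n => M) M)
    (f : ∀ n : ℕ, MultilinearMap k (fun _ : Fin n => L) M) : Prop where
  morphism : IsLInfinityMorphism ℒ ℳ μ μ' f
  quasiIso : ∃ h : unary (f 1) ∘ₗ unary (μ 1) = unary (μ' 1) ∘ₗ unary (f 1),
    Function.Bijective (homologyMap (unary (f 1)) h)

end LInfinity

/-! ### Differential graded Lie algebras and splittings -/

section DGL

variable {k : Type*} [CommRing k]
variable {L : Type*} [AddCommGroup L] [Module k L]

/-- A differential graded Lie algebra structure `(d, [·,·])` on the graded module `L`, with `d` of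
degree `+1` and `[·,·]` of degree `0`. -/
structure DGLieAlgebra (ℒ : ℤ → Submodule k L) where
  d : L →ₗ[k] L
  bracket : L →ₗ[k] L →ₗ[k] L
  d_degree : ∀ (i : ℤ) (x : L), x ∈ ℒ i → d x ∈ ℒ (i + 1)
  bracket_degree : ∀ (i j : ℤ) (x y : L), x ∈ ℒ i → y ∈ ℒ j → bracket x y ∈ ℒ (i + j)
  d_d : ∀ x, d (d x) = 0
  antisymm : ∀ (i j : ℤ) (x y : L), x ∈ ℒ i → y ∈ ℒ j →
    bracket x y = -((i * j).negOnePow • bracket y x)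
  jacobi : ∀ (i j : ℤ) (x y z : L), x ∈ ℒ i → y ∈ ℒ j →
    bracket x (bracket y z) =
      bracket (bracket x y) z + (i * j).negOnePow • bracket y (bracket x z)
  leibniz : ∀ (i : ℤ) (x y : L), x ∈ ℒ i →
    d (bracket x y) = bracket (d x) y + i.negOnePow • bracket x (d y)

/-- A bilinear map as a multilinear map in two variables. -/
def binary (b : L →ₗ[k] L →ₗ[k] L) : MultilinearMap k (fun _ : Fin 2 => L) L :=
  MultilinearMap.mk' (fun a => b (a 0) (a 1))
    (by intro a i x y; fin_cases i <;> simp)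
    (by intro a i c x; fin_cases i <;> simp)

/-- A differential graded Lie algebra as an `L_∞`-algebra: `μ₁ = d`, `μ₂ = [·,·]` and `μₙ = 0`
otherwise. -/
def DGLieAlgebra.toLInfinity {ℒ : ℤ → Submodule k L} (D : DGLieAlgebra ℒ) :
    ∀ n : ℕ, MultilinearMap k (fun _ : Fin n => L) L
  | 1 => MultilinearMap.ofSubsingleton k L L (0 : Fin 1) D.d
  | 2 => binary D.bracket
  | _ => 0

/-- A splitting `η` of `(L, d)`: `η` has degree `-1`, `d η d = d`, `η² = 0` and `η d η = η`. -/
structure IsSplitting {ℒ : ℤ → Submodule k L} (D : DGLieAlgebra ℒ) (η : L →ₗ[k] L) : Prop where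
  degree : ∀ (i : ℤ) (x : L), x ∈ ℒ i → η x ∈ ℒ (i - 1)
  d_η_d : ∀ x, D.d (η (D.d x)) = D.d x
  η_η : ∀ x, η (η x) = 0
  η_d_η : ∀ x, η (D.d (η x)) = η x

/-- `H = ker [d, η]`, where `[d, η] = d η + η d` is the graded commutator. -/
def harmonic {ℒ : ℤ → Submodule k L} (D : DGLieAlgebra ℒ) (η : L →ₗ[k] L) : Submodule k L :=
  LinearMap.ker (D.d ∘ₗ η + η ∘ₗ D.d)

/-- The grading that a submodule inherits. -/
def inducedGrading (ℒ : ℤ → Submodule k L) (H : Submodule k L) : ℤ → Submodule k H :=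
  fun i => (ℒ i).comap H.subtype

/-- The bilinear map `g = η [·,·]`. -/
def etaBracket {ℒ : ℤ → Submodule k L} (D : DGLieAlgebra ℒ) (η : L →ₗ[k] L) :
    L →ₗ[k] L →ₗ[k] L :=
  D.bracket.compr₂ η

/-- The bilinear map `(1 - [d, η]) [·,·]`. -/
def projBracket {ℒ : ℤ → Submodule k L} (D : DGLieAlgebra ℒ) (η : L →ₗ[k] L) :
    L →ₗ[k] L →ₗ[k] L :=
  D.bracket.compr₂ (LinearMap.id - (D.d ∘ₗ η + η ∘ₗ D.d))

theorem projBracket_mem {ℒ : ℤ → Submodule k L} {D : DGLieAlgebra ℒ} {η : L →ₗ[k] L}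
    (hη : IsSplitting D η) (x y : L) : projBracket D η x y ∈ harmonic D η := by
  simp [harmonic, projBracket, hη.d_η_d, hη.η_η, hη.η_d_η, D.d_d]

end DGL

/-! ### Oriented binary trees

Oriented trees with `n` leaves, up to oriented equivalence, are the plane binary trees with `n - 1`
internal nodes (the ramifications); `BinaryTree.treesOfNumNodesEq (n - 1)` is the finite set of
them. -/

section Trees

variable {k : Type*} [CommRing k]
variable {L : Type*} [AddCommGroup L] [Module k L]

/-- The list, from left to right, of the numbers `w_φ(i)` of left turns on the way from the root to
the `i`-th leaf. -/
def leftTurns {α : Type*} : BinaryTree α → List ℕ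
  | nil => [0]
  | node _ l r => (leftTurns l).map (· + 1) ++ leftTurns r

/-- `e(φ) = (-1)^{w_φ(1) + ⋯ + w_φ(n)}`. -/
def treeSign {α : Type*} (φ : BinaryTree α) : ℤˣ := (-1) ^ (leftTurns φ).sum

/-- The degree of `φ(B)`, where each ramification `K` carries the degree of `b_K` and `b_K`. -/
def treeDegree : BinaryTree (ℤ × (L →ₗ[k] L →ₗ[k] L)) → ℤ
  | nil => 0
  | node b l r => b.1 + treeDegree l + treeDegree r

/-- The multilinear map `φ(B) : L^{⊗n} → L` for a tree whose ramifications `K` carry homogeneous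
bilinear maps `b_K` (together with their degrees): `Id` for the tree with one leaf, and
`b₀ ∘ (φ₁(B₁) ⊗ φ₂(B₂))`, with the Koszul sign convention, for a tree with root label `b₀` and left
and right branches `φ₁` and `φ₂`. -/
def treeEval (ℒ : ℤ → Submodule k L) [DirectSum.Decomposition ℒ] :
    (φ : BinaryTree (ℤ × (L →ₗ[k] L →ₗ[k] L))) →
      MultilinearMap k (fun _ : Fin φ.numLeaves => L) L
  | nil => MultilinearMap.ofSubsingleton k L L (0 : Fin 1) LinearMap.id
  | node b l r =>
      (TensorProduct.lift b.2).compMultilinearMap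
        ((((treeEval ℒ l).compLinearMap (fun _ => koszulTwist ℒ (treeDegree r))).domCoprod
          (treeEval ℒ r)).domDomCongr finSumFinEquiv)

/-- The family `(b₀, b, …, b)` on the ramifications of `φ`, with `b₀` at the root. -/
def decorate {α : Type*} (b₀ b : α) : BinaryTree Unit → BinaryTree α
  | nil => nil
  | node _ l r => node b₀ (l.map fun _ => b) (r.map fun _ => b)

theorem numLeaves_map {α β : Type*} (f : α → β) (φ : BinaryTree α) :
    (φ.map f).numLeaves = φ.numLeaves := by
  induction φ with
  | nil => rfl
  | node a l r hl hr => simp [BinaryTree.map, hl, hr]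

theorem numLeaves_decorate {α : Type*} (b₀ b : α) {n : ℕ} {φ : BinaryTree Unit}
    (h : φ ∈ treesOfNumNodesEq n) : (decorate b₀ b φ).numLeaves = n + 1 := by
  rw [mem_treesOfNumNodesEq] at h
  rw [← h, ← numLeaves_eq_numNodes_succ]
  cases φ with
  | nil => rfl
  | node a l r => simp [decorate, numLeaves_map]

/-- `∑_{φ ∈ Ot(n+1)} e(φ) φ(b₀, b, …, b) ∘ α_{n+1}`. -/
def treeSum (ℒ : ℤ → Submodule k L) [DirectSum.Decomposition ℒ]
    (b₀ b : ℤ × (L →ₗ[k] L →ₗ[k] L)) (n : ℕ) :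
    MultilinearMap k (fun _ : Fin (n + 1) => L) L :=
  ∑ φ ∈ (treesOfNumNodesEq n).attach,
    treeSign φ.1 •
      compAntisymm ℒ ((treeEval ℒ (decorate b₀ b φ.1)).domDomCongr
        (finCongr (numLeaves_decorate b₀ b φ.2)))

theorem treeSum_mem (ℒ : ℤ → Submodule k L) [DirectSum.Decomposition ℒ]
    (b₀ b : ℤ × (L →ₗ[k] L →ₗ[k] L)) (n : ℕ) (S : Submodule k L)
    (hS : ∀ x y, b₀.2 x y ∈ S) (a : Fin (n + 2) → L) : treeSum ℒ b₀ b (n + 1) a ∈ S := by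
  have key : ∀ (φ : BinaryTree Unit), φ ∈ treesOfNumNodesEq (n + 1) →
      ∀ v, treeEval ℒ (decorate b₀ b φ) v ∈ S := by
    intro φ hφ v
    cases φ with
    | nil => simp [mem_treesOfNumNodesEq] at hφ
    | node u l r => exact hS _ _
  have units : ∀ (u : ℤˣ) (x : L), x ∈ S → u • x ∈ S := by
    intro u x hx
    rcases Int.units_eq_one_or u with rfl | rfl <;> simpa using hx
  simp only [treeSum, compAntisymm, sum_apply, smul_apply]
  refine Submodule.sum_mem _ fun φ _ => units _ _ ?_
  refine Submodule.sum_mem _ fun σ _ => Submodule.sum_mem _ fun p _ => units _ _ ?_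
  exact key _ φ.2 _

end Trees

/-! ### The minimal model and the quasi-isomorphism -/

section Model

variable {k : Type*} [CommRing k] [Algebra ℚ k]
variable {L : Type*} [AddCommGroup L] [Module k L]
variable {ℒ : ℤ → Submodule k L} [DirectSum.Decomposition ℒ]

/-- The operations on `H = ker [d, η]`: `μ₁ = 0` and, for `n ≥ 2`,
`μₙ = -(1/2)^{n-1} ∑_{φ ∈ Ot(n)} e(φ) φ((1 - [d,η])[·,·], g, …, g) ∘ αₙ`. -/
def minimalModel (D : DGLieAlgebra ℒ) {η : L →ₗ[k] L} (hη : IsSplitting D η) :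
    ∀ n : ℕ, MultilinearMap k (fun _ : Fin n => harmonic D η) (harmonic D η)
  | 0 => 0
  | 1 => 0
  | n + 2 =>
      algebraMap ℚ k (-(1 / 2) ^ (n + 1)) •
        ((treeSum ℒ (0, projBracket D η) (-1, etaBracket D η) (n + 1)).compLinearMap
          (fun _ => (harmonic D η).subtype)).codRestrict (harmonic D η)
            (fun _ => treeSum_mem ℒ _ _ n _ (projBracket_mem hη) _)

/-- The maps `fₙ : H^{⊗n} → L`: `f₁` is the inclusion and, for `n ≥ 2`,
`fₙ = (1/2)^{n-1} ∑_{φ ∈ Ot(n)} e(φ) φ(g, …, g) ∘ αₙ`. -/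
def modelMap (D : DGLieAlgebra ℒ) (η : L →ₗ[k] L) :
    ∀ n : ℕ, MultilinearMap k (fun _ : Fin n => harmonic D η) L
  | 0 => 0
  | 1 => MultilinearMap.ofSubsingleton k (harmonic D η) L (0 : Fin 1) (harmonic D η).subtype
  | n + 2 =>
      algebraMap ℚ k ((1 / 2) ^ (n + 1)) •
        (treeSum ℒ (-1, etaBracket D η) (-1, etaBracket D η) (n + 1)).compLinearMap
          (fun _ => (harmonic D η).subtype)

end Model

end

end LInfinity

namespace LInfinity

noncomputable section

/-! ### Orderings of finite sets -/

section Orderings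

variable {ι : Type*}

/-! The tree formulas are the multilinear expansion of the solution of a fixed point equation, and
the theorem is a statement about the curvature of that solution. Fix homogeneous elements a_i and
index all values by finite sets S of labels. Multiplied by the décalage sign, the tree sums form a
family F_S of total degree one with respect to the shifted degrees |a_i| - 1. Such families have a
bracket [X, Y]_S = ∑ ± [X_A, Y_B] over the decompositions S = A ⊔ B (`convBracket`), and for a
family X of degree one d[X, X] = 2[dX, X] (`d_convBracket_self`) and [[X, X], X] = 0
(`convBracket_jacobi`; this needs 1/3). Cutting trees at the root (`treeOn_eq`) gives F = a + η ½[F,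
F], where a lives on singletons (`shiftedTree_eq`). If the a_i are closed, then dF = dη ½[F, F]
(`d_shiftedTree`).

Put Q = ½[F, F], P = 1 - [d, η] and R = dF - Q. Then dQ = [dF, F] = [R, F], because [Q, F] = 0
(`d_halfSquare`), and R = dηQ - Q = -PQ - ηdQ = -PQ - η[R, F]. As F vanishes on ∅, this linear
recursion has only one solution (`convBracket_rec_unique`). On the other hand -PQ_A is the operation
μ_A up to décalage. Cutting at the root the trees whose first argument is μ_A (`consTree_eq`) and
summing over A shows that the sums ∑ ± f(μ_A, a_C) over S = A ⊔ C obey the same recursion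
(`insertSum_convBracket`). So they equal R, which is the morphism equation dF - ½[F, F] = ∑ ± f(μ_A,
a_C) (`curvature_eq_insertSum`). With P in place of η at the root, the sum of the μ(μ_A, a_C)
becomes, up to sign, P[R, F] = PdQ = 0, because Pd = 0; these are the generalised Jacobi identities
(`insertSum_proj_eq_zero`).

What remains is translation. Permutations and shuffles are replaced by words of labels and then by
subsets (`sum_perm_eq_sum_orderings`, `sum_orderings_take_drop`, `sum_shuffles`), the target
contributes only μ'_1 and μ'_2 (`sum_compMulti`), and `decalage_mul_splitSign` and
`decalage_mul_insert_sign` match the signs. On homology, a closed x is cohomologous to the harmonic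
element x - dηx, and a harmonic boundary x = dy equals dηdy = dηx = 0. -/

/-- The lists that enumerate the finite set `S` without repetition. -/
def orderings (S : Finset ι) : Finset (List ι) :=
  ⟨Multiset.lists S.val, Multiset.lists_nodup_finset S⟩

theorem mem_orderings {S : Finset ι} {l : List ι} :
    l ∈ orderings S ↔ (l : Multiset ι) = S.val := by
  change l ∈ Multiset.lists S.val ↔ _
  rw [Multiset.mem_lists_iff, eq_comm]; rfl

theorem length_of_mem_orderings {S : Finset ι} {l : List ι} (h : l ∈ orderings S) :
    l.length = S.card := by
  rw [Finset.card, ← mem_orderings.1 h, Multiset.coe_card]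

theorem nodup_of_mem_orderings {S : Finset ι} {l : List ι} (h : l ∈ orderings S) :
    l.Nodup := by
  rw [← Multiset.coe_nodup, mem_orderings.1 h]; exact S.nodup

theorem mem_of_mem_orderings {S : Finset ι} {l : List ι} (h : l ∈ orderings S) {x : ι} :
    x ∈ l ↔ x ∈ S := by
  rw [← Multiset.mem_coe, mem_orderings.1 h]; rfl

theorem prod_map_of_mem_orderings {N : Type*} [CommMonoid N] {S : Finset ι} {l : List ι}
    (h : l ∈ orderings S) (f : ι → N) : (l.map f).prod = ∏ x ∈ S, f x := by
  rw [Finset.prod_eq_multiset_prod, ← mem_orderings.1 h, Multiset.map_coe, Multiset.prod_coe]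

theorem sum_map_of_mem_orderings {N : Type*} [AddCommMonoid N] {S : Finset ι} {l : List ι}
    (h : l ∈ orderings S) (f : ι → N) : (l.map f).sum = ∑ x ∈ S, f x := by
  rw [Finset.sum_eq_multiset_sum, ← mem_orderings.1 h, Multiset.map_coe, Multiset.sum_coe]

theorem mem_orderings_of_nodup {S : Finset ι} {l : List ι} (h : l.Nodup)
    (h' : ∀ x, x ∈ l ↔ x ∈ S) : l ∈ orderings S := by
  rw [mem_orderings]
  exact (Multiset.Nodup.ext (Multiset.coe_nodup.2 h) S.nodup).2 (by simpa using h')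

theorem exists_perm_of_mem_orderings {n : ℕ} (e : Fin n ↪ ι) {l : List ι}
    (hl : l ∈ orderings (Finset.univ.map e)) :
    ∃ σ : Equiv.Perm (Fin n), (List.ofFn fun i => e (σ i)) = l := by
  have hlen : l.length = n := by rw [length_of_mem_orderings hl]; simp
  subst hlen
  have hex : ∀ i : Fin l.length, ∃ j, e j = l.get i := by
    intro i
    have := (mem_of_mem_orderings hl).1 (l.get_mem i)
    simpa using this
  choose s hs using hex
  have hinj : Function.Injective s := by
    intro i j hij
    have := congrArg e hij
    rw [hs, hs] at this
    exact (nodup_of_mem_orderings hl).injective_get this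
  refine ⟨Equiv.ofBijective s (Finite.injective_iff_bijective.1 hinj), ?_⟩
  simp only [Equiv.ofBijective_apply, hs]
  exact List.ofFn_get l

/-- A sum over the permutations as a sum over the orderings. -/
theorem sum_perm_eq_sum_orderings {N : Type*} [AddCommMonoid N] {n : ℕ} (e : Fin n ↪ ι)
    (h : List ι → N) :
    ∑ σ : Equiv.Perm (Fin n), h (List.ofFn fun i => e (σ i)) =
      ∑ l ∈ orderings (Finset.univ.map e), h l := by
  refine Finset.sum_bij (fun σ _ => List.ofFn fun i => e (σ i)) ?_ ?_ ?_ ?_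
  · intro σ _
    refine mem_orderings_of_nodup (List.nodup_ofFn.2 (e.injective.comp σ.injective)) fun x => ?_
    simp only [List.mem_ofFn, Finset.mem_map, Finset.mem_univ, true_and]
    exact (σ.surjective.exists (p := fun i => e i = x)).symm
  · intro σ _ τ _ hστ
    have := List.ofFn_injective hστ
    ext i
    exact congrArg Fin.val (e.injective (congrFun this i))
  · intro l hl
    obtain ⟨σ, hσ⟩ := exists_perm_of_mem_orderings e hl
    exact ⟨σ, Finset.mem_univ _, hσ⟩
  · intro σ _; rfl

/-- Counts the equal terms that antisymmetry produces, and so cancels the factorials of f_I in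
`compMulti_pair`. -/
theorem card_orderings (S : Finset ι) : (orderings S).card = S.card.factorial := by
  have h := sum_perm_eq_sum_orderings (N := ℕ)
    (S.equivFin.symm.toEmbedding.trans (Function.Embedding.subtype _)) fun _ => 1
  have hS : Finset.univ.map (S.equivFin.symm.toEmbedding.trans (Function.Embedding.subtype _))
      = S := by
    ext x
    simp only [Finset.mem_map, Finset.mem_univ, true_and, Function.Embedding.trans_apply,
      Equiv.coe_toEmbedding, Function.Embedding.subtype_apply]
    exact ⟨by rintro ⟨i, rfl⟩; exact (S.equivFin.symm i).2,
      fun hx => ⟨S.equivFin ⟨x, hx⟩, by simp⟩⟩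
  rw [hS] at h
  simp only [Finset.sum_const, smul_eq_mul, mul_one] at h
  rw [← h, Finset.card_univ, Fintype.card_perm, Fintype.card_fin]

variable [DecidableEq ι]

/-- Cutting an ordering of `S` after `r` elements. -/
theorem sum_orderings_take_drop {N : Type*} [AddCommMonoid N] (S : Finset ι) (r : ℕ)
    (hr : r ≤ S.card) (h : List ι → List ι → N) :
    ∑ l ∈ orderings S, h (l.take r) (l.drop r) =
      ∑ A ∈ S.powersetCard r, ∑ u ∈ orderings A, ∑ v ∈ orderings (S \ A), h u v := by
  simp_rw [← Finset.sum_product']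
  rw [Finset.sum_sigma']
  refine Finset.sum_bij' (fun l _ => ⟨(l.take r).toFinset, (l.take r, l.drop r)⟩)
    (fun x _ => x.2.1 ++ x.2.2) ?_ ?_ ?_ ?_ ?_
  · intro l hl
    have hnd := nodup_of_mem_orderings hl
    have hnd' : (l.take r ++ l.drop r).Nodup := by rwa [List.take_append_drop]
    rw [List.nodup_append'] at hnd'
    simp only [Finset.mem_sigma, Finset.mem_product, Finset.mem_powersetCard]
    refine ⟨⟨fun x hx => ?_, ?_⟩, ?_, ?_⟩
    · rw [List.mem_toFinset] at hx
      exact (mem_of_mem_orderings hl).1 (List.mem_of_mem_take hx)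
    · rw [List.toFinset_card_of_nodup hnd'.1, List.length_take, length_of_mem_orderings hl]
      omega
    · exact mem_orderings_of_nodup hnd'.1 (by simp)
    · refine mem_orderings_of_nodup hnd'.2.1 fun x => ?_
      have hx : x ∈ S ↔ x ∈ l.take r ∨ x ∈ l.drop r := by
        rw [← List.mem_append, List.take_append_drop, mem_of_mem_orderings hl]
      have := @hnd'.2.2 x
      simp only [Finset.mem_sdiff, List.mem_toFinset]
      tauto
  · rintro ⟨A, u, v⟩ hx
    simp only [Finset.mem_sigma, Finset.mem_product, Finset.mem_powersetCard] at hx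
    obtain ⟨⟨hA, -⟩, hu, hv⟩ := hx
    rw [mem_orderings, ← Multiset.coe_add, mem_orderings.1 hu, mem_orderings.1 hv]
    rw [Finset.sdiff_val, add_tsub_cancel_of_le (Finset.val_le_iff.2 hA)]
  · intro l _
    exact List.take_append_drop r l
  · rintro ⟨A, u, v⟩ hx
    simp only [Finset.mem_sigma, Finset.mem_product, Finset.mem_powersetCard] at hx
    obtain ⟨⟨hA, hc⟩, hu, hv⟩ := hx
    have hl : u.length = r := by rw [length_of_mem_orderings hu, hc]
    have h1 : (u ++ v).take r = u := by simp [← hl]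
    have h2 : (u ++ v).drop r = v := by simp [← hl]
    have h3 : u.toFinset = A := by ext x; simp [mem_of_mem_orderings hu]
    simp only [h1, h2, h3]
  · intro l _; rfl

end Orderings

/-! ### Signs of orderings -/

section Signs

variable {ι : Type*} [LinearOrder ι]

/-- The sign that an inversion `x, y` with `y < x` contributes to `chi`. -/
def pairSign (p : ι → ℤ) (x y : ι) : ℤˣ := if y < x then -(p x * p y).negOnePow else 1

/-- The product of the signs of the inversions of a list. -/
def listChi (p : ι → ℤ) : List ι → ℤˣ
  | [] => 1
  | x :: l => (l.map (pairSign p x)).prod * listChi p l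

/-- The sign of the shuffle that moves `B` past `A`. -/
def cross (p : ι → ℤ) (A B : Finset ι) : ℤˣ := ∏ x ∈ A, ∏ y ∈ B, pairSign p x y

theorem listChi_append (p : ι → ℤ) (u v : List ι) :
    listChi p (u ++ v) =
      listChi p u * listChi p v * (u.map fun x => (v.map (pairSign p x)).prod).prod := by
  induction u with
  | nil => simp [listChi]
  | cons x u ih =>
    simp only [List.cons_append, listChi, List.map_append, List.prod_append, ih, List.map_cons,
      List.prod_cons]
    ac_rfl

/-- The inversions between the two words depend only on their sets of letters, so a signed sum over
the words of a set, cut in two, separates into independent signed sums over the words of `A` and of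
`B`. -/
theorem listChi_append_of_mem_orderings (p : ι → ℤ) {A B : Finset ι} {u v : List ι}
    (hu : u ∈ orderings A) (hv : v ∈ orderings B) :
    listChi p (u ++ v) = listChi p u * listChi p v * cross p A B := by
  rw [listChi_append, cross, prod_map_of_mem_orderings hu]
  simp only [prod_map_of_mem_orderings hv]

theorem listChi_of_pairwise_lt (p : ι → ℤ) {l : List ι} (h : l.Pairwise (· < ·)) :
    listChi p l = 1 := by
  induction l with
  | nil => rfl
  | cons x l ih =>
    rw [List.pairwise_cons] at h
    rw [listChi, ih h.2, mul_one]
    refine List.prod_eq_one fun s hs => ?_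
    obtain ⟨y, hy, rfl⟩ := List.mem_map.1 hs
    rw [pairSign, if_neg (h.1 y hy).le.not_gt]

theorem listChi_ofFn (p : ι → ℤ) {n : ℕ} (s : Fin n → ι) :
    listChi p (List.ofFn s) =
      ∏ i : Fin n, ∏ j : Fin n, if i < j then pairSign p (s i) (s j) else 1 := by
  induction n with
  | zero => simp [listChi]
  | succ n ih =>
    rw [List.ofFn_succ, listChi, ih, Fin.prod_univ_succ]
    simp only [Fin.prod_univ_succ, lt_self_iff_false, if_false, Fin.succ_pos, if_true, one_mul,
      Fin.not_lt_zero, Fin.succ_lt_succ_iff, List.map_ofFn, List.prod_ofFn, Function.comp]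

/-- An order embedding preserves inversions, so the sign can be read off from the word of labels,
independently of `Fin n`. -/
theorem chi_eq_listChi {n : ℕ} (p : ι → ℤ) (e : Fin n ↪o ι) (σ : Equiv.Perm (Fin n)) :
    chi σ (fun i => p (e i)) = listChi p (List.ofFn fun i => e (σ i)) := by
  rw [listChi_ofFn, chi]
  refine Finset.prod_congr rfl fun i _ => Finset.prod_congr rfl fun j _ => ?_
  simp only [pairSign, OrderEmbedding.lt_iff_lt, ite_and]

/-- Reindexing a product over pairs along a permutation. -/
theorem prod_lt_perm {N : Type*} [CommMonoid N] {n : ℕ} (u : Fin n → Fin n → N)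
    (hu : ∀ i j, u i j = u j i) (τ : Equiv.Perm (Fin n)) :
    ∏ i, ∏ j, (if i < j then u (τ i) (τ j) else 1) = ∏ i, ∏ j, if i < j then u i j else 1 := by
  have h1 : ∏ i, ∏ j, (if i < j then u (τ i) (τ j) else 1) =
      ∏ i, ∏ j, if τ.symm i < τ.symm j then u i j else 1 := by
    rw [← Equiv.prod_comp τ fun i => ∏ j, if τ.symm i < τ.symm j then u i j else 1]
    refine Finset.prod_congr rfl fun i _ => ?_
    rw [← Equiv.prod_comp τ fun j => if τ.symm (τ i) < τ.symm j then u (τ i) j else 1]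
    simp
  -- Both products are split according to whether `τ.symm` preserves or reverses the order of the
  -- pair; the reversed parts agree after exchanging the indices.
  have h2 : ∀ i j, (if τ.symm i < τ.symm j then u i j else 1) =
      (if i < j ∧ τ.symm i < τ.symm j then u i j else 1) *
        (if j < i ∧ τ.symm i < τ.symm j then u j i else 1) := by
    intro i j
    rcases lt_trichotomy i j with h | rfl | h
    · simp [h, h.not_gt]
    · simp
    · simp [h, h.not_gt, hu i j]
  have h3 : ∀ i j, (if i < j then u i j else 1) =
      (if i < j ∧ τ.symm i < τ.symm j then u i j else 1) *
        (if i < j ∧ τ.symm j < τ.symm i then u i j else 1) := by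
    intro i j
    by_cases h : i < j
    · rcases lt_trichotomy (τ.symm i) (τ.symm j) with h' | h' | h'
      · simp [h, h', h'.not_gt]
      · exact absurd (τ.symm.injective h') h.ne
      · simp [h, h', h'.not_gt]
    · simp [h]
  rw [h1]
  simp only [h2, h3, Finset.prod_mul_distrib]
  congr 1
  exact Finset.prod_comm

/-- Cocycle rule: `σ * τ` inverts a pair when exactly one of the two happens, that `τ` inverts it or
that `σ` inverts its image; if both happen, the two equal signs cancel. -/
theorem chi_mul {n : ℕ} (σ τ : Equiv.Perm (Fin n)) (p : Fin n → ℤ) :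
    chi (σ * τ) p = chi σ p * chi τ (fun i => p (σ i)) := by
  -- The inversion condition is made symmetric in `i` and `j`, as `prod_lt_perm` requires.
  have h : chi σ p = ∏ i, ∏ j, if i < j then
      (if (i < j ∧ σ j < σ i) ∨ (j < i ∧ σ i < σ j) then -(p (σ i) * p (σ j)).negOnePow else 1)
      else 1 := by
    refine Finset.prod_congr rfl fun i _ => Finset.prod_congr rfl fun j _ => ?_
    by_cases hij : i < j
    · simp [hij, hij.not_gt]
    · simp [hij]
  rw [h, ← prod_lt_perm _ _ τ]
  · simp only [chi, ← Finset.prod_mul_distrib]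
    refine Finset.prod_congr rfl fun i _ => Finset.prod_congr rfl fun j _ => ?_
    simp only [Equiv.Perm.mul_apply]
    by_cases hij : i < j
    · have hne : τ i ≠ τ j := fun h => hij.ne (τ.injective h)
      have hne' : σ (τ i) ≠ σ (τ j) := fun h => hne (σ.injective h)
      rcases lt_or_gt_of_ne hne with h1 | h1 <;> rcases lt_or_gt_of_ne hne' with h2 | h2 <;>
        simp [hij, h1, h2, h1.not_gt, h2.not_gt]
    · simp [hij]
  · intro i j
    exact if_congr or_comm (by rw [mul_comm]) rfl

end Signs

/-! ### Units of `ℤ` as scalars -/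

section UnitScalars

variable {k : Type*} [CommRing k]
variable {L : Type*} [AddCommGroup L] [Module k L]
variable {M : Type*} [AddCommGroup M] [Module k M]

theorem map_unit_smul (f : L →ₗ[k] M) (u : ℤˣ) (x : L) : f (u • x) = u • f x := by
  rw [Units.smul_def, Units.smul_def, map_zsmul]

theorem unit_smul_mem (S : Submodule k L) (u : ℤˣ) {x : L} (hx : x ∈ S) : u • x ∈ S := by
  rw [Units.smul_def]; exact zsmul_mem hx _

theorem map_unit_smul_univ {n : ℕ} (f : MultilinearMap k (fun _ : Fin n => L) M)
    (u : Fin n → ℤˣ) (v : Fin n → L) : f (fun i => u i • v i) = (∏ i, u i) • f v := by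
  have h : ∀ i, u i • v i = (((u i : ℤ) : k)) • v i := fun i => by
    rw [Units.smul_def, Int.cast_smul_eq_zsmul]
  simp only [h]
  rw [MultilinearMap.map_smul_univ, Units.smul_def, Units.coe_prod, ← Int.cast_smul_eq_zsmul k,
    Int.cast_prod]

theorem negOnePow_sum {α : Type*} (s : Finset α) (f : α → ℤ) :
    (∑ i ∈ s, f i).negOnePow = ∏ i ∈ s, (f i).negOnePow := by
  classical
  induction s using Finset.induction_on with
  | empty => simp
  | insert x s hx ih => rw [Finset.sum_insert hx, Finset.prod_insert hx, Int.negOnePow_add, ih]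

end UnitScalars

/-! ### Evaluating trees on words -/

section TreeWords

variable {k : Type*} [CommRing k]
variable {L : Type*} [AddCommGroup L] [Module k L]

theorem length_leftTurns {α : Type*} (φ : BinaryTree α) :
    (leftTurns φ).length = φ.numLeaves := by
  induction φ with
  | nil => rfl
  | node a l r hl hr => simp [leftTurns, hl, hr]

/-- Every leaf of the left branch makes one more left turn, hence one sign for each of them. -/
theorem treeSign_node {α : Type*} (a : α) (l r : BinaryTree α) :
    treeSign (node a l r) = (-1) ^ l.numLeaves * (treeSign l * treeSign r) := by
  simp only [treeSign, leftTurns, List.sum_append]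
  have h : ((leftTurns l).map (· + 1)).sum = (leftTurns l).sum + l.numLeaves := by
    rw [List.sum_map_add]; simp [length_leftTurns]
  rw [h, pow_add, pow_add]
  ac_rfl

theorem decorate_self {α : Type*} (b : α) (φ : BinaryTree Unit) :
    decorate b b φ = φ.map fun _ => b := by
  cases φ <;> rfl

theorem treeDegree_map (b : ℤ × (L →ₗ[k] L →ₗ[k] L)) (φ : BinaryTree Unit) :
    treeDegree (φ.map fun _ => b) = φ.numNodes * b.1 := by
  induction φ with
  | nil => simp [BinaryTree.map, treeDegree]
  | node a l r hl hr => simp only [BinaryTree.map, treeDegree, hl, hr, numNodes]; push_cast; ring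

variable (ℒ : ℤ → Submodule k L)

/-- A bilinear map together with its degree. -/
def IsHomogeneousBilinear (b : ℤ × (L →ₗ[k] L →ₗ[k] L)) : Prop :=
  ∀ (i j : ℤ) (x y : L), x ∈ ℒ i → y ∈ ℒ j → b.2 x y ∈ ℒ (i + j + b.1)

theorem getD_map_mem {ι : Type*} {p : ι → ℤ} {a : ι → L} (ha : ∀ i, a i ∈ ℒ (p i)) (w : List ι)
    (i : ℕ) : (w.map a).getD i 0 ∈ ℒ ((w.map p).getD i 0) := by
  by_cases h : i < w.length
  · simpa [List.getD, h] using ha _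
  · simp [List.getD, h]

theorem sum_getD_eq (w : List ℤ) {n : ℕ} (h : w.length = n) : ∑ i : Fin n, w.getD i 0 = w.sum := by
  subst h
  rw [← List.sum_ofFn]
  congr 1
  apply List.ext_get <;> simp

variable [DirectSum.Decomposition ℒ]

theorem koszulTwist_mem (m : ℤ) {i : ℤ} {x : L} (hx : x ∈ ℒ i) : koszulTwist ℒ m x ∈ ℒ i := by
  rw [koszulTwist_of_mem ℒ m i hx]; exact unit_smul_mem _ _ hx

theorem treeEval_node (b : ℤ × (L →ₗ[k] L →ₗ[k] L)) (l r : BinaryTree (ℤ × (L →ₗ[k] L →ₗ[k] L)))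
    (v : Fin (node b l r).numLeaves → L) :
    treeEval ℒ (node b l r) v =
      b.2 (treeEval ℒ l fun i => koszulTwist ℒ (treeDegree r) (v (Fin.castAdd r.numLeaves i)))
        (treeEval ℒ r fun i => v (Fin.natAdd l.numLeaves i)) := rfl

theorem treeEval_map_mem {b : ℤ × (L →ₗ[k] L →ₗ[k] L)} (hb : IsHomogeneousBilinear ℒ b)
    (φ : BinaryTree Unit) :
    HasDegree ℒ ℒ (treeEval ℒ (φ.map fun _ => b)) (φ.numNodes * b.1) := by
  induction φ with
  | nil =>
    intro p a ha
    have := ha (0 : Fin 1)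
    have hs : ∑ i, p i = p (0 : Fin 1) := Fin.sum_univ_one p
    rw [hs, numNodes, Nat.cast_zero, zero_mul, add_zero]
    exact this
  | node c l r hl hr =>
    intro p a ha
    have h1 := hl (fun i => p (Fin.castAdd _ i))
      (fun i => koszulTwist ℒ (treeDegree (r.map fun _ => b)) (a (Fin.castAdd _ i)))
      fun i => koszulTwist_mem ℒ _ (ha _)
    have h2 := hr (fun i => p (Fin.natAdd _ i)) (fun i => a (Fin.natAdd _ i)) fun i => ha _
    have h3 := hb _ _ _ _ h1 h2
    have h4 : ∑ i, p i = ∑ i, p (Fin.castAdd _ i) + ∑ i, p (Fin.natAdd _ i) :=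
      Fin.sum_univ_add (a := (l.map fun _ => b).numLeaves) (b := (r.map fun _ => b).numLeaves) p
    have h5 : (∑ i, p i) + ((node c l r).numNodes : ℤ) * b.1 =
      ∑ i, p (Fin.castAdd _ i) + l.numNodes * b.1 +
        (∑ i, p (Fin.natAdd _ i) + r.numNodes * b.1) + b.1 := by
      rw [h4, numNodes]; push_cast; ring
    rw [h5]
    exact h3

theorem treeEval_decorate_mem {b₀ b : ℤ × (L →ₗ[k] L →ₗ[k] L)} (hb₀ : IsHomogeneousBilinear ℒ b₀)
    (hb : IsHomogeneousBilinear ℒ b) (u : Unit) (l r : BinaryTree Unit) :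
    HasDegree ℒ ℒ (treeEval ℒ (decorate b₀ b (node u l r)))
      (b₀.1 + (l.numNodes + r.numNodes) * b.1) := by
  intro p a ha
  have h1 := treeEval_map_mem ℒ hb l (fun i => p (Fin.castAdd _ i))
    (fun i => koszulTwist ℒ (treeDegree (r.map fun _ => b)) (a (Fin.castAdd _ i)))
    fun i => koszulTwist_mem ℒ _ (ha _)
  have h2 := treeEval_map_mem ℒ hb r (fun i => p (Fin.natAdd _ i)) (fun i => a (Fin.natAdd _ i))
    fun i => ha _
  have h3 := hb₀ _ _ _ _ h1 h2
  have h4 : ∑ i, p i = ∑ i, p (Fin.castAdd _ i) + ∑ i, p (Fin.natAdd _ i) :=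
    Fin.sum_univ_add (a := (l.map fun _ => b).numLeaves) (b := (r.map fun _ => b).numLeaves) p
  have h5 : (∑ i, p i) + (b₀.1 + ((l.numNodes : ℤ) + r.numNodes) * b.1) =
    ∑ i, p (Fin.castAdd _ i) + l.numNodes * b.1 +
      (∑ i, p (Fin.natAdd _ i) + r.numNodes * b.1) + b₀.1 := by
    rw [h4]; ring
  rw [h5]
  exact h3

/-- The value of `φ(B)` on a word, padded with zeros if it is too short. -/
def treeVal (φ : BinaryTree (ℤ × (L →ₗ[k] L →ₗ[k] L))) (w : List L) : L :=
  treeEval ℒ φ fun i => w.getD i 0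

theorem treeVal_nil (x : L) : treeVal ℒ nil [x] = x := rfl

/-- On homogeneous letters the Koszul twists of the separate arguments collapse into one sign: the
degree of the right branch times the total degree of the letters read by the left branch. -/
theorem treeVal_node {ι : Type*} {p : ι → ℤ} {a : ι → L} (ha : ∀ i, a i ∈ ℒ (p i))
    (b : ℤ × (L →ₗ[k] L →ₗ[k] L)) (l r : BinaryTree (ℤ × (L →ₗ[k] L →ₗ[k] L))) (w : List ι)
    (hw : w.length = l.numLeaves + r.numLeaves) :
    treeVal ℒ (node b l r) (w.map a) =
      (treeDegree r * ((w.take l.numLeaves).map p).sum).negOnePow •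
        b.2 (treeVal ℒ l ((w.take l.numLeaves).map a))
          (treeVal ℒ r ((w.drop l.numLeaves).map a)) := by
  rw [treeVal, treeEval_node]
  have h1 : ∀ i : Fin l.numLeaves,
      koszulTwist ℒ (treeDegree r) ((w.map a).getD (Fin.castAdd r.numLeaves i) 0) =
      (treeDegree r * ((w.take l.numLeaves).map p).getD i 0).negOnePow •
        ((w.take l.numLeaves).map a).getD i 0 := by
    intro i
    have : (w.map a).getD (Fin.castAdd r.numLeaves i) 0 =
        ((w.take l.numLeaves).map a).getD i 0 := by
      simp [List.getD]
    rw [this]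
    exact koszulTwist_of_mem ℒ _ _ (getD_map_mem ℒ ha _ _)
  have h2 : ∀ i : Fin r.numLeaves, (w.map a).getD (Fin.natAdd l.numLeaves i) 0 =
      ((w.drop l.numLeaves).map a).getD i 0 := by
    intro i
    simp [List.getD]
  simp only [h1, h2]
  rw [map_unit_smul_univ, ← negOnePow_sum, ← Finset.mul_sum, sum_getD_eq _ (by simp [hw]),
    map_unit_smul]
  rw [LinearMap.smul_apply]
  rfl

/-- `∑_{φ ∈ Ot(n+1)} e(φ) φ(b₀, b, …, b)` on a word. -/
def treeWord (b₀ b : ℤ × (L →ₗ[k] L →ₗ[k] L)) (n : ℕ) (w : List L) : L :=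
  ∑ φ ∈ treesOfNumNodesEq n, treeSign φ • treeVal ℒ (decorate b₀ b φ) w

theorem treeWord_zero (b₀ b : ℤ × (L →ₗ[k] L →ₗ[k] L)) (x : L) : treeWord ℒ b₀ b 0 [x] = x := by
  simp [treeWord, treesOfNumNodesEq_zero, treeSign, leftTurns, decorate, treeVal_nil]

/-- A tree determines its branches and their sizes, so the union over the sizes is disjoint. -/
theorem sum_treesOfNumNodesEq_succ {N : Type*} [AddCommMonoid N] (n : ℕ)
    (h : BinaryTree Unit → N) :
    ∑ φ ∈ treesOfNumNodesEq (n + 1), h φ =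
      ∑ ij ∈ Finset.HasAntidiagonal.antidiagonal n, ∑ l ∈ treesOfNumNodesEq ij.1,
        ∑ r ∈ treesOfNumNodesEq ij.2,
        h (node () l r) := by
  rw [treesOfNumNodesEq_succ, Finset.sum_biUnion]
  · refine Finset.sum_congr rfl fun ij _ => ?_
    rw [pairwiseNode, Finset.sum_map, Finset.sum_product]
    rfl
  · intro ij _ ij' _ hne
    rw [Function.onFun, Finset.disjoint_left]
    intro φ hφ hφ'
    simp only [pairwiseNode, Finset.mem_map, Finset.mem_product, mem_treesOfNumNodesEq] at hφ hφ'
    obtain ⟨⟨l, r⟩, ⟨h1, h2⟩, rfl⟩ := hφ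
    obtain ⟨⟨l', r'⟩, ⟨h1', h2'⟩, h⟩ := hφ'
    injection h with _ h3 h4
    exact hne (Prod.ext (by rw [← h1, ← h1', h3]) (by rw [← h2, ← h2', h4]))

/-- Splitting trees at the root. -/
theorem treeWord_succ {ι : Type*} {p : ι → ℤ} {a : ι → L} (ha : ∀ i, a i ∈ ℒ (p i))
    (b₀ b : ℤ × (L →ₗ[k] L →ₗ[k] L)) (n : ℕ) (w : List ι) (hw : w.length = n + 2) :
    treeWord ℒ b₀ b (n + 1) (w.map a) =
      ∑ ij ∈ Finset.HasAntidiagonal.antidiagonal n,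
        ((-1) ^ (ij.1 + 1) * (ij.2 * b.1 * ((w.take (ij.1 + 1)).map p).sum).negOnePow) •
          b₀.2 (treeWord ℒ b b ij.1 ((w.take (ij.1 + 1)).map a))
            (treeWord ℒ b b ij.2 ((w.drop (ij.1 + 1)).map a)) := by
  rw [treeWord, sum_treesOfNumNodesEq_succ]
  refine Finset.sum_congr rfl fun ij hij => ?_
  simp only [treeWord, map_sum, LinearMap.sum_apply, Finset.smul_sum]
  rw [Finset.sum_comm]
  refine Finset.sum_congr rfl fun r hr => Finset.sum_congr rfl fun l hl => ?_
  rw [mem_treesOfNumNodesEq] at hl hr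
  have hl' : (l.map fun _ => b).numLeaves = ij.1 + 1 := by
    rw [numLeaves_map, numLeaves_eq_numNodes_succ, hl]
  have hr' : (r.map fun _ => b).numLeaves = ij.2 + 1 := by
    rw [numLeaves_map, numLeaves_eq_numNodes_succ, hr]
  have hij' := Finset.HasAntidiagonal.mem_antidiagonal.1 hij
  rw [decorate, treeVal_node ℒ ha _ _ _ _ (by rw [hl', hr', hw]; omega), treeDegree_map, hl', hr,
    treeSign_node, numLeaves_eq_numNodes_succ, hl, decorate_self, decorate_self, map_unit_smul,
    map_unit_smul, LinearMap.smul_apply]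
  simp only [smul_smul]
  congr 1
  ac_rfl

/-- Passes from permutations of positions to words of labels, which can be cut along with the trees
at the root. -/
theorem treeSum_apply {ι : Type*} [LinearOrder ι] {p : ι → ℤ} {a : ι → L} (ha : ∀ i, a i ∈ ℒ (p i))
    (b₀ b : ℤ × (L →ₗ[k] L →ₗ[k] L)) (n : ℕ) (e : Fin (n + 1) ↪o ι) :
    treeSum ℒ b₀ b n (fun i => a (e i)) =
      ∑ w ∈ orderings (Finset.univ.map e.toEmbedding),
        listChi p w • treeWord ℒ b₀ b n (w.map a) := by
  rw [← sum_perm_eq_sum_orderings]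
  simp only [treeSum, sum_apply, smul_apply, treeWord, Finset.smul_sum]
  rw [Finset.sum_comm, ← Finset.sum_attach (treesOfNumNodesEq n)]
  refine Finset.sum_congr rfl fun φ _ => ?_
  rw [compAntisymm_of_mem ℒ _ (fun i => p (e i)) _ (fun i => ha (e i)), Finset.smul_sum]
  refine Finset.sum_congr rfl fun σ _ => ?_
  rw [chi_eq_listChi, smul_comm]
  congr 2
  rw [MultilinearMap.domDomCongr_apply, treeVal]
  congr 1
  ext i
  have hi : (i : ℕ) < n + 1 := i.2.trans_eq (numLeaves_decorate b₀ b φ.2)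
  simp [-List.ofFn_succ, List.getD, hi, finCongr, Fin.cast]

end TreeWords

/-! ### Antisymmetry and degrees -/

section Antisymm

variable {k : Type*} [CommRing k]
variable {L : Type*} [AddCommGroup L] [Module k L]
variable {M : Type*} [AddCommGroup M] [Module k M]
variable (ℒ : ℤ → Submodule k L)

theorem HasDegree.domDomCongr {ℳ : ℤ → Submodule k M} {n n' : ℕ}
    {f : MultilinearMap k (fun _ : Fin n => L) M} {m : ℤ} (hf : HasDegree ℒ ℳ f m)
    (e : Fin n ≃ Fin n') : HasDegree ℒ ℳ (f.domDomCongr e) m := by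
  intro p a ha
  rw [← Equiv.sum_comp e]
  exact hf (fun i => p (e i)) _ fun i => ha (e i)

variable [DirectSum.Decomposition ℒ]

/-- Left translation by `σ` permutes the summands, and by `chi_mul` it costs the sign of `σ`. -/
theorem compAntisymm_antisymm {n : ℕ} (f : MultilinearMap k (fun _ : Fin n => L) M) :
    IsGradedAntisymmetric ℒ (compAntisymm ℒ f) := by
  intro σ p a ha
  rw [compAntisymm_of_mem ℒ f p a ha,
    compAntisymm_of_mem ℒ f (fun i => p (σ i)) _ fun i => ha (σ i), Finset.smul_sum,
    ← Equiv.sum_comp (Equiv.mulLeft σ) fun τ => chi σ p • chi τ p • f fun i => a (τ i)]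
  refine Finset.sum_congr rfl fun τ _ => ?_
  rw [Equiv.coe_mulLeft, chi_mul, smul_smul, ← mul_assoc, Int.units_mul_self, one_mul]
  rfl

theorem compAntisymm_hasDegree {ℳ : ℤ → Submodule k M} {n : ℕ}
    {f : MultilinearMap k (fun _ : Fin n => L) M} {m : ℤ} (hf : HasDegree ℒ ℳ f m) :
    HasDegree ℒ ℳ (compAntisymm ℒ f) m := by
  intro p a ha
  rw [compAntisymm_of_mem ℒ f p a ha]
  refine Submodule.sum_mem _ fun σ _ => unit_smul_mem _ _ ?_
  rw [← Equiv.sum_comp σ]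
  exact hf (fun i => p (σ i)) _ fun i => ha (σ i)

theorem treeSum_antisymm (b₀ b : ℤ × (L →ₗ[k] L →ₗ[k] L)) (n : ℕ) :
    IsGradedAntisymmetric ℒ (treeSum ℒ b₀ b n) := by
  intro σ p a ha
  simp only [treeSum, sum_apply, smul_apply, Finset.smul_sum]
  refine Finset.sum_congr rfl fun φ _ => ?_
  rw [compAntisymm_antisymm ℒ _ σ p a ha, smul_comm]

theorem treeSum_hasDegree_self {b : ℤ × (L →ₗ[k] L →ₗ[k] L)} (hb : IsHomogeneousBilinear ℒ b)
    (n : ℕ) : HasDegree ℒ ℒ (treeSum ℒ b b n) (n * b.1) := by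
  intro p a ha
  simp only [treeSum, sum_apply, smul_apply]
  refine Submodule.sum_mem _ fun φ _ => unit_smul_mem _ _ ?_
  refine compAntisymm_hasDegree ℒ (HasDegree.domDomCongr ℒ ?_ _) p a ha
  have hφ := mem_treesOfNumNodesEq.1 φ.2
  generalize φ.1 = ψ at hφ
  subst hφ
  rw [decorate_self]
  exact treeEval_map_mem ℒ hb ψ

theorem treeSum_hasDegree {b₀ b : ℤ × (L →ₗ[k] L →ₗ[k] L)} (hb₀ : IsHomogeneousBilinear ℒ b₀)
    (hb : IsHomogeneousBilinear ℒ b) (n : ℕ) :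
    HasDegree ℒ ℒ (treeSum ℒ b₀ b (n + 1)) (b₀.1 + n * b.1) := by
  intro p a ha
  simp only [treeSum, sum_apply, smul_apply]
  refine Submodule.sum_mem _ fun φ _ => unit_smul_mem _ _ ?_
  refine compAntisymm_hasDegree ℒ (HasDegree.domDomCongr ℒ ?_ _) p a ha
  have hφ := mem_treesOfNumNodesEq.1 φ.2
  generalize φ.1 = ψ at hφ
  cases ψ with
  | nil => simp at hφ
  | node u l r =>
    rw [numNodes, Nat.add_right_cancel_iff] at hφ
    subst hφ
    push_cast
    exact treeEval_decorate_mem ℒ hb₀ hb u l r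

end Antisymm

/-! ### Tree sums indexed by finite sets -/

section TreeOn

/-- The two branches of a tree are never empty, so cutting at the root yields only proper nonempty
subsets. Adding the vanishing extreme terms gives sums over the whole powerset, which are easier to
rearrange. -/
theorem sum_powerset_of_card {N : Type*} [AddCommMonoid N] {ι : Type*} {S : Finset ι} {n : ℕ}
    (hS : S.card = n + 2) (h : Finset ι → N) (h0 : h ∅ = 0) (h1 : h S = 0) :
    ∑ A ∈ S.powerset, h A =
      ∑ ij ∈ Finset.HasAntidiagonal.antidiagonal n, ∑ A ∈ S.powersetCard (ij.1 + 1), h A := by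
  rw [Finset.sum_powerset, hS, Finset.sum_range_succ, ← hS, Finset.powersetCard_self,
    Finset.sum_singleton, h1, add_zero, hS, Finset.sum_range_succ', Finset.powersetCard_zero,
    Finset.sum_singleton, h0, add_zero,
    Finset.Nat.sum_antidiagonal_eq_sum_range_succ_mk]

variable {ι : Type*} [LinearOrder ι]

/-- The sign of the term with first factor indexed by `A` and second factor by `B`. -/
def splitSign (p : ι → ℤ) (m : ℤ) (A B : Finset ι) : ℤˣ :=
  (-1) ^ A.card * (((B.card : ℤ) - 1) * m * ∑ i ∈ A, p i).negOnePow * cross p A B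

variable {k : Type*} [CommRing k] [Algebra ℚ k]
variable {L : Type*} [AddCommGroup L] [Module k L]
variable (ℒ : ℤ → Submodule k L) [DirectSum.Decomposition ℒ]

/-- `(1/2)^{n-1} ∑_{φ ∈ Ot(n)} e(φ) φ(b₀, b, …, b) ∘ αₙ` at the elements `a i`, `i ∈ S`. -/
def treeOn (p : ι → ℤ) (a : ι → L) (b₀ b : ℤ × (L →ₗ[k] L →ₗ[k] L)) (S : Finset ι) : L :=
  -- The value zero on `∅` fits the convention f₀ = 0, and every recursion along proper subsets
  -- rests on it.
  if S = ∅ then 0 else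
    algebraMap ℚ k ((1 / 2) ^ (S.card - 1)) •
      ∑ w ∈ orderings S, listChi p w • treeWord ℒ b₀ b (S.card - 1) (w.map a)

theorem treeOn_empty (p : ι → ℤ) (a : ι → L) (b₀ b : ℤ × (L →ₗ[k] L →ₗ[k] L)) :
    treeOn ℒ p a b₀ b ∅ = 0 := if_pos rfl

theorem treeOn_map {p : ι → ℤ} {a : ι → L} (ha : ∀ i, a i ∈ ℒ (p i))
    (b₀ b : ℤ × (L →ₗ[k] L →ₗ[k] L)) {n : ℕ} (e : Fin (n + 1) ↪o ι) :
    treeOn ℒ p a b₀ b (Finset.univ.map e.toEmbedding) =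
      algebraMap ℚ k ((1 / 2) ^ n) • treeSum ℒ b₀ b n (fun i => a (e i)) := by
  rw [treeOn, if_neg (by simp [Finset.univ_eq_empty_iff]), treeSum_apply ℒ ha]
  simp

theorem treeOn_singleton (p : ι → ℤ) (a : ι → L) (b₀ b : ℤ × (L →ₗ[k] L →ₗ[k] L)) (i : ι) :
    treeOn ℒ p a b₀ b {i} = a i := by
  have h : orderings ({i} : Finset ι) = {[i]} := by
    ext w
    rw [mem_orderings, Finset.singleton_val, Finset.mem_singleton]
    exact Multiset.coe_eq_singleton
  rw [treeOn, if_neg (Finset.singleton_ne_empty i), h]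
  simp [listChi, treeWord_zero]

theorem treeOn_mem_self {p : ι → ℤ} {a : ι → L} (ha : ∀ i, a i ∈ ℒ (p i))
    {b : ℤ × (L →ₗ[k] L →ₗ[k] L)} (hb : IsHomogeneousBilinear ℒ b) (S : Finset ι) :
    treeOn ℒ p a b b S ∈ ℒ (∑ i ∈ S, p i + ((S.card : ℤ) - 1) * b.1) := by
  rcases hn : S.card with _ | n
  · rw [Finset.card_eq_zero.1 hn, treeOn_empty]; exact zero_mem _
  · rw [← Finset.map_orderEmbOfFin_univ S hn, treeOn_map ℒ ha, Finset.sum_map]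
    refine Submodule.smul_mem _ _ ?_
    have := treeSum_hasDegree_self ℒ hb n (fun i => p (S.orderEmbOfFin hn i)) _ fun i => ha _
    push_cast
    rwa [add_sub_cancel_right]

theorem treeOn_mem {p : ι → ℤ} {a : ι → L} (ha : ∀ i, a i ∈ ℒ (p i))
    {b₀ b : ℤ × (L →ₗ[k] L →ₗ[k] L)} (hb₀ : IsHomogeneousBilinear ℒ b₀)
    (hb : IsHomogeneousBilinear ℒ b) {S : Finset ι} (hS : 2 ≤ S.card) :
    treeOn ℒ p a b₀ b S ∈ ℒ (∑ i ∈ S, p i + (b₀.1 + ((S.card : ℤ) - 2) * b.1)) := by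
  obtain ⟨n, hn⟩ := Nat.exists_eq_add_of_le' hS
  rw [hn, ← Finset.map_orderEmbOfFin_univ S hn, treeOn_map ℒ ha, Finset.sum_map]
  refine Submodule.smul_mem _ _ ?_
  have := treeSum_hasDegree ℒ hb₀ hb n (fun i => p (S.orderEmbOfFin hn i)) _ fun i => ha _
  push_cast
  rwa [add_sub_cancel_right]

/-- The recursion satisfied by tree sums, from splitting the trees at the root. -/
theorem treeOn_eq {p : ι → ℤ} {a : ι → L} (ha : ∀ i, a i ∈ ℒ (p i))
    (b₀ b : ℤ × (L →ₗ[k] L →ₗ[k] L)) {S : Finset ι} (hS : 2 ≤ S.card) :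
    treeOn ℒ p a b₀ b S = algebraMap ℚ k (1 / 2) • ∑ A ∈ S.powerset,
      splitSign p b.1 A (S \ A) • b₀.2 (treeOn ℒ p a b b A) (treeOn ℒ p a b b (S \ A)) := by
  obtain ⟨n, hn⟩ := Nat.exists_eq_add_of_le' hS
  have hne : S ≠ ∅ := by rintro rfl; simp at hS
  rw [sum_powerset_of_card hn _ (by simp [treeOn_empty]) (by simp [treeOn_empty]),
    treeOn, if_neg hne, hn]
  have hsub : n + 2 - 1 = n + 1 := rfl
  -- Of the n + 1 factors 1/2 one stays at the root; the others go to the branches with i and j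
  -- nodes, where i + j = n.
  rw [hsub, pow_succ', map_mul, mul_smul]
  congr 1
  have h1 : ∀ w ∈ orderings S, listChi p w • treeWord ℒ b₀ b (n + 1) (w.map a) =
      ∑ ij ∈ Finset.HasAntidiagonal.antidiagonal n,
        listChi p (w.take (ij.1 + 1) ++ w.drop (ij.1 + 1)) •
        ((-1) ^ (ij.1 + 1) * (ij.2 * b.1 * ((w.take (ij.1 + 1)).map p).sum).negOnePow) •
          b₀.2 (treeWord ℒ b b ij.1 ((w.take (ij.1 + 1)).map a))
            (treeWord ℒ b b ij.2 ((w.drop (ij.1 + 1)).map a)) := by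
    intro w hw
    rw [treeWord_succ ℒ ha b₀ b n w (by rw [length_of_mem_orderings hw, hn]), Finset.smul_sum]
    simp only [List.take_append_drop]
  rw [Finset.sum_congr rfl h1, Finset.sum_comm, Finset.smul_sum]
  refine Finset.sum_congr rfl fun ij hij => ?_
  have hij' := Finset.HasAntidiagonal.mem_antidiagonal.1 hij
  rw [sum_orderings_take_drop S (ij.1 + 1) (by omega) fun u v => listChi p (u ++ v) •
        ((-1) ^ (ij.1 + 1) * (ij.2 * b.1 * (u.map p).sum).negOnePow) •
          b₀.2 (treeWord ℒ b b ij.1 (u.map a)) (treeWord ℒ b b ij.2 (v.map a)), Finset.smul_sum]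
  refine Finset.sum_congr rfl fun A hA => ?_
  rw [Finset.mem_powersetCard] at hA
  have hc : (S \ A).card = ij.2 + 1 := by rw [Finset.card_sdiff_of_subset hA.1]; omega
  have hA0 : A ≠ ∅ := by rintro rfl; simp at hA
  have hB0 : S \ A ≠ ∅ := by intro h; simp [h] at hc
  rw [treeOn, if_neg hA0, treeOn, if_neg hB0, hA.2, hc, Nat.add_sub_cancel, Nat.add_sub_cancel,
    ← hij', pow_add, map_mul, mul_smul, map_smul, map_smul, LinearMap.smul_apply,
    smul_comm (algebraMap ℚ k ((1 / 2) ^ ij.2)), smul_comm (splitSign _ _ _ _),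
    smul_comm (splitSign _ _ _ _)]
  congr 2
  simp only [map_sum, LinearMap.sum_apply, Finset.smul_sum]
  rw [Finset.sum_comm]
  refine Finset.sum_congr rfl fun v hv => Finset.sum_congr rfl fun u hu => ?_
  rw [listChi_append_of_mem_orderings p hu hv, sum_map_of_mem_orderings hu, map_unit_smul,
    map_unit_smul, LinearMap.smul_apply, splitSign, hA.2, hc]
  simp only [smul_smul]
  congr 1
  push_cast
  rw [add_sub_cancel_right]
  ac_rfl

end TreeOn

/-! ### Sums over decompositions of a finite set -/

section Decompositions

variable {ι : Type*} [DecidableEq ι] {N : Type*} [AddCommMonoid N]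

theorem sum_powerset_sdiff (S : Finset ι) (h : Finset ι → Finset ι → N) :
    ∑ A ∈ S.powerset, h A (S \ A) = ∑ A ∈ S.powerset, h (S \ A) A := by
  refine Finset.sum_nbij' (fun A => S \ A) (fun A => S \ A) ?_ ?_ ?_ ?_ ?_
  · intro A _; exact Finset.mem_powerset.2 Finset.sdiff_subset
  · intro A _; exact Finset.mem_powerset.2 Finset.sdiff_subset
  · intro A hA; exact Finset.sdiff_sdiff_eq_self (Finset.mem_powerset.1 hA)
  · intro A hA; exact Finset.sdiff_sdiff_eq_self (Finset.mem_powerset.1 hA)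
  · intro A hA; rw [Finset.sdiff_sdiff_eq_self (Finset.mem_powerset.1 hA)]

/-- Both sides run over the ordered decompositions of `S` into three blocks; one cuts off the last
block first, the other the first block. -/
theorem sum_powerset_assoc (S : Finset ι) (h : Finset ι → Finset ι → Finset ι → N) :
    ∑ A ∈ S.powerset, ∑ B ∈ A.powerset, h B (A \ B) (S \ A) =
      ∑ B ∈ S.powerset, ∑ C ∈ (S \ B).powerset, h B C ((S \ B) \ C) := by
  rw [Finset.sum_sigma', Finset.sum_sigma']
  refine Finset.sum_bij' (fun x _ => ⟨x.2, x.1 \ x.2⟩) (fun x _ => ⟨x.1 ∪ x.2, x.1⟩) ?_ ?_ ?_ ?_ ?_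
  all_goals
    rintro ⟨A, B⟩ hx
    simp only [Finset.mem_sigma, Finset.mem_powerset] at hx ⊢
    obtain ⟨h1, h2⟩ := hx
  · exact ⟨h2.trans h1, Finset.sdiff_subset_sdiff h1 subset_rfl⟩
  · exact ⟨Finset.union_subset h1 (h2.trans Finset.sdiff_subset), Finset.subset_union_left⟩
  · rw [Finset.union_sdiff_of_subset h2]
  · rw [Finset.union_sdiff_cancel_left]
    exact (Finset.subset_sdiff.1 h2).2.symm
  · rw [sdiff_sdiff_left, Finset.sup_eq_union, Finset.union_sdiff_of_subset h2]

theorem sum_powerset_comm_left (S : Finset ι) (h : Finset ι → Finset ι → Finset ι → N) :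
    ∑ A ∈ S.powerset, ∑ B ∈ A.powerset, h B (A \ B) (S \ A) =
      ∑ A ∈ S.powerset, ∑ B ∈ A.powerset, h (A \ B) B (S \ A) :=
  Finset.sum_congr rfl fun A _ => sum_powerset_sdiff A fun B C => h B C (S \ A)

theorem sum_powerset_comm_right (S : Finset ι) (h : Finset ι → Finset ι → Finset ι → N) :
    ∑ A ∈ S.powerset, ∑ B ∈ A.powerset, h B (A \ B) (S \ A) =
      ∑ A ∈ S.powerset, ∑ B ∈ A.powerset, h B (S \ A) (A \ B) := by
  rw [sum_powerset_assoc, sum_powerset_assoc S fun B C D => h B D C]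
  exact Finset.sum_congr rfl fun B _ => sum_powerset_sdiff (S \ B) fun C D => h B C D

end Decompositions

/-! ### Shifted signs -/

section ShiftedSigns

variable {ι : Type*}

/-- The total shifted degree. -/
def shiftDeg (p : ι → ℤ) (A : Finset ι) : ℤ := ∑ i ∈ A, (p i - 1)

theorem shiftDeg_eq (p : ι → ℤ) (A : Finset ι) : shiftDeg p A = ∑ i ∈ A, p i - A.card := by
  simp [shiftDeg, Finset.sum_sub_distrib]

variable [LinearOrder ι]

/-- The Koszul sign of the shuffle that moves `B` past `A`, for the degrees `p i - 1`. -/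
def shiftSign (p : ι → ℤ) (A B : Finset ι) : ℤˣ :=
  ∏ x ∈ A, ∏ y ∈ B, if y < x then ((p x - 1) * (p y - 1)).negOnePow else 1

/-- The sign of the décalage isomorphism. -/
def decalage (p : ι → ℤ) (S : Finset ι) : ℤˣ :=
  ∏ x ∈ S, ∏ y ∈ S, if x < y then (p x).negOnePow else 1

theorem shiftDeg_union (p : ι → ℤ) {A B : Finset ι} (h : Disjoint A B) :
    shiftDeg p (A ∪ B) = shiftDeg p A + shiftDeg p B := Finset.sum_union h

theorem shiftSign_empty_right (p : ι → ℤ) (A : Finset ι) : shiftSign p A ∅ = 1 := by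
  simp [shiftSign]

theorem shiftSign_union_left (p : ι → ℤ) {A B : Finset ι} (h : Disjoint A B) (C : Finset ι) :
    shiftSign p (A ∪ B) C = shiftSign p A C * shiftSign p B C := Finset.prod_union h

theorem shiftSign_union_right (p : ι → ℤ) (A : Finset ι) {B C : Finset ι} (h : Disjoint B C) :
    shiftSign p A (B ∪ C) = shiftSign p A B * shiftSign p A C := by
  simp only [shiftSign, Finset.prod_union h, Finset.prod_mul_distrib]

/-- Each pair is inverted in exactly one of the two orders and so contributes its sign once. -/
theorem shiftSign_mul_swap (p : ι → ℤ) {A B : Finset ι} (h : Disjoint A B) :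
    shiftSign p A B * shiftSign p B A = (shiftDeg p A * shiftDeg p B).negOnePow := by
  rw [shiftDeg, shiftDeg, Finset.sum_mul_sum, negOnePow_sum]
  simp only [negOnePow_sum]
  rw [shiftSign, shiftSign, Finset.prod_comm (s := B)]
  simp only [← Finset.prod_mul_distrib]
  refine Finset.prod_congr rfl fun x hx => Finset.prod_congr rfl fun y hy => ?_
  rcases lt_trichotomy x y with hxy | rfl | hxy
  · simp [hxy, hxy.not_gt, mul_comm]
  · exact absurd hy (Finset.disjoint_left.1 h hx)
  · simp [hxy, hxy.not_gt]

theorem shiftSign_swap (p : ι → ℤ) {A B : Finset ι} (h : Disjoint A B) :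
    shiftSign p A B = (shiftDeg p A * shiftDeg p B).negOnePow * shiftSign p B A := by
  rw [← shiftSign_mul_swap p h, mul_assoc, Int.units_mul_self, mul_one]

/-- Holds pair by pair. For x in `A`, y in `B` with x < y the sign of x occurs twice and cancels;
for y < x the inversion sign -(-1)^{|x||y|} combines with those of x and y to (-1)^{(|x|-1)(|y|-1)}.
-/
theorem decalage_union (p : ι → ℤ) {A B : Finset ι} (h : Disjoint A B) :
    decalage p (A ∪ B) * (cross p A B * (B.card * ∑ i ∈ A, p i).negOnePow) =
      shiftSign p A B * (decalage p A * decalage p B) := by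
  have h1 : decalage p (A ∪ B) = decalage p A * decalage p B *
      ∏ x ∈ A, ∏ y ∈ B,
        ((if x < y then (p x).negOnePow else 1) * if y < x then (p y).negOnePow else 1) := by
    simp only [decalage, Finset.prod_union h, Finset.prod_mul_distrib]
    rw [Finset.prod_comm (s := B) (t := A)]
    ac_rfl
  have h2 : (B.card * ∑ i ∈ A, p i).negOnePow = ∏ x ∈ A, ∏ _y ∈ B, (p x).negOnePow := by
    simp only [← negOnePow_sum, Finset.sum_const, nsmul_eq_mul, Finset.mul_sum]
  rw [h1, h2, cross, mul_assoc, mul_comm (shiftSign p A B)]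
  congr 1
  rw [shiftSign]
  simp only [← Finset.prod_mul_distrib]
  refine Finset.prod_congr rfl fun x hx => Finset.prod_congr rfl fun y hy => ?_
  rcases lt_trichotomy x y with hxy | rfl | hxy
  · simp [pairSign, hxy, hxy.not_gt, Int.units_mul_self]
  · exact absurd hy (Finset.disjoint_left.1 h hx)
  · have : (p x - 1) * (p y - 1) = p x * p y + 1 + -p x - p y := by ring
    simp only [pairSign, hxy, hxy.not_gt, if_true, if_false, one_mul, this]
    rw [Int.negOnePow_sub, Int.negOnePow_add, Int.negOnePow_neg, Int.negOnePow_succ]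
    ac_rfl

/-- This is what the sign e(φ) is for: with the Koszul signs of the degree -1 maps `g` it turns,
under décalage, into the sign of `convBracket`. -/
theorem decalage_mul_splitSign (p : ι → ℤ) {A B : Finset ι} (h : Disjoint A B) :
    decalage p (A ∪ B) * splitSign p (-1) A B =
      (shiftDeg p A).negOnePow * shiftSign p A B * (decalage p A * decalage p B) := by
  have h1 : splitSign p (-1) A B =
      (shiftDeg p A).negOnePow * (cross p A B * (B.card * ∑ i ∈ A, p i).negOnePow) := by
    have : ((B.card : ℤ) - 1) * -1 * ∑ i ∈ A, p i = ∑ i ∈ A, p i - B.card * ∑ i ∈ A, p i := by ring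
    rw [splitSign, this, Int.negOnePow_sub, shiftDeg_eq, Int.negOnePow_sub]
    have h2 : (-1 : ℤˣ) ^ A.card = (A.card : ℤ).negOnePow := by simp [Int.negOnePow_def]
    rw [h2]
    ac_rfl
  rw [h1, mul_left_comm, decalage_union p h]
  ac_rfl

end ShiftedSigns

/-! ### The bracket of families: symmetry, derivation rule, Jacobi identity -/

section Convolution

variable {k : Type*} [CommRing k]
variable {L : Type*} [AddCommGroup L] [Module k L] {ℒ : ℤ → Submodule k L}
variable {ι : Type*} [LinearOrder ι]

/-- The bracket of two families indexed by finite sets, with the Koszul signs of the shifted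
degrees. -/
def convBracket (D : DGLieAlgebra ℒ) (p : ι → ℤ) (X Y : Finset ι → L) (S : Finset ι) : L :=
  ∑ A ∈ S.powerset,
    ((shiftDeg p A).negOnePow * shiftSign p A (S \ A)) • D.bracket (X A) (Y (S \ A))

variable (D : DGLieAlgebra ℒ) (p : ι → ℤ)

theorem convBracket_add_left (X X' Y : Finset ι → L) (S : Finset ι) :
    convBracket D p (fun A => X A + X' A) Y S = convBracket D p X Y S + convBracket D p X' Y S := by
  simp only [convBracket, map_add, LinearMap.add_apply, smul_add, Finset.sum_add_distrib]

theorem convBracket_smul_left (c : k) (X Y : Finset ι → L) (S : Finset ι) :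
    convBracket D p (fun A => c • X A) Y S = c • convBracket D p X Y S := by
  simp only [convBracket, map_smul, LinearMap.smul_apply, Finset.smul_sum]
  exact Finset.sum_congr rfl fun A _ => smul_comm _ _ _

/-- Graded symmetry. -/
theorem sum_bracket_swap {X Y : Finset ι → L} (t : ℤ) (hX : ∀ A, X A ∈ ℒ (shiftDeg p A + 1))
    (hY : ∀ A, Y A ∈ ℒ (shiftDeg p A + t)) (S : Finset ι) :
    ∑ A ∈ S.powerset,
        ((t * shiftDeg p A).negOnePow * shiftSign p A (S \ A)) • D.bracket (X A) (Y (S \ A)) =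
      (t - 1).negOnePow • convBracket D p Y X S := by
  rw [convBracket, sum_powerset_sdiff S fun A B =>
    ((t * shiftDeg p A).negOnePow * shiftSign p A B) • D.bracket (X A) (Y B), Finset.smul_sum]
  refine Finset.sum_congr rfl fun B _ => ?_
  have hd : Disjoint (S \ B) B := Finset.sdiff_disjoint
  rw [D.antisymm _ _ _ _ (hX (S \ B)) (hY B), shiftSign_swap p hd, ← Units.neg_smul, smul_smul,
    smul_smul, ← Int.negOnePow_succ]
  congr 1
  rw [← mul_assoc, ← Int.negOnePow_add, mul_right_comm, ← Int.negOnePow_add, ← mul_assoc,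
    ← Int.negOnePow_add]
  congr 1
  rw [Int.negOnePow_eq_iff]
  generalize shiftDeg p (S \ B) = a
  generalize shiftDeg p B = b
  simp only [Int.even_sub, Int.even_add, Int.even_mul, Int.not_even_one]
  tauto

/-- The differential is a derivation. -/
theorem d_convBracket_self {X : Finset ι → L} (hX : ∀ A, X A ∈ ℒ (shiftDeg p A + 1))
    (S : Finset ι) :
    D.d (convBracket D p X X S) = (2 : k) • convBracket D p (fun A => D.d (X A)) X S := by
  have hdX : ∀ A, D.d (X A) ∈ ℒ (shiftDeg p A + 2) := fun A => by
    have := D.d_degree _ _ (hX A); rwa [add_assoc] at this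
  -- The family dX has total degree 2, so exchanging it with X costs only a minus sign.
  have h := sum_bracket_swap D p 2 hX hdX S
  rw [two_smul]
  nth_rw 3 [convBracket]
  rw [convBracket, map_sum]
  have h1 : (2 - 1 : ℤ).negOnePow = -1 := by simp
  rw [h1, Units.neg_smul, one_smul, ← neg_eq_iff_eq_neg] at h
  rw [← h, ← Finset.sum_neg_distrib, add_comm, ← Finset.sum_add_distrib]
  refine Finset.sum_congr rfl fun A _ => ?_
  rw [map_unit_smul, D.leibniz _ _ _ (hX A), smul_add, smul_smul, ← Units.neg_smul]
  congr 2
  rw [mul_right_comm, ← Int.negOnePow_add, ← neg_mul, ← Int.negOnePow_succ]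
  congr 1
  rw [Int.negOnePow_eq_iff]
  generalize shiftDeg p A = a
  simp only [Int.even_sub, Int.even_add, Int.even_mul, Int.not_even_one,
    even_two]
  tauto

theorem convBracket_convBracket (X Y Z : Finset ι → L) (S : Finset ι) :
    convBracket D p (convBracket D p X Y) Z S = ∑ A ∈ S.powerset, ∑ B ∈ A.powerset,
      ((shiftDeg p (A \ B)).negOnePow * (shiftSign p B (A \ B) * shiftSign p B (S \ A) *
        shiftSign p (A \ B) (S \ A))) • D.bracket (D.bracket (X B) (Y (A \ B))) (Z (S \ A)) := by
  rw [convBracket]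
  refine Finset.sum_congr rfl fun A hA => ?_
  rw [convBracket, map_sum, LinearMap.sum_apply, Finset.smul_sum]
  refine Finset.sum_congr rfl fun B hB => ?_
  have hd : Disjoint B (A \ B) := Finset.disjoint_sdiff
  have hu : B ∪ (A \ B) = A := Finset.union_sdiff_of_subset (Finset.mem_powerset.1 hB)
  rw [map_unit_smul, LinearMap.smul_apply, smul_smul]
  congr 1
  nth_rw 1 2 [← hu]
  rw [shiftDeg_union p hd, shiftSign_union_left p hd, Int.negOnePow_add]
  -- The sign of `B` comes once from the inner and once from the outer bracket; the two cancel, and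
  -- only the sign of `A \ B` is left.
  generalize (shiftDeg p B).negOnePow = e
  generalize (shiftDeg p (A \ B)).negOnePow = e'
  rw [mul_assoc e e', ← mul_assoc, mul_right_comm e _ e, Int.units_mul_self, one_mul]
  ac_rfl

/-- The Jacobi identity with [x, [y, z]] and [y, [x, z]] turned around by antisymmetry: every term
now has the shape [[·, ·], ·] of `convBracket_convBracket`, with signs in the shifted degrees. -/
theorem bracket_jacobi_cyclic {a b c : ℤ} {x y z : L} (hx : x ∈ ℒ (a + 1)) (hy : y ∈ ℒ (b + 1))
    (hz : z ∈ ℒ (c + 1)) :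
    b.negOnePow • D.bracket (D.bracket x y) z +
      (c + a * b + a * c).negOnePow • D.bracket (D.bracket y z) x +
      (c + b * c).negOnePow • D.bracket (D.bracket x z) y = 0 := by
  have h := D.jacobi _ _ x y z hx hy
  rw [D.antisymm _ _ _ _ hx (D.bracket_degree _ _ _ _ hy hz),
    D.antisymm _ _ _ _ hy (D.bracket_degree _ _ _ _ hx hz), smul_neg, smul_smul,
    ← sub_eq_add_neg, eq_sub_iff_add_eq, ← Units.neg_smul, ← Int.negOnePow_succ,
    ← Int.negOnePow_add] at h
  rw [← h, smul_add, smul_smul, smul_smul, ← Int.negOnePow_add, ← Int.negOnePow_add]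
  have h1 : (b + ((a + 1) * (b + 1 + (c + 1)) + 1)).negOnePow =
      -(c + a * b + a * c).negOnePow := by
    rw [← Int.negOnePow_succ, Int.negOnePow_eq_iff]
    simp only [Int.even_sub, Int.even_add, Int.even_mul, Int.not_even_one]
    tauto
  have h2 : (b + ((a + 1) * (b + 1) + (b + 1) * (a + 1 + (c + 1)))).negOnePow =
      -(c + b * c).negOnePow := by
    rw [← Int.negOnePow_succ, Int.negOnePow_eq_iff]
    simp only [Int.even_sub, Int.even_add, Int.even_mul, Int.not_even_one]
    tauto
  rw [h1, h2, Units.neg_smul, Units.neg_smul]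
  abel

/-- The Jacobi identity. -/
theorem convBracket_jacobi [Algebra ℚ k] {X : Finset ι → L}
    (hX : ∀ A, X A ∈ ℒ (shiftDeg p A + 1)) (S : Finset ι) :
    convBracket D p (convBracket D p X X) X S = 0 := by
  let T : Finset ι → Finset ι → Finset ι → L := fun A B C =>
    ((shiftDeg p B).negOnePow * (shiftSign p A B * shiftSign p A C * shiftSign p B C)) •
      D.bracket (D.bracket (X A) (X B)) (X C)
  have hT : ∀ A B C, Disjoint A B → Disjoint A C → Disjoint B C →
      T A B C + T B C A + T A C B = 0 := by
    intro A B C hAB hAC hBC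
    have h := bracket_jacobi_cyclic D (hX A) (hX B) (hX C)
    have h' := congrArg (fun x => (shiftSign p A B * shiftSign p A C * shiftSign p B C) • x) h
    simp only [smul_add, smul_smul, smul_zero] at h'
    simp only [T]
    rw [← h', shiftSign_swap p hAB.symm, shiftSign_swap p hAC.symm, shiftSign_swap p hBC.symm,
      Int.negOnePow_add, Int.negOnePow_add, Int.negOnePow_add]
    refine congrArg₂ (· + ·) (congrArg₂ (· + ·) ?_ ?_) ?_ <;> congr 1 <;> ac_rfl
  -- Permuting the three blocks writes the same sum with terms T X Y Z (`h1`), T X Z Y (`h2`) and T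
  -- Y Z X (`h3`). The three add up to zero by `hT`, so three times the sum vanishes.
  have h1 : convBracket D p (convBracket D p X X) X S =
      ∑ A ∈ S.powerset, ∑ B ∈ A.powerset, T B (A \ B) (S \ A) := convBracket_convBracket D p X X X S
  have h2 := h1.trans (sum_powerset_comm_right S T)
  have h3 := h2.trans (sum_powerset_comm_left S fun A B C => T A C B)
  have h4 : convBracket D p (convBracket D p X X) X S + convBracket D p (convBracket D p X X) X S +
      convBracket D p (convBracket D p X X) X S = 0 := by
    nth_rw 1 [h1]
    nth_rw 1 [h3]
    rw [h2]
    simp only [← Finset.sum_add_distrib]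
    refine Finset.sum_eq_zero fun A hA => Finset.sum_eq_zero fun B hB => ?_
    rw [Finset.mem_powerset] at hB
    exact hT _ _ _ Finset.disjoint_sdiff (Finset.disjoint_sdiff.mono_left hB)
      (Finset.disjoint_sdiff.mono_left Finset.sdiff_subset)
  generalize convBracket D p (convBracket D p X X) X S = J at h4
  have h5 : algebraMap ℚ k (1 / 3) * 3 = 1 := by
    rw [← map_ofNat (algebraMap ℚ k) 3, ← map_mul]; norm_num
  calc J = (algebraMap ℚ k (1 / 3) * 3) • J := by rw [h5, one_smul]
    _ = algebraMap ℚ k (1 / 3) • (J + J + J) := by rw [mul_smul]; congr 1; module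
    _ = 0 := by rw [h4, smul_zero]

end Convolution

/-! ### The curvature and the recursion that determines it -/

section Curvature

variable {k : Type*} [CommRing k]
variable {L : Type*} [AddCommGroup L] [Module k L] {ℒ : ℤ → Submodule k L}
variable {ι : Type*} [LinearOrder ι]
variable (D : DGLieAlgebra ℒ) (p : ι → ℤ)

/-- A recursion along the convolution bracket with a family vanishing on `∅` has at most one
solution. -/
theorem convBracket_rec_unique {F : Finset ι → L} (hF : F ∅ = 0) (M : Finset ι → L) (T : L →ₗ[k] L)
    {P Q : Finset ι → L} (hP : ∀ S, P S = M S + T (convBracket D p P F S))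
    (hQ : ∀ S, Q S = M S + T (convBracket D p Q F S)) : P = Q := by
  funext S
  induction S using Finset.strongInduction with
  | H S ih =>
    rw [hP, hQ]
    congr 2
    refine Finset.sum_congr rfl fun A hA => ?_
    -- The only term involving the unknown at `S` itself has `F ∅ = 0` as its second factor.
    rcases (Finset.mem_powerset.1 hA).eq_or_ssubset with rfl | h
    · rw [Finset.sdiff_self, hF, map_zero, map_zero]
    · rw [ih A h]

theorem convBracket_empty {X Y : Finset ι → L} (hY : Y ∅ = 0) :
    convBracket D p X Y ∅ = 0 := by
  simp [convBracket, hY]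

theorem convBracket_unit_smul_left (u : ℤˣ) (X Y : Finset ι → L) (S : Finset ι) :
    convBracket D p (fun A => u • X A) Y S = u • convBracket D p X Y S := by
  simp only [convBracket, map_unit_smul, LinearMap.smul_apply, Finset.smul_sum]
  exact Finset.sum_congr rfl fun A _ => smul_comm _ _ _

theorem convBracket_of_card_le_one {F : Finset ι → L} (hF : F ∅ = 0) {S : Finset ι}
    (hS : S.card ≤ 1) : convBracket D p F F S = 0 := by
  refine Finset.sum_eq_zero fun A hA => ?_
  by_cases hA0 : A = ∅
  · rw [hA0, hF, map_zero, LinearMap.zero_apply, smul_zero]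
  · have hAS : A = S := Finset.eq_of_subset_of_card_le (Finset.mem_powerset.1 hA)
      (hS.trans (Finset.card_pos.2 (Finset.nonempty_iff_ne_empty.2 hA0)))
    rw [hAS, Finset.sdiff_self, hF, map_zero, smul_zero]

/-- Summing, over the subsets `A` of `S`, families depending on `A`. -/
def insertSum (G : Finset ι → Finset ι → L) (S : Finset ι) : L :=
  ∑ A ∈ S.powerset, shiftSign p A (S \ A) • G A (S \ A)

/-- Both sides sum over S = A ⊔ B ⊔ C, where `A` indexes the inserted operation, `B` its companions
and `C` the other factor of the bracket. So a recursion for each `G A` turns into one for the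
insertion sum; the degree one of the inserted operation is responsible for the minus sign. -/
theorem insertSum_convBracket (T : L →ₗ[k] L) (F : Finset ι → L) (G : Finset ι → Finset ι → L)
    (S : Finset ι) :
    insertSum p (fun A C => (shiftDeg p A + 1).negOnePow • T (convBracket D p (G A) F C)) S =
      -T (convBracket D p (insertSum p G) F S) := by
  have h := sum_powerset_assoc S fun A B C => ((shiftDeg p A + shiftDeg p B).negOnePow *
    (shiftSign p A B * shiftSign p A C * shiftSign p B C)) • T (D.bracket (G A B) (F C))
  have h1 : T (convBracket D p (insertSum p G) F S) =
      ∑ A ∈ S.powerset, ∑ B ∈ A.powerset, ((shiftDeg p B + shiftDeg p (A \ B)).negOnePow *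
        (shiftSign p B (A \ B) * shiftSign p B (S \ A) * shiftSign p (A \ B) (S \ A))) •
          T (D.bracket (G B (A \ B)) (F (S \ A))) := by
    rw [convBracket, map_sum]
    refine Finset.sum_congr rfl fun A hA => ?_
    rw [insertSum, map_sum, LinearMap.sum_apply, Finset.smul_sum, map_sum]
    refine Finset.sum_congr rfl fun B hB => ?_
    have hd : Disjoint B (A \ B) := Finset.disjoint_sdiff
    have hu : B ∪ (A \ B) = A := Finset.union_sdiff_of_subset (Finset.mem_powerset.1 hB)
    rw [map_unit_smul, map_unit_smul, LinearMap.smul_apply, map_unit_smul, smul_smul]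
    congr 1
    nth_rw 1 2 [← hu]
    rw [shiftDeg_union p hd, shiftSign_union_left p hd]
    ac_rfl
  rw [h1, h, insertSum, ← Finset.sum_neg_distrib]
  refine Finset.sum_congr rfl fun A hA => ?_
  rw [convBracket, map_sum, Finset.smul_sum, Finset.smul_sum, ← Finset.sum_neg_distrib]
  refine Finset.sum_congr rfl fun B hB => ?_
  have hd : Disjoint B ((S \ A) \ B) := Finset.disjoint_sdiff
  have hu : B ∪ ((S \ A) \ B) = S \ A := Finset.union_sdiff_of_subset (Finset.mem_powerset.1 hB)
  rw [map_unit_smul, smul_smul, smul_smul, ← Units.neg_smul]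
  congr 1
  nth_rw 1 [← hu]
  rw [shiftSign_union_right p A hd, Int.negOnePow_succ, Int.negOnePow_add, mul_neg, neg_mul,
    neg_inj]
  ac_rfl

/-- The projection `1 - [d, η]`. -/
def projHarmonic (η : L →ₗ[k] L) : L →ₗ[k] L := LinearMap.id - (D.d ∘ₗ η + η ∘ₗ D.d)

theorem projHarmonic_apply (η : L →ₗ[k] L) (x : L) :
    projHarmonic D η x = x - (D.d (η x) + η (D.d x)) := rfl

theorem etaBracket_homogeneous {η : L →ₗ[k] L} (hη : IsSplitting D η) :
    IsHomogeneousBilinear ℒ (-1, etaBracket D η) := fun i j x y hx hy =>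
  hη.degree _ _ (D.bracket_degree i j x y hx hy)

theorem projBracket_homogeneous {η : L →ₗ[k] L} (hη : IsSplitting D η) :
    IsHomogeneousBilinear ℒ (0, projBracket D η) := by
  intro i j x y hx hy
  have h := D.bracket_degree i j x y hx hy
  have h1 := D.d_degree _ _ (hη.degree _ _ h)
  have h2 := hη.degree _ _ (D.d_degree _ _ h)
  rw [sub_add_cancel] at h1
  rw [add_sub_cancel_right] at h2
  rw [add_zero]
  exact sub_mem h (add_mem h1 h2)

variable [Algebra ℚ k]

theorem half_smul_two_smul (x : L) : algebraMap ℚ k (1 / 2) • (2 : k) • x = x := by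
  rw [smul_smul, ← map_ofNat (algebraMap ℚ k) 2, ← map_mul]; norm_num

/-- Half the convolution bracket of a family with itself. -/
def halfSquare (F : Finset ι → L) (S : Finset ι) : L :=
  algebraMap ℚ k (1 / 2) • convBracket D p F F S

theorem halfSquare_of_card_le_one {F : Finset ι → L} (hF : F ∅ = 0) {S : Finset ι}
    (hS : S.card ≤ 1) : halfSquare D p F S = 0 := by
  rw [halfSquare, convBracket_of_card_le_one D p hF hS, smul_zero]

variable {F : Finset ι → L}

/-- Bianchi identity: dQ = [dF, F] for Q = ½[F, F], and [Q, F] = 0 by Jacobi, so Q may be subtracted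
from dF. -/
theorem d_halfSquare (hF : ∀ A, F A ∈ ℒ (shiftDeg p A + 1)) (S : Finset ι) :
    D.d (halfSquare D p F S) =
      convBracket D p (fun A => D.d (F A) - halfSquare D p F A) F S := by
  rw [halfSquare, map_smul, d_convBracket_self D p hF, half_smul_two_smul]
  have h1 := convBracket_add_left D p (fun A => D.d (F A) - halfSquare D p F A) (halfSquare D p F)
    F S
  have h2 : convBracket D p (halfSquare D p F) F S = 0 := by
    have := convBracket_smul_left D p (algebraMap ℚ k (1 / 2)) (convBracket D p F F) F S
    rw [convBracket_jacobi D p hF, smul_zero] at this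
    exact this
  rw [h2, add_zero] at h1
  rw [← h1]
  simp only [sub_add_cancel]

variable {η : L →ₗ[k] L}

/-- The curvature of a solution of `F = η (½[F, F]) + closed terms` agrees with the sum of
insertions of the operations `-(1 - [d, η]) ½[F, F]`. -/
theorem curvature_eq_insertSum (hF : ∀ A, F A ∈ ℒ (shiftDeg p A + 1)) (hF0 : F ∅ = 0)
    (hdF : ∀ S, D.d (F S) = D.d (η (halfSquare D p F S))) (G : Finset ι → Finset ι → L)
    (hG : ∀ A C, G A C = (if C = ∅ then
        -projHarmonic D η (halfSquare D p F A) else 0) +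
      (shiftDeg p A + 1).negOnePow • η (convBracket D p (G A) F C)) :
    (fun S => D.d (F S) - halfSquare D p F S) = insertSum p G := by
  refine convBracket_rec_unique D p hF0
    (fun S => -projHarmonic D η (halfSquare D p F S)) (-η)
    (fun S => ?_) fun S => ?_
  · rw [LinearMap.neg_apply, ← d_halfSquare D p hF, hdF]
    simp only [projHarmonic_apply]
    abel
  · rw [LinearMap.neg_apply, ← insertSum_convBracket, insertSum, insertSum]
    -- Only `A = S` has an empty complement, so only there does the inhomogeneous term of `G`
    -- survive.
    rw [← sub_eq_iff_eq_add, ← Finset.sum_sub_distrib, Finset.sum_eq_single S]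
    · rw [Finset.sdiff_self, shiftSign_empty_right, one_smul, one_smul, hG S ∅]
      simp
    · intro A hA hne
      have : S \ A ≠ ∅ := fun h => hne
        (Finset.Subset.antisymm (Finset.mem_powerset.1 hA) (Finset.sdiff_eq_empty_iff_subset.1 h))
      rw [hG A (S \ A), if_neg this, zero_add, sub_self]
    · intro h; simp at h

/-- The generalised Jacobi identities for the operations `-(1 - [d, η]) ½[F, F]`. -/
theorem insertSum_proj_eq_zero (hF : ∀ A, F A ∈ ℒ (shiftDeg p A + 1)) (hη : IsSplitting D η)
    (hF0 : F ∅ = 0)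
    (hdF : ∀ S, D.d (F S) = D.d (η (halfSquare D p F S))) (G : Finset ι → Finset ι → L)
    (hG : ∀ A C, G A C = (if C = ∅ then
        -projHarmonic D η (halfSquare D p F A) else 0) +
      (shiftDeg p A + 1).negOnePow • η (convBracket D p (G A) F C)) (S : Finset ι) :
    insertSum p (fun A C => (shiftDeg p A + 1).negOnePow •
      projHarmonic D η (convBracket D p (G A) F C)) S = 0 := by
  -- The sum is -PdQ, and Pd = d - dηd - ηdd = 0.
  rw [insertSum_convBracket, ← curvature_eq_insertSum D p hF hF0 hdF G hG, ← d_halfSquare D p hF]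
  simp [projHarmonic_apply, D.d_d, hη.d_η_d]

end Curvature

/-! ### Transport of signs and sums along embeddings -/

section Embeddings

variable {ι ι' : Type*} [LinearOrder ι] [LinearOrder ι']

theorem decalage_map (p : ι' → ℤ) (e : ι ↪o ι') (A : Finset ι) :
    decalage p (A.map e.toEmbedding) = decalage (fun i => p (e i)) A := by
  simp [decalage, Finset.prod_map]

theorem shiftDeg_map (p : ι' → ℤ) (e : ι ↪o ι') (A : Finset ι) :
    shiftDeg p (A.map e.toEmbedding) = shiftDeg (fun i => p (e i)) A := by
  simp [shiftDeg, Finset.sum_map]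

theorem sum_powerset_insert_map {N : Type*} [AddCommMonoid N] (e : ι ↪ ι') {x : ι'}
    (hx : ∀ i, e i ≠ x) (C : Finset ι) (h : Finset ι' → Finset ι' → N) :
    ∑ A ∈ (insert x (C.map e)).powerset, h A (insert x (C.map e) \ A) =
      ∑ A ∈ C.powerset, h (A.map e) (insert x ((C \ A).map e)) +
        ∑ A ∈ C.powerset, h (insert x (A.map e)) ((C \ A).map e) := by
  have hxC : ∀ A : Finset ι, x ∉ A.map e := by
    intro A hA
    obtain ⟨i, -, hi⟩ := Finset.mem_map.1 hA
    exact hx i hi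
  have hsum : ∀ f : Finset ι' → N,
      ∑ A ∈ (C.map e).powerset, f A = ∑ A ∈ C.powerset, f (A.map e) := by
    intro f
    have : (C.map e).powerset = C.powerset.map (Finset.mapEmbedding e).toEmbedding := by
      ext A
      simp only [Finset.mem_powerset, Finset.mem_map, Finset.subset_map_iff]
      exact exists_congr fun B => and_congr_right fun _ => eq_comm
    rw [this, Finset.sum_map]; rfl
  rw [Finset.sum_powerset_insert (hxC C), hsum, hsum]
  congr 1
  · refine Finset.sum_congr rfl fun A _ => ?_
    rw [Finset.insert_sdiff_of_notMem _ (hxC A), Finset.map_sdiff]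
  · refine Finset.sum_congr rfl fun A _ => ?_
    rw [Finset.insert_sdiff_insert, Finset.sdiff_insert_of_notMem (hxC C), Finset.map_sdiff]

end Embeddings

/-! ### The tree sums as a family of degree one -/

section Families

variable {k : Type*} [CommRing k] [Algebra ℚ k]
variable {L : Type*} [AddCommGroup L] [Module k L]
variable {ℒ : ℤ → Submodule k L} [DirectSum.Decomposition ℒ]
variable {ι ι' : Type*} [LinearOrder ι] [LinearOrder ι']

theorem treeOn_map_emb {p : ι' → ℤ} {a : ι' → L} (ha : ∀ i, a i ∈ ℒ (p i))
    (b₀ b : ℤ × (L →ₗ[k] L →ₗ[k] L)) (e : ι ↪o ι') (S : Finset ι) :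
    treeOn ℒ p a b₀ b (S.map e.toEmbedding) =
      treeOn ℒ (fun i => p (e i)) (fun i => a (e i)) b₀ b S := by
  rcases hn : S.card with _ | n
  · rw [Finset.card_eq_zero.1 hn, Finset.map_empty, treeOn_empty, treeOn_empty]
  · have h1 := treeOn_map ℒ (p := fun i => p (e i)) (a := fun i => a (e i)) (fun i => ha _) b₀ b
      (S.orderEmbOfFin hn)
    have h2 := treeOn_map ℒ ha b₀ b ((S.orderEmbOfFin hn).trans e)
    have h3 : Finset.univ.map ((S.orderEmbOfFin hn).trans e).toEmbedding =
        S.map e.toEmbedding := by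
      conv_rhs => rw [← Finset.map_orderEmbOfFin_univ S hn, Finset.map_map]
      rfl
    rw [Finset.map_orderEmbOfFin_univ] at h1
    rw [h3] at h2
    rw [h1, h2]; rfl

variable (D : DGLieAlgebra ℒ)

/-- The tree sums `f_S`, with the décalage sign. -/
def shiftedTree (η : L →ₗ[k] L) (p : ι → ℤ) (a : ι → L) (S : Finset ι) : L :=
  decalage p S • treeOn ℒ p a (-1, etaBracket D η) (-1, etaBracket D η) S

variable {D} {η : L →ₗ[k] L} {p : ι → ℤ} {a : ι → L}

theorem shiftedTree_empty : shiftedTree D η p a ∅ = 0 := by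
  rw [shiftedTree, treeOn_empty, smul_zero]

theorem shiftedTree_singleton (i : ι) : shiftedTree D η p a {i} = a i := by
  rw [shiftedTree, treeOn_singleton]
  simp [decalage]

theorem shiftedTree_mem (hη : IsSplitting D η) (ha : ∀ i, a i ∈ ℒ (p i)) (S : Finset ι) :
    shiftedTree D η p a S ∈ ℒ (shiftDeg p S + 1) := by
  have h := treeOn_mem_self ℒ ha (etaBracket_homogeneous D hη) S
  have h1 : ∑ i ∈ S, p i + ((S.card : ℤ) - 1) * -1 = shiftDeg p S + 1 := by
    rw [shiftDeg_eq]; ring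
  rw [h1] at h
  exact unit_smul_mem _ _ h

theorem shiftedTree_map {p : ι' → ℤ} {a : ι' → L} (ha : ∀ i, a i ∈ ℒ (p i)) (e : ι ↪o ι')
    (S : Finset ι) :
    shiftedTree D η p a (S.map e.toEmbedding) =
      shiftedTree D η (fun i => p (e i)) (fun i => a (e i)) S := by
  rw [shiftedTree, treeOn_map_emb ha, decalage_map, shiftedTree]

theorem halfSquare_shiftedTree (p : ι → ℤ) (a : ι → L) (S : Finset ι) :
    halfSquare D p (shiftedTree D η p a) S =
      decalage p S • algebraMap ℚ k (1 / 2) • ∑ A ∈ S.powerset, splitSign p (-1) A (S \ A) •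
        D.bracket (treeOn ℒ p a (-1, etaBracket D η) (-1, etaBracket D η) A)
          (treeOn ℒ p a (-1, etaBracket D η) (-1, etaBracket D η) (S \ A)) := by
  rw [halfSquare, smul_comm (decalage p S), convBracket, Finset.smul_sum (r := decalage p S)]
  congr 1
  refine Finset.sum_congr rfl fun A hA => ?_
  have hu : A ∪ (S \ A) = S := Finset.union_sdiff_of_subset (Finset.mem_powerset.1 hA)
  have hs := decalage_mul_splitSign p (A := A) (B := S \ A) Finset.disjoint_sdiff
  rw [hu] at hs
  rw [smul_smul, hs, shiftedTree, shiftedTree]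
  simp only [map_unit_smul, LinearMap.smul_apply, smul_smul]

/-- The recursion for tree sums in terms of the convolution bracket. -/
theorem decalage_smul_treeOn (ha : ∀ i, a i ∈ ℒ (p i)) (m : ℤ) (T : L →ₗ[k] L) {S : Finset ι}
    (hS : 2 ≤ S.card) :
    decalage p S • treeOn ℒ p a (m, D.bracket.compr₂ T) (-1, etaBracket D η) S =
      T (halfSquare D p (shiftedTree D η p a) S) := by
  rw [treeOn_eq ℒ ha _ _ hS, halfSquare_shiftedTree, map_unit_smul, map_smul, map_sum]
  simp only [map_unit_smul, LinearMap.compr₂_apply]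

/-- With `g` also at the root, the recursion closes up to the fixed point equation of F. -/
theorem shiftedTree_eq (ha : ∀ i, a i ∈ ℒ (p i)) {S : Finset ι} (hS : 2 ≤ S.card) :
    shiftedTree D η p a S = η (halfSquare D p (shiftedTree D η p a) S) :=
  decalage_smul_treeOn ha (-1) η hS

/-- F and ηQ differ only on singletons, where Q vanishes and F is closed. -/
theorem d_shiftedTree (ha : ∀ i, a i ∈ ℒ (p i)) (hda : ∀ i, D.d (a i) = 0) (S : Finset ι) :
    D.d (shiftedTree D η p a S) = D.d (η (halfSquare D p (shiftedTree D η p a) S)) := by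
  rcases Nat.lt_or_ge 1 S.card with h | h
  · rw [← shiftedTree_eq ha h]
  · rw [halfSquare_of_card_le_one D p shiftedTree_empty h, map_zero, map_zero]
    by_cases h0 : S = ∅
    · rw [h0, shiftedTree_empty, map_zero]
    · obtain ⟨i, hi⟩ := Finset.card_eq_one.1
        (le_antisymm h (Finset.card_pos.2 (Finset.nonempty_iff_ne_empty.2 h0)))
      rw [hi, shiftedTree_singleton, hda]

end Families

/-! ### Families with an additional first element -/

section

variable {k : Type*} [CommRing k]
variable {L : Type*} [AddCommGroup L] [Module k L] {ℒ : ℤ → Submodule k L}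
variable {n : ℕ} {p : Fin n → ℤ} {a : Fin n → L}

theorem cons_mem {s : ℤ} {m : L} (hm : m ∈ ℒ s) (ha : ∀ i, a i ∈ ℒ (p i)) (i : Fin (n + 1)) :
    (Fin.cons m a : Fin (n + 1) → L) i ∈ ℒ ((Fin.cons s p : Fin (n + 1) → ℤ) i) := by
  refine Fin.cases ?_ (fun i => ?_) i
  · exact hm
  · exact ha i

end

section Cons

variable {k : Type*} [CommRing k] [Algebra ℚ k]
variable {L : Type*} [AddCommGroup L] [Module k L]
variable {ℒ : ℤ → Submodule k L} [DirectSum.Decomposition ℒ]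
variable {D : DGLieAlgebra ℒ} {η : L →ₗ[k] L} {n : ℕ} {p : Fin n → ℤ} {a : Fin n → L}

/-- The set `{0} ∪ (C + 1)`. -/
def consSet (C : Finset (Fin n)) : Finset (Fin (n + 1)) :=
  insert 0 (C.map (Fin.succOrderEmb n).toEmbedding)

theorem zero_notMem_map_succ (C : Finset (Fin n)) :
    (0 : Fin (n + 1)) ∉ C.map (Fin.succOrderEmb n).toEmbedding := by
  simp [Fin.succ_ne_zero]

theorem card_consSet (C : Finset (Fin n)) : (consSet C).card = C.card + 1 := by
  rw [consSet, Finset.card_insert_of_notMem (zero_notMem_map_succ C), Finset.card_map]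

theorem shiftDeg_consSet (s : ℤ) (p : Fin n → ℤ) (C : Finset (Fin n)) :
    shiftDeg (Fin.cons s p : Fin (n + 1) → ℤ) (consSet C) = s - 1 + shiftDeg p C := by
  rw [shiftDeg, consSet, Finset.sum_insert (zero_notMem_map_succ C), Finset.sum_map]
  simp [shiftDeg]

theorem shiftSign_consSet_left (s : ℤ) (p : Fin n → ℤ) (A B : Finset (Fin n)) :
    shiftSign (Fin.cons s p : Fin (n + 1) → ℤ) (consSet A)
      (B.map (Fin.succOrderEmb n).toEmbedding) = shiftSign p A B := by
  rw [shiftSign, consSet, Finset.prod_insert (zero_notMem_map_succ A)]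
  simp [shiftSign, Finset.prod_map]

theorem shiftSign_consSet_right (s : ℤ) (p : Fin n → ℤ) (A B : Finset (Fin n)) :
    shiftSign (Fin.cons s p : Fin (n + 1) → ℤ) (A.map (Fin.succOrderEmb n).toEmbedding)
      (consSet B) = ((s - 1) * shiftDeg p A).negOnePow * shiftSign p A B := by
  simp only [shiftSign, consSet, Finset.prod_insert (zero_notMem_map_succ B)]
  rw [shiftDeg, Finset.mul_sum, negOnePow_sum]
  simp [Finset.prod_map, Finset.prod_mul_distrib, mul_comm]

/-- `f̃(m, a_C)`: the tree sum with an additional first argument `m` of degree `s`. -/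
def consTree (D : DGLieAlgebra ℒ) (η : L →ₗ[k] L) (p : Fin n → ℤ) (a : Fin n → L) (s : ℤ) (m : L)
    (C : Finset (Fin n)) : L :=
  shiftedTree D η (Fin.cons s p : Fin (n + 1) → ℤ) (Fin.cons m a : Fin (n + 1) → L) (consSet C)

/-- The first argument lies in the left or in the right branch. By graded symmetry both cases
contribute the same, which cancels the ½ and makes the recursion linear in the tree sums containing
`m`. -/
theorem halfSquare_consSet (hη : IsSplitting D η) {s : ℤ} {m : L} (hm : m ∈ ℒ s)
    (ha : ∀ i, a i ∈ ℒ (p i)) (C : Finset (Fin n)) :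
    halfSquare D (Fin.cons s p : Fin (n + 1) → ℤ)
        (shiftedTree D η (Fin.cons s p : Fin (n + 1) → ℤ) (Fin.cons m a : Fin (n + 1) → L))
        (consSet C) =
      (s - 1).negOnePow • convBracket D p (consTree D η p a s m) (shiftedTree D η p a) C := by
  have hX := shiftedTree_mem hη ha
  have hY : ∀ C, consTree D η p a s m C ∈ ℒ (shiftDeg p C + s) := fun C => by
    have := shiftedTree_mem hη (cons_mem hm ha) (consSet C)
    rwa [shiftDeg_consSet, show s - 1 + shiftDeg p C + 1 = shiftDeg p C + s by ring] at this
  have hmap : ∀ A : Finset (Fin n), shiftedTree D η (Fin.cons s p : Fin (n + 1) → ℤ)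
      (Fin.cons m a : Fin (n + 1) → L) (A.map (Fin.succOrderEmb n).toEmbedding) =
      shiftedTree D η p a A := fun A => shiftedTree_map (cons_mem hm ha) (Fin.succOrderEmb n) A
  have hdeg : ∀ A : Finset (Fin n), shiftDeg (Fin.cons s p : Fin (n + 1) → ℤ)
      (A.map (Fin.succOrderEmb n).toEmbedding) = shiftDeg p A :=
    fun A => shiftDeg_map _ (Fin.succOrderEmb n) A
  have key : convBracket D (Fin.cons s p : Fin (n + 1) → ℤ)
        (shiftedTree D η (Fin.cons s p : Fin (n + 1) → ℤ) (Fin.cons m a : Fin (n + 1) → L))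
        (shiftedTree D η (Fin.cons s p : Fin (n + 1) → ℤ) (Fin.cons m a : Fin (n + 1) → L))
        (consSet C) =
      (2 : k) • (s - 1).negOnePow •
        convBracket D p (consTree D η p a s m) (shiftedTree D η p a) C := by
    rw [convBracket, consSet, sum_powerset_insert_map _ (by simp [Fin.succ_ne_zero]) C
      fun A B => ((shiftDeg (Fin.cons s p : Fin (n + 1) → ℤ) A).negOnePow *
        shiftSign (Fin.cons s p : Fin (n + 1) → ℤ) A B) • D.bracket
        (shiftedTree D η (Fin.cons s p : Fin (n + 1) → ℤ) (Fin.cons m a : Fin (n + 1) → L) A)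
        (shiftedTree D η (Fin.cons s p : Fin (n + 1) → ℤ) (Fin.cons m a : Fin (n + 1) → L) B)]
    rw [two_smul]
    congr 1
    · rw [← sum_bracket_swap D p s hX hY]
      refine Finset.sum_congr rfl fun A _ => ?_
      rw [hmap, hdeg, ← consSet, shiftSign_consSet_right, ← mul_assoc, ← Int.negOnePow_add,
        show shiftDeg p A + (s - 1) * shiftDeg p A = s * shiftDeg p A by ring]
      rfl
    · rw [convBracket, Finset.smul_sum]
      refine Finset.sum_congr rfl fun A _ => ?_
      rw [hmap, ← consSet, shiftSign_consSet_left, shiftDeg_consSet, Int.negOnePow_add, mul_assoc,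
        mul_smul]
      rfl
  rw [halfSquare, key, half_smul_two_smul]

/-- The recursion for tree sums with an additional first argument. -/
theorem decalage_smul_treeOn_consSet (hη : IsSplitting D η) {s : ℤ} {m : L} (hm : m ∈ ℒ s)
    (ha : ∀ i, a i ∈ ℒ (p i)) (m₀ : ℤ) (T : L →ₗ[k] L) {C : Finset (Fin n)} (hC : C ≠ ∅) :
    decalage (Fin.cons s p : Fin (n + 1) → ℤ) (consSet C) •
      treeOn ℒ (Fin.cons s p : Fin (n + 1) → ℤ) (Fin.cons m a : Fin (n + 1) → L)
        (m₀, D.bracket.compr₂ T) (-1, etaBracket D η) (consSet C) =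
      (s - 1).negOnePow • T (convBracket D p (consTree D η p a s m) (shiftedTree D η p a) C) := by
  have hcard : 2 ≤ (consSet C).card := by
    rw [card_consSet]
    have := Finset.card_pos.2 (Finset.nonempty_iff_ne_empty.2 hC)
    omega
  rw [decalage_smul_treeOn (cons_mem hm ha) m₀ T hcard, halfSquare_consSet hη hm ha, map_unit_smul]

theorem consTree_empty (s : ℤ) (m : L) : consTree D η p a s m ∅ = m := by
  have : consSet (∅ : Finset (Fin n)) = {0} := by simp [consSet]
  rw [consTree, this, shiftedTree_singleton, Fin.cons_zero]

theorem consTree_eq (hη : IsSplitting D η) {s : ℤ} {m : L} (hm : m ∈ ℒ s)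
    (ha : ∀ i, a i ∈ ℒ (p i)) (C : Finset (Fin n)) :
    consTree D η p a s m C = (if C = ∅ then m else 0) +
      (s - 1).negOnePow • η (convBracket D p (consTree D η p a s m) (shiftedTree D η p a) C) := by
  by_cases hC : C = ∅
  · rw [hC, if_pos rfl, convBracket_empty D p shiftedTree_empty, map_zero, smul_zero, add_zero,
      consTree_empty]
  · rw [if_neg hC, zero_add]
    exact decalage_smul_treeOn_consSet hη hm ha (-1) η hC

end Cons

/-! ### Removing the décalage signs -/

section Unshifted

variable {k : Type*} [CommRing k] [Algebra ℚ k]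
variable {L : Type*} [AddCommGroup L] [Module k L]
variable {ℒ : ℤ → Submodule k L} [DirectSum.Decomposition ℒ]
variable {D : DGLieAlgebra ℒ} {η : L →ₗ[k] L}

/-- The operations `μ_S` of the minimal model at the elements `a i`, `i ∈ S`. -/
def modelOn {ι : Type*} [LinearOrder ι] (D : DGLieAlgebra ℒ) (η : L →ₗ[k] L) (p : ι → ℤ)
    (a : ι → L) (S : Finset ι) : L :=
  if S.card ≤ 1 then 0 else -treeOn ℒ p a (0, projBracket D η) (-1, etaBracket D η) S

theorem decalage_smul_modelOn {ι : Type*} [LinearOrder ι] {p : ι → ℤ} {a : ι → L}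
    (ha : ∀ i, a i ∈ ℒ (p i)) (S : Finset ι) :
    decalage p S • modelOn D η p a S =
      -projHarmonic D η (halfSquare D p (shiftedTree D η p a) S) := by
  rw [modelOn]
  split_ifs with h
  · rw [halfSquare_of_card_le_one D p shiftedTree_empty h, map_zero, neg_zero, smul_zero]
  · rw [smul_neg, neg_inj]
    exact decalage_smul_treeOn ha 0 (projHarmonic D η) (by omega)

theorem modelOn_mem {ι : Type*} [LinearOrder ι] (hη : IsSplitting D η) {p : ι → ℤ} {a : ι → L}
    (ha : ∀ i, a i ∈ ℒ (p i)) (S : Finset ι) : modelOn D η p a S ∈ ℒ (shiftDeg p S + 2) := by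
  rw [modelOn]
  split_ifs with h
  · exact zero_mem _
  · have := treeOn_mem ℒ ha (projBracket_homogeneous D hη) (etaBracket_homogeneous D hη)
      (S := S) (by omega)
    have h1 : ∑ i ∈ S, p i + (0 + ((S.card : ℤ) - 2) * -1) = shiftDeg p S + 2 := by
      rw [shiftDeg_eq]; ring
    rw [h1] at this
    exact neg_mem this

variable {n : ℕ} {p : Fin n → ℤ} {a : Fin n → L}

theorem decalage_consSet (s : ℤ) (p : Fin n → ℤ) (C : Finset (Fin n)) :
    decalage (Fin.cons s p : Fin (n + 1) → ℤ) (consSet C) =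
      (C.card * s).negOnePow * decalage p C := by
  have h : (C.card * s).negOnePow = ∏ _i ∈ C, s.negOnePow := by
    rw [← negOnePow_sum, Finset.sum_const, nsmul_eq_mul]
  rw [decalage, consSet, h]
  simp only [Finset.prod_insert (zero_notMem_map_succ C)]
  simp [decalage, Finset.prod_map]

/-- The operation on `A`, placed first, has the parity of |A| plus the sum of the degrees over `A`.
Its décalage past `C` and the sign in `decalage_union` leave (-1)^{|A||C|}, which is the sign
(-1)^{r(l-1)} of `insertionSum`. -/
theorem decalage_mul_insert_sign (p : Fin n → ℤ) {A C : Finset (Fin n)} (h : Disjoint A C) :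
    shiftSign p A C * (decalage p A *
        decalage (Fin.cons (shiftDeg p A + 2) p : Fin (n + 1) → ℤ) (consSet C)) =
      decalage p (A ∪ C) * (((A.card : ℤ) * C.card).negOnePow * cross p A C) := by
  have h1 := decalage_union p h
  have h2 : ((C.card : ℤ) * (shiftDeg p A + 2)).negOnePow * (C.card * ∑ i ∈ A, p i).negOnePow =
      ((A.card : ℤ) * C.card).negOnePow := by
    rw [← Int.negOnePow_add, Int.negOnePow_eq_iff, shiftDeg_eq]
    exact ⟨C.card * (∑ i ∈ A, p i - A.card + 1), by ring⟩
  rw [decalage_consSet, ← h2]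
  calc _ = ((C.card : ℤ) * (shiftDeg p A + 2)).negOnePow *
        (shiftSign p A C * (decalage p A * decalage p C)) := by ac_rfl
    _ = _ := by rw [← h1]; ac_rfl

/-- The family `a` with `μ_A` as an additional first element. -/
def insertModel (D : DGLieAlgebra ℒ) (η : L →ₗ[k] L) (p : Fin n → ℤ) (a : Fin n → L)
    (A : Finset (Fin n)) : Fin (n + 1) → L :=
  Fin.cons (modelOn D η p a A) a

theorem insertModel_mem (hη : IsSplitting D η) (ha : ∀ i, a i ∈ ℒ (p i)) (A : Finset (Fin n))
    (i : Fin (n + 1)) : insertModel D η p a A i ∈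
      ℒ ((Fin.cons (shiftDeg p A + 2) p : Fin (n + 1) → ℤ) i) :=
  cons_mem (modelOn_mem hη ha A) ha i

/-- Supplies the hypothesis `hG` of `curvature_eq_insertSum` and `insertSum_proj_eq_zero`, for
G_A(C) the tree sum with μ_A as first argument. -/
theorem decalage_smul_consTree_eq (hη : IsSplitting D η) (ha : ∀ i, a i ∈ ℒ (p i))
    (A C : Finset (Fin n)) :
    decalage p A • consTree D η p a (shiftDeg p A + 2) (modelOn D η p a A) C =
      (if C = ∅ then -projHarmonic D η (halfSquare D p (shiftedTree D η p a) A) else 0) +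
        (shiftDeg p A + 1).negOnePow • η (convBracket D p (fun C => decalage p A •
          consTree D η p a (shiftDeg p A + 2) (modelOn D η p a A) C) (shiftedTree D η p a) C) := by
  rw [convBracket_unit_smul_left D p, map_unit_smul, consTree_eq hη (modelOn_mem hη ha A) ha C,
    smul_add, ← decalage_smul_modelOn ha]
  congr 1
  · split_ifs <;> simp
  · rw [smul_comm, show shiftDeg p A + 2 - 1 = shiftDeg p A + 1 by ring]

theorem decalage_smul_modelOn_consSet (hη : IsSplitting D η) {s : ℤ} {m : L} (hm : m ∈ ℒ s)
    (ha : ∀ i, a i ∈ ℒ (p i)) (C : Finset (Fin n)) :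
    decalage (Fin.cons s p : Fin (n + 1) → ℤ) (consSet C) •
      modelOn D η (Fin.cons s p : Fin (n + 1) → ℤ) (Fin.cons m a : Fin (n + 1) → L) (consSet C) =
      -((s - 1).negOnePow • projHarmonic D η
        (convBracket D p (consTree D η p a s m) (shiftedTree D η p a) C)) := by
  rw [decalage_smul_modelOn (cons_mem hm ha), halfSquare_consSet hη hm ha, map_unit_smul]

/-- The equation of an `L_∞`-morphism for tree sums. -/
theorem morphism_eq_treeOn (hη : IsSplitting D η) (ha : ∀ i, a i ∈ ℒ (p i))
    (hda : ∀ i, D.d (a i) = 0) (S : Finset (Fin n)) :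
    D.d (treeOn ℒ p a (-1, etaBracket D η) (-1, etaBracket D η) S) -
        algebraMap ℚ k (1 / 2) • ∑ A ∈ S.powerset, splitSign p (-1) A (S \ A) •
          D.bracket (treeOn ℒ p a (-1, etaBracket D η) (-1, etaBracket D η) A)
            (treeOn ℒ p a (-1, etaBracket D η) (-1, etaBracket D η) (S \ A)) =
      ∑ A ∈ S.powerset,
        (((A.card : ℤ) * (S \ A).card).negOnePow * cross p A (S \ A)) •
          treeOn ℒ (Fin.cons (shiftDeg p A + 2) p : Fin (n + 1) → ℤ) (insertModel D η p a A)
            (-1, etaBracket D η) (-1, etaBracket D η) (consSet (S \ A)) := by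
  have h := congrFun (curvature_eq_insertSum D p (shiftedTree_mem hη ha) shiftedTree_empty
    (d_shiftedTree ha hda) _ (decalage_smul_consTree_eq hη ha)) S
  refine smul_left_cancel (decalage p S) ?_
  rw [insertSum] at h
  convert h using 1
  · rw [smul_sub, shiftedTree, map_unit_smul]
    congr 1
    have h1 : halfSquare D p (shiftedTree D η p a) S =
        decalage p S • algebraMap ℚ k (1 / 2) • ∑ A ∈ S.powerset, splitSign p (-1) A (S \ A) •
          D.bracket (treeOn ℒ p a (-1, etaBracket D η) (-1, etaBracket D η) A)
            (treeOn ℒ p a (-1, etaBracket D η) (-1, etaBracket D η) (S \ A)) := by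
      rw [halfSquare_shiftedTree]
    rw [h1]
  · rw [Finset.smul_sum]
    refine Finset.sum_congr rfl fun A hA => ?_
    have hu : A ∪ (S \ A) = S := Finset.union_sdiff_of_subset (Finset.mem_powerset.1 hA)
    have hs := decalage_mul_insert_sign p (A := A) (C := S \ A) Finset.disjoint_sdiff
    rw [hu] at hs
    rw [smul_smul, ← hs, mul_smul, mul_smul]
    rfl

/-- The generalised Jacobi identities for tree sums. -/
theorem jacobi_modelOn (hη : IsSplitting D η) (ha : ∀ i, a i ∈ ℒ (p i))
    (hda : ∀ i, D.d (a i) = 0) (S : Finset (Fin n)) :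
    ∑ A ∈ S.powerset,
        (((A.card : ℤ) * (S \ A).card).negOnePow * cross p A (S \ A)) •
          modelOn D η (Fin.cons (shiftDeg p A + 2) p : Fin (n + 1) → ℤ) (insertModel D η p a A)
            (consSet (S \ A)) = 0 := by
  have h := insertSum_proj_eq_zero D p (shiftedTree_mem hη ha) hη shiftedTree_empty
    (d_shiftedTree ha hda) _ (decalage_smul_consTree_eq hη ha) S
  refine smul_left_cancel (decalage p S) ?_
  rw [smul_zero, ← neg_eq_zero, ← h, insertSum, Finset.smul_sum, ← Finset.sum_neg_distrib]
  refine Finset.sum_congr rfl fun A hA => ?_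
  have hu : A ∪ (S \ A) = S := Finset.union_sdiff_of_subset (Finset.mem_powerset.1 hA)
  have hs := decalage_mul_insert_sign p (A := A) (C := S \ A) Finset.disjoint_sdiff
  rw [hu] at hs
  rw [smul_smul, ← hs, mul_smul, mul_smul, insertModel,
    decalage_smul_modelOn_consSet hη (modelOn_mem hη ha A) ha, convBracket_unit_smul_left D p,
    smul_neg, smul_neg, neg_neg, map_unit_smul, smul_comm (decalage p A),
    show shiftDeg p A + 2 - 1 = shiftDeg p A + 1 by ring]

end Unshifted

/-! ### The maps of the theorem as tree sums over sets -/

section Values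

variable {k : Type*} [CommRing k] [Algebra ℚ k]
variable {L : Type*} [AddCommGroup L] [Module k L]
variable {ℒ : ℤ → Submodule k L} [DirectSum.Decomposition ℒ]
variable {D : DGLieAlgebra ℒ} {η : L →ₗ[k] L}
variable {ι : Type*} [LinearOrder ι] {p : ι → ℤ} {x : ι → harmonic D η}

theorem modelMap_apply (hx : ∀ i, (x i : L) ∈ ℒ (p i)) {n : ℕ} (e : Fin n ↪o ι) :
    modelMap D η n (fun i => x (e i)) =
      treeOn ℒ p (fun i => (x i : L)) (-1, etaBracket D η) (-1, etaBracket D η)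
        (Finset.univ.map e.toEmbedding) := by
  match n with
  | 0 =>
    rw [Finset.univ_eq_empty, Finset.map_empty, treeOn_empty]; rfl
  | 1 =>
    have : Finset.univ.map e.toEmbedding = {e 0} := by simp
    rw [this, treeOn_singleton]; rfl
  | n + 2 =>
    rw [treeOn_map ℒ hx]; rfl

theorem minimalModel_apply (hη : IsSplitting D η) (hx : ∀ i, (x i : L) ∈ ℒ (p i)) {n : ℕ}
    (e : Fin n ↪o ι) :
    (minimalModel D hη n (fun i => x (e i)) : L) =
      modelOn D η p (fun i => (x i : L)) (Finset.univ.map e.toEmbedding) := by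
  rw [modelOn, Finset.card_map, Finset.card_univ, Fintype.card_fin]
  match n with
  | 0 => rfl
  | 1 => rfl
  | n + 2 =>
    rw [if_neg (by omega), treeOn_map ℒ hx, ← neg_smul, ← map_neg]; rfl

end Values

/-! ### Shuffles -/

section Shuffles

variable {n : ℕ}

/-- The increasing enumeration of the first `r` values of a shuffle. -/
def shuffleLeft {r : ℕ} (hr : r ≤ n) {σ : Equiv.Perm (Fin n)} (hσ : σ ∈ shuffles r n) :
    Fin r ↪o Fin n :=
  OrderEmbedding.ofStrictMono (fun i => σ ⟨i, i.2.trans_le hr⟩) fun _ j hij =>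
    (Finset.mem_filter.1 hσ).2 _ _ hij (Or.inl j.2)

/-- The increasing enumeration of the last `n - r` values of a shuffle. -/
def shuffleRight {r : ℕ} (hr : r ≤ n) {σ : Equiv.Perm (Fin n)} (hσ : σ ∈ shuffles r n) :
    Fin (n - r) ↪o Fin n :=
  OrderEmbedding.ofStrictMono (fun i => σ ⟨r + i, by omega⟩) fun i j hij =>
    (Finset.mem_filter.1 hσ).2 _ _ (Nat.add_lt_add_left hij r) (Or.inr (Nat.le_add_right _ _))

theorem shuffleLeft_apply {r : ℕ} (hr : r ≤ n) {σ : Equiv.Perm (Fin n)} (hσ : σ ∈ shuffles r n)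
    (i : Fin r) : shuffleLeft hr hσ i = σ ⟨i, i.2.trans_le hr⟩ := rfl

theorem shuffleRight_apply {r : ℕ} (hr : r ≤ n) {σ : Equiv.Perm (Fin n)} (hσ : σ ∈ shuffles r n)
    (i : Fin (n - r)) : shuffleRight hr hσ i = σ ⟨r + i, by omega⟩ := rfl

theorem map_shuffleRight {r : ℕ} (hr : r ≤ n) {σ : Equiv.Perm (Fin n)} (hσ : σ ∈ shuffles r n) :
    Finset.univ.map (shuffleRight hr hσ).toEmbedding =
      Finset.univ \ Finset.univ.map (shuffleLeft hr hσ).toEmbedding := by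
  ext x
  simp only [Finset.mem_map, Finset.mem_univ, true_and, Finset.mem_sdiff]
  constructor
  · rintro ⟨i, rfl⟩ ⟨j, hj⟩
    have := congrArg Fin.val (σ.injective hj)
    simp only at this
    omega
  · intro h
    have h1 : r ≤ (σ.symm x : ℕ) := by
      by_contra hlt
      exact h ⟨⟨σ.symm x, by omega⟩, by
        change σ ⟨(σ.symm x : ℕ), _⟩ = x
        simp⟩
    refine ⟨⟨σ.symm x - r, by omega⟩, ?_⟩
    change σ ⟨r + (σ.symm x - r), _⟩ = x
    have h2 : (⟨r + (σ.symm x - r), by omega⟩ : Fin n) = σ.symm x := Fin.ext (by simp; omega)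
    rw [h2, Equiv.apply_symm_apply]

/-- The word of a shuffle consists of two increasing words, so all inversions are between them. -/
theorem chi_of_mem_shuffles {r : ℕ} (hr : r ≤ n) {σ : Equiv.Perm (Fin n)} (hσ : σ ∈ shuffles r n)
    (p : Fin n → ℤ) :
    chi σ p = cross p (Finset.univ.map (shuffleLeft hr hσ).toEmbedding)
      (Finset.univ.map (shuffleRight hr hσ).toEmbedding) := by
  have h1 : List.ofFn σ = List.ofFn (shuffleLeft hr hσ) ++ List.ofFn (shuffleRight hr hσ) := by
    refine List.ext_getElem (by simp; omega) fun i hi hi' => ?_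
    rw [List.getElem_append]
    split_ifs with h
    · simp only [List.getElem_ofFn, shuffleLeft_apply]
    · simp only [List.length_ofFn, not_lt] at h
      simp only [List.getElem_ofFn, List.length_ofFn, shuffleRight_apply]
      congr 2
      exact (Nat.add_sub_of_le h).symm
  have h2 : ∀ {m : ℕ} (e : Fin m ↪o Fin n),
      List.ofFn e ∈ orderings (Finset.univ.map e.toEmbedding) := fun e =>
    mem_orderings_of_nodup (List.nodup_ofFn.2 e.injective) fun x => by simp [List.mem_ofFn]
  have h3 : ∀ {m : ℕ} (e : Fin m ↪o Fin n), listChi p (List.ofFn e) = 1 := fun e =>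
    listChi_of_pairwise_lt p (List.pairwise_ofFn.2 fun i j hij => e.strictMono hij)
  have h4 := chi_eq_listChi p (OrderIso.refl (Fin n)).toOrderEmbedding σ
  have h5 : (List.ofFn fun i => (OrderIso.refl (Fin n)).toOrderEmbedding (σ i)) = List.ofFn σ := rfl
  rw [h5, h1, listChi_append_of_mem_orderings p (h2 _) (h2 _), h3, h3, one_mul, one_mul] at h4
  exact h4

/-- A sum over the shuffles as a sum over the subsets with `r` elements. -/
theorem sum_shuffles {N : Type*} [AddCommMonoid N] {r : ℕ} (hr : r ≤ n)
    (h : Equiv.Perm (Fin n) → N) (h' : Finset (Fin n) → N)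
    (hh : ∀ σ (hσ : σ ∈ shuffles r n),
      h σ = h' (Finset.univ.map (shuffleLeft hr hσ).toEmbedding)) :
    ∑ σ ∈ shuffles r n, h σ = ∑ A ∈ Finset.univ.powersetCard r, h' A := by
  refine Finset.sum_bij (fun σ hσ => Finset.univ.map (shuffleLeft hr hσ).toEmbedding) ?_ ?_ ?_ hh
  · intro σ hσ
    simp [Finset.mem_powersetCard]
  · intro σ hσ τ hτ hστ
    have hστ' : Finset.univ.map (shuffleRight hr hσ).toEmbedding =
        Finset.univ.map (shuffleRight hr hτ).toEmbedding := by
      rw [map_shuffleRight, map_shuffleRight, hστ]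
    -- An increasing enumeration is determined by its image; hence the set of the first `r` values
    -- determines the shuffle.
    have huniq : ∀ {m : ℕ} (e e' : Fin m ↪o Fin n),
        Finset.univ.map e.toEmbedding = Finset.univ.map e'.toEmbedding → e = e' := by
      intro m e e' hee
      have hc : (Finset.univ.map e'.toEmbedding).card = m := by simp
      rw [Finset.orderEmbOfFin_unique' hc (f := e) fun i => by rw [← hee]; simp,
        ← Finset.orderEmbOfFin_unique' hc (f := e') fun i => by simp]
    have hl := huniq _ _ hστ
    have hr' := huniq _ _ hστ'
    ext i
    congr 1
    rcases lt_or_ge (i : ℕ) r with hi | hi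
    · exact congrArg (fun e : Fin r ↪o Fin n => e ⟨i, hi⟩) hl
    · have := congrArg (fun e : Fin (n - r) ↪o Fin n => e ⟨i - r, by omega⟩) hr'
      change σ ⟨r + (i - r), _⟩ = τ ⟨r + (i - r), _⟩ at this
      have h2 : (⟨r + (i - r), by omega⟩ : Fin n) = i := Fin.ext (by simp; omega)
      rwa [h2] at this
  · intro A hA
    have hAc : A.card = r := (Finset.mem_powersetCard.1 hA).2
    have hAc' : (Aᶜ).card = n - r := by rw [Finset.card_compl, hAc, Fintype.card_fin]
    -- The preimage of `A`: enumerate `A` increasingly, then its complement.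
    let σ : Equiv.Perm (Fin n) := (finCongr (by omega : n = r + (n - r))).trans
      (finSumFinEquiv.symm.trans (finSumEquivOfFinset hAc hAc'))
    have hl : ∀ (i : Fin n) (hi : (i : ℕ) < r), σ i = A.orderEmbOfFin hAc ⟨i, hi⟩ := by
      intro i hi
      have : (finCongr (by omega : n = r + (n - r))) i = Fin.castAdd (n - r) ⟨i, hi⟩ := by
        ext; simp
      simp only [σ, Equiv.trans_apply, this, finSumFinEquiv_symm_apply_castAdd,
        finSumEquivOfFinset_inl]
    have hr' : ∀ (i : Fin n) (hi : r ≤ (i : ℕ)),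
        σ i = Aᶜ.orderEmbOfFin hAc' ⟨i - r, by omega⟩ := by
      intro i hi
      have : (finCongr (by omega : n = r + (n - r))) i =
          Fin.natAdd r ⟨i - r, by omega⟩ := by
        ext; simp; omega
      simp only [σ, Equiv.trans_apply, this, finSumFinEquiv_symm_apply_natAdd,
        finSumEquivOfFinset_inr]
    have hσ : σ ∈ shuffles r n := by
      refine Finset.mem_filter.2 ⟨Finset.mem_univ _, fun i j hij h => ?_⟩
      rcases h with h | h
      · rw [hl i (lt_trans hij h), hl j h]
        exact (A.orderEmbOfFin hAc).strictMono hij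
      · have hj : r ≤ (j : ℕ) := h.trans (le_of_lt hij)
        rw [hr' i h, hr' j hj]
        refine (Aᶜ.orderEmbOfFin hAc').strictMono ?_
        rw [Fin.lt_def] at hij ⊢
        simp only
        omega
    refine ⟨σ, hσ, ?_⟩
    have : shuffleLeft hr hσ = A.orderEmbOfFin hAc := by
      ext i
      exact congrArg Fin.val (hl ⟨i, i.2.trans_le hr⟩ i.2)
    rw [this, Finset.map_orderEmbOfFin_univ]

variable {k : Type*} [CommRing k]
variable {L : Type*} [AddCommGroup L] [Module k L]
variable {M : Type*} [AddCommGroup M] [Module k M]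

/-- A shuffle is recorded by the set of its first `r` values. Serves both the Jacobi identities and
the right hand side of the morphism equation. -/
theorem insertionSum_eq (f : ∀ n : ℕ, MultilinearMap k (fun _ : Fin n => L) M)
    (μ : ∀ n : ℕ, MultilinearMap k (fun _ : Fin n => L) L) (p : Fin n → ℤ) (a : Fin n → L)
    (h : Finset (Fin n) → M)
    (hh : ∀ (r s : ℕ) (e : Fin r ↪o Fin n) (e' : Fin s ↪o Fin n),
      Finset.univ.map e'.toEmbedding = Finset.univ \ Finset.univ.map e.toEmbedding →
      f (s + 1) (Fin.cons (μ r fun i => a (e i)) fun i => a (e' i)) =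
        h (Finset.univ.map e.toEmbedding)) :
    insertionSum f μ n p a = ∑ A ∈ (Finset.univ : Finset (Fin n)).powerset,
      (((A.card : ℤ) * (Finset.univ \ A).card).negOnePow * cross p A (Finset.univ \ A)) • h A := by
  rw [Finset.sum_powerset, Finset.card_univ, Fintype.card_fin, Finset.sum_range, insertionSum]
  refine Finset.sum_congr rfl fun r _ => ?_
  have hr : (r : ℕ) ≤ n := by omega
  refine sum_shuffles hr _ _ fun σ hσ => ?_
  rw [← hh _ _ (shuffleLeft hr hσ) (shuffleRight hr hσ) (map_shuffleRight hr hσ),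
    chi_of_mem_shuffles hr hσ, map_shuffleRight hr hσ]
  congr 3
  rw [Finset.card_sdiff_of_subset (Finset.subset_univ _)]
  simp [hr]

end Shuffles

/-! ### Values of antisymmetric maps on words -/

section Words

variable {k : Type*} [CommRing k]
variable {L : Type*} [AddCommGroup L] [Module k L]
variable {M : Type*} [AddCommGroup M] [Module k M]
variable {ι : Type*}

/-- The value of a family of multilinear maps at the elements `a i`, for `i` in the word `w`. -/
def evalWord (f : ∀ n : ℕ, MultilinearMap k (fun _ : Fin n => L) M) (a : ι → L) (w : List ι) : M :=
  f w.length fun i => a (w.get i)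

/-- Compares members of a family whose numbers of arguments are only propositionally equal. -/
theorem family_congr (f : ∀ n : ℕ, MultilinearMap k (fun _ : Fin n => L) M) {m n : ℕ}
    {v : Fin m → L} {w : Fin n → L} (h : m = n)
    (hvw : ∀ i (hi : i < m) (hi' : i < n), v ⟨i, hi⟩ = w ⟨i, hi'⟩) : f m v = f n w := by
  subst h
  congr 1
  ext i
  exact hvw i i.2 i.2

theorem evalWord_ofFn (f : ∀ n : ℕ, MultilinearMap k (fun _ : Fin n => L) M) (a : ι → L) {n : ℕ}
    (s : Fin n → ι) : evalWord f a (List.ofFn s) = f n fun i => a (s i) :=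
  family_congr f (List.length_ofFn) fun i hi hi' => by simp

variable [LinearOrder ι] {ℒ : ℤ → Submodule k L}

theorem evalWord_of_mem_orderings {f : ∀ n : ℕ, MultilinearMap k (fun _ : Fin n => L) M}
    (hf : ∀ n, IsGradedAntisymmetric ℒ (f n)) {p : ι → ℤ} {a : ι → L} (ha : ∀ i, a i ∈ ℒ (p i))
    {h : Finset ι → M}
    (hh : ∀ (r : ℕ) (e : Fin r ↪o ι), f r (fun i => a (e i)) = h (Finset.univ.map e.toEmbedding))
    {A : Finset ι} {w : List ι} (hw : w ∈ orderings A) :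
    evalWord f a w = listChi p w • h A := by
  rw [← Finset.map_orderEmbOfFin_univ A rfl] at hw
  obtain ⟨σ, rfl⟩ := exists_perm_of_mem_orderings _ hw
  rw [evalWord_ofFn]
  have h1 := hf A.card σ (fun i => p (A.orderEmbOfFin rfl i)) (fun i => a (A.orderEmbOfFin rfl i))
    fun i => ha _
  rw [hh A.card (A.orderEmbOfFin rfl), Finset.map_orderEmbOfFin_univ, chi_eq_listChi] at h1
  exact h1

end Words

theorem toLInfinity_eq_zero {k M : Type*} [CommRing k] [AddCommGroup M] [Module k M]
    {ℳ : ℤ → Submodule k M} (D : DGLieAlgebra ℳ) {m : ℕ} (h1 : m ≠ 1) (h2 : m ≠ 2) :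
    D.toLInfinity m = 0 := by
  match m with
  | 0 => rfl
  | 1 => exact absurd rfl h1
  | 2 => exact absurd rfl h2
  | m + 3 => rfl

/-! ### The left hand side of the morphism equation for a Lie target -/

section CompMulti

variable {k : Type*} [CommRing k] [Algebra ℚ k]
variable {L : Type*} [AddCommGroup L] [Module k L]
variable {M : Type*} [AddCommGroup M] [Module k M]
variable {ℒ : ℤ → Submodule k L} {ℳ : ℤ → Submodule k M}
variable (D : DGLieAlgebra ℳ)

variable {f : ∀ n : ℕ, MultilinearMap k (fun _ : Fin n => L) M}
variable {n : ℕ} {p : Fin n → ℤ} {a : Fin n → L}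

theorem compMulti_eq_zero (I : Composition n) (h1 : I.length ≠ 1) (h2 : I.length ≠ 2) :
    compMulti D.toLInfinity f I p a = 0 := by
  simp [compMulti, toLInfinity_eq_zero D h1 h2]

/-- By antisymmetry all n! permutations contribute the same, which cancels 1/n!. -/
theorem compMulti_single (hf : ∀ n, IsGradedAntisymmetric ℒ (f n)) (ha : ∀ i, a i ∈ ℒ (p i))
    (hn : 0 < n) : compMulti D.toLInfinity f (Composition.single n hn) p a = D.d (f n a) := by
  have hterm : ∀ σ : Equiv.Perm (Fin n),
      (chi σ p * ∏ s : Fin (Composition.single n hn).length,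
        ∏ t : Fin (Composition.single n hn).length,
          if s < t then ((1 - ((Composition.single n hn).blocksFun t : ℤ)) *
            ∑ x, p (σ ((Composition.single n hn).embedding s x))).negOnePow else 1) •
        D.toLInfinity (Composition.single n hn).length (fun s =>
          f ((Composition.single n hn).blocksFun s)
            (fun x => a (σ ((Composition.single n hn).embedding s x)))) = D.d (f n a) := by
    intro σ
    have h1 : (∏ s : Fin (Composition.single n hn).length,
        ∏ t : Fin (Composition.single n hn).length,
          if s < t then ((1 - ((Composition.single n hn).blocksFun t : ℤ)) *
            ∑ x, p (σ ((Composition.single n hn).embedding s x))).negOnePow else 1) = 1 := by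
      refine Finset.prod_eq_one fun s _ => Finset.prod_eq_one fun t _ => if_neg ?_
      have hs : (s : ℕ) < 1 := s.2
      have ht : (t : ℕ) < 1 := t.2
      rw [Fin.lt_def]; omega
    have h2 : f ((Composition.single n hn).blocksFun (0 : Fin 1))
        (fun x => a (σ ((Composition.single n hn).embedding (0 : Fin 1) x))) =
        f n fun i => a (σ i) := by
      refine family_congr f rfl fun i hi hi' => ?_
      congr 2
      exact Fin.ext ((Composition.coe_embedding (Composition.single n hn) (0 : Fin 1) ⟨i, hi⟩).trans
        (by simp [Composition.sizeUpTo]))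
    rw [h1, mul_one]
    change chi σ p • D.d (f ((Composition.single n hn).blocksFun (0 : Fin 1))
        (fun x => a (σ ((Composition.single n hn).embedding (0 : Fin 1) x)))) = _
    rw [h2, hf n σ p a ha, map_unit_smul, smul_smul, Int.units_mul_self, one_smul]
  have hfac : ((∏ s, ((Composition.single n hn).blocksFun s).factorial : ℕ)) = n.factorial :=
    Fin.prod_univ_one (fun s : Fin 1 => ((Composition.single n hn).blocksFun s).factorial)
  rw [compMulti, Finset.sum_congr rfl fun σ _ => hterm σ, Finset.sum_const, Finset.card_univ,
    Fintype.card_perm, Fintype.card_fin, hfac, Composition.single_length, Nat.factorial_one,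
    ← Nat.cast_smul_eq_nsmul k, smul_smul, ← map_natCast (algebraMap ℚ k), ← map_mul]
  have : (n.factorial : ℚ) ≠ 0 := by positivity
  rw [Nat.cast_one, mul_one, one_div, inv_mul_cancel₀ this, map_one, one_smul]

/-- Each subset `A` of size i arises from i! j! permutations with equal contributions; of the factor
1/(i! j! 2!) only 1/2 remains. -/
theorem compMulti_pair (hf : ∀ n, IsGradedAntisymmetric ℒ (f n)) (ha : ∀ i, a i ∈ ℒ (p i))
    {h : Finset (Fin n) → M}
    (hh : ∀ (r : ℕ) (e : Fin r ↪o Fin n),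
      f r (fun i => a (e i)) = h (Finset.univ.map e.toEmbedding))
    {i j : ℕ} (hpos : ∀ {m}, m ∈ [i, j] → 0 < m) (hsum : [i, j].sum = n) :
    compMulti D.toLInfinity f ⟨[i, j], hpos, hsum⟩ p a =
      algebraMap ℚ k (1 / 2) • ∑ A ∈ (Finset.univ : Finset (Fin n)).powersetCard i,
        (((1 - (j : ℤ)) * ∑ x ∈ A, p x).negOnePow * cross p A (Finset.univ \ A)) •
          D.bracket (h A) (h (Finset.univ \ A)) := by
  have hij : i + j = n := by simpa using hsum
  set I : Composition n := ⟨[i, j], hpos, hsum⟩ with hI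
  have hterm : ∀ σ : Equiv.Perm (Fin n),
      (chi σ p * ∏ s : Fin I.length, ∏ t : Fin I.length,
          if s < t then ((1 - (I.blocksFun t : ℤ)) * ∑ x, p (σ (I.embedding s x))).negOnePow
          else 1) •
        D.toLInfinity I.length (fun s => f (I.blocksFun s) (fun x => a (σ (I.embedding s x)))) =
      (fun u v => (listChi p (u ++ v) * ((1 - (j : ℤ)) * (u.map p).sum).negOnePow) •
        D.bracket (evalWord f a u) (evalWord f a v))
        ((List.ofFn σ).take i) ((List.ofFn σ).drop i) := by
    intro σ
    have h1 : (∏ s : Fin I.length, ∏ t : Fin I.length,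
          if s < t then ((1 - (I.blocksFun t : ℤ)) * ∑ x, p (σ (I.embedding s x))).negOnePow
          else 1) =
        ((1 - (j : ℤ)) * ∑ x, p (σ (I.embedding (0 : Fin 2) x))).negOnePow := by
      refine (Fin.prod_univ_two (fun s : Fin 2 => ∏ t : Fin 2,
        if s < t then ((1 - (I.blocksFun t : ℤ)) * ∑ x, p (σ (I.embedding s x))).negOnePow
          else 1)).trans ?_
      simp only [Fin.prod_univ_two]
      simp
      rfl
    have htake : (List.ofFn σ).take i = List.ofFn fun x => σ (I.embedding (0 : Fin 2) x) := by
      have hb : I.blocksFun (0 : Fin 2) = i := rfl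
      refine List.ext_getElem (by simp only [List.length_take, List.length_ofFn, hb]; omega)
        fun x hx hx' => ?_
      simp only [List.getElem_take, List.getElem_ofFn]
      congr 1
      exact Fin.ext ((Composition.coe_embedding I (0 : Fin 2) ⟨x, by simpa using hx'⟩).trans
        (by simp [Composition.sizeUpTo])).symm
    have hdrop : (List.ofFn σ).drop i = List.ofFn fun x => σ (I.embedding (1 : Fin 2) x) := by
      have hb : I.blocksFun (1 : Fin 2) = j := rfl
      refine List.ext_getElem (by simp only [List.length_drop, List.length_ofFn, hb]; omega)
        fun x hx hx' => ?_
      simp only [List.getElem_drop, List.getElem_ofFn]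
      congr 1
    have hchi : chi σ p = listChi p (List.ofFn σ) :=
      chi_eq_listChi p (OrderIso.refl (Fin n)).toOrderEmbedding σ
    rw [h1]
    simp only [List.take_append_drop]
    rw [htake, hdrop, evalWord_ofFn, evalWord_ofFn, hchi, List.map_ofFn, List.sum_ofFn]
    rfl
  have hfac : (∏ s, (I.blocksFun s).factorial : ℕ) = i.factorial * j.factorial :=
    Fin.prod_univ_two (fun s : Fin 2 => (I.blocksFun s).factorial)
  have hlen : I.length.factorial = 2 := rfl
  have hsplit := sum_perm_eq_sum_orderings (Function.Embedding.refl (Fin n)) fun l =>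
    (fun u v => (listChi p (u ++ v) * ((1 - (j : ℤ)) * (u.map p).sum).negOnePow) •
        D.bracket (evalWord f a u) (evalWord f a v)) (l.take i) (l.drop i)
  rw [Finset.map_refl, sum_orderings_take_drop Finset.univ i (by simp; omega) fun u v =>
    (listChi p (u ++ v) * ((1 - (j : ℤ)) * (u.map p).sum).negOnePow) •
        D.bracket (evalWord f a u) (evalWord f a v)] at hsplit
  rw [compMulti, Finset.sum_congr rfl fun σ _ => hterm σ, hfac, hlen]
  refine (congrArg _ hsplit).trans ?_
  have hA : ∀ A ∈ (Finset.univ : Finset (Fin n)).powersetCard i,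
      ∑ u ∈ orderings A, ∑ v ∈ orderings (Finset.univ \ A),
        (listChi p (u ++ v) * ((1 - (j : ℤ)) * (u.map p).sum).negOnePow) •
          D.bracket (evalWord f a u) (evalWord f a v) =
      ((i.factorial * j.factorial : ℕ) : k) •
        (((1 - (j : ℤ)) * ∑ x ∈ A, p x).negOnePow * cross p A (Finset.univ \ A)) •
          D.bracket (h A) (h (Finset.univ \ A)) := by
    intro A hA
    have hAc := (Finset.mem_powersetCard.1 hA).2
    have hBc : (Finset.univ \ A).card = j := by
      rw [Finset.card_sdiff_of_subset (Finset.subset_univ _), hAc]; simp; omega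
    have huv : ∀ u ∈ orderings A, ∀ v ∈ orderings (Finset.univ \ A),
        (listChi p (u ++ v) * ((1 - (j : ℤ)) * (u.map p).sum).negOnePow) •
          D.bracket (evalWord f a u) (evalWord f a v) =
        (((1 - (j : ℤ)) * ∑ x ∈ A, p x).negOnePow * cross p A (Finset.univ \ A)) •
          D.bracket (h A) (h (Finset.univ \ A)) := by
      intro u hu v hv
      rw [evalWord_of_mem_orderings hf ha hh hu, evalWord_of_mem_orderings hf ha hh hv,
        listChi_append_of_mem_orderings p hu hv, sum_map_of_mem_orderings hu]
      simp only [map_unit_smul, LinearMap.smul_apply, smul_smul]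
      congr 1
      -- The signs of `u` and `v` occur twice, in the sign of the whole word and through the
      -- antisymmetry of `f`, and cancel.
      generalize listChi p u = s
      generalize listChi p v = t
      rw [show s * t * cross p A (Finset.univ \ A) * ((1 - (j : ℤ)) * ∑ x ∈ A, p x).negOnePow *
          (s * t)
        = (s * s) * (t * t) * (((1 - (j : ℤ)) * ∑ x ∈ A, p x).negOnePow *
          cross p A (Finset.univ \ A)) by ac_rfl, Int.units_mul_self, Int.units_mul_self,
          one_mul, one_mul]
    rw [Finset.sum_congr rfl fun u hu => Finset.sum_congr rfl fun v hv => huv u hu v hv,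
      Finset.sum_const, Finset.sum_const, card_orderings, card_orderings, hAc, hBc,
      smul_smul, Nat.cast_smul_eq_nsmul]
  rw [Finset.sum_congr rfl hA, ← Finset.smul_sum, smul_smul, ← map_natCast (algebraMap ℚ k),
    ← map_mul]
  congr 2
  have hne : ((i.factorial * j.factorial : ℕ) : ℚ) ≠ 0 := by positivity
  push_cast at hne ⊢
  field_simp

/-- The left hand side of the equation of an `L_∞`-morphism to a differential graded Lie
algebra. -/
theorem sum_compMulti (hf : ∀ n, IsGradedAntisymmetric ℒ (f n)) (ha : ∀ i, a i ∈ ℒ (p i))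
    {h : Finset (Fin n) → M} (h0 : h ∅ = 0)
    (hh : ∀ (r : ℕ) (e : Fin r ↪o Fin n),
      f r (fun i => a (e i)) = h (Finset.univ.map e.toEmbedding)) :
    ∑ I : Composition n,
        ((-1 : ℤˣ) ^ (I.length * (I.length - 1) / 2 +
          ∑ s : Fin I.length, I.blocksFun s * (I.length - 1 - s))) •
            compMulti D.toLInfinity f I p a =
      D.d (h Finset.univ) - algebraMap ℚ k (1 / 2) •
        ∑ A ∈ (Finset.univ : Finset (Fin n)).powerset, splitSign p (-1) A (Finset.univ \ A) •
          D.bracket (h A) (h (Finset.univ \ A)) := by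
  set t : Composition n → M := fun I => ((-1 : ℤˣ) ^ (I.length * (I.length - 1) / 2 +
          ∑ s : Fin I.length, I.blocksFun s * (I.length - 1 - s))) •
            compMulti D.toLInfinity f I p a with ht
  have ht0 : ∀ I : Composition n, t I =
      (if I.length = 1 then t I else 0) + (if I.length = 2 then t I else 0) := by
    intro I
    by_cases h1 : I.length = 1
    · simp [h1]
    · by_cases h2 : I.length = 2
      · simp [h2]
      · simp [h1, h2, ht, compMulti_eq_zero D I h1 h2]
  rw [Finset.sum_congr rfl fun I _ => ht0 I, Finset.sum_add_distrib, sub_eq_add_neg]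
  congr 1
  · rcases Nat.eq_zero_or_pos n with hn | hn
    · subst hn
      have hu : (Finset.univ : Finset (Fin 0)) = ∅ := Finset.univ_eq_empty
      rw [hu, h0, map_zero]
      refine Finset.sum_eq_zero fun I _ => if_neg ?_
      have := I.length_le
      omega
    · rw [Finset.sum_eq_single (Composition.single n hn)]
      · rw [if_pos (Composition.single_length hn), ht]
        simp only
        have h1 : f n a = h Finset.univ :=
          (hh n (OrderIso.refl (Fin n)).toOrderEmbedding).trans (congrArg h (by ext; simp))
        have hsgn : (-1 : ℤˣ) ^ ((Composition.single n hn).length *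
            ((Composition.single n hn).length - 1) / 2 + ∑ s : Fin (Composition.single n hn).length,
            (Composition.single n hn).blocksFun s *
              ((Composition.single n hn).length - 1 - s)) = 1 := by
          change (-1 : ℤˣ) ^ (1 * (1 - 1) / 2 + ∑ s : Fin 1, [n].get s * (1 - 1 - s)) = _
          simp
        rw [compMulti_single D hf ha hn, h1, hsgn, one_smul]
      · intro I _ hI
        exact if_neg fun h => hI ((Composition.eq_single_iff_length hn).2 h)
      · simp
  · rw [← Finset.sum_filter]
    rcases Nat.lt_or_ge n 2 with hn | hn
    · rw [Finset.sum_eq_zero, Finset.sum_eq_zero, smul_zero, neg_zero]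
      · intro A _
        rcases Finset.eq_empty_or_nonempty A with hA | hA
        · rw [hA, h0, map_zero, LinearMap.zero_apply, smul_zero]
        · have hA' : A = Finset.univ := (Finset.card_eq_iff_eq_univ A).1 (le_antisymm
            (Finset.card_le_univ A) (by rw [Fintype.card_fin]; have := hA.card_pos; omega))
          rw [hA', Finset.sdiff_self, h0, map_zero, smul_zero]
      · intro I hI
        have := I.length_le
        have := (Finset.mem_filter.1 hI).2
        omega
    · obtain ⟨m, rfl⟩ := Nat.exists_eq_add_of_le' hn
      rw [sum_powerset_of_card (n := m) (by simp) _ (by simp [h0]) (by simp [h0]), Finset.smul_sum,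
        ← Finset.sum_neg_distrib]
      symm
      refine Finset.sum_bij (fun ij hij => ⟨[ij.1 + 1, ij.2 + 1], by simp, by
        have := Finset.HasAntidiagonal.mem_antidiagonal.1 hij
        simp; omega⟩) ?_ ?_ ?_ ?_
      · intro ij hij
        exact Finset.mem_filter.2 ⟨Finset.mem_univ _, rfl⟩
      · intro ij hij ij' hij' heq
        have := congrArg Composition.blocks heq
        simp only [List.cons.injEq, Nat.add_right_cancel_iff, and_true] at this
        exact Prod.ext this.1 this.2
      · intro I hI
        obtain ⟨b, c, hbc⟩ := List.length_eq_two.1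
          (show I.blocks.length = 2 from (Finset.mem_filter.1 hI).2)
        have hb : 0 < b := I.blocks_pos (by rw [hbc]; simp)
        have hc : 0 < c := I.blocks_pos (by rw [hbc]; simp)
        have hs := I.blocks_sum
        rw [hbc] at hs
        simp only [List.sum_cons, List.sum_nil, add_zero] at hs
        refine ⟨(b - 1, c - 1), Finset.HasAntidiagonal.mem_antidiagonal.2 (by simp only; omega),
          Composition.ext ?_⟩
        simp only [hbc]
        rw [Nat.sub_add_cancel hb, Nat.sub_add_cancel hc]
      · rintro ⟨i, j⟩ hij
        have hij' := Finset.HasAntidiagonal.mem_antidiagonal.1 hij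
        simp only at hij'
        simp only [ht]
        rw [compMulti_pair D hf ha hh (fun hm => by simp at hm; omega), smul_comm, ← smul_neg]
        congr 1
        rw [Finset.smul_sum, ← Finset.sum_neg_distrib]
        refine Finset.sum_congr rfl fun A hA => ?_
        have hAc := (Finset.mem_powersetCard.1 hA).2
        have hBc : (Finset.univ \ A).card = j + 1 := by
          rw [Finset.card_sdiff_of_subset (Finset.subset_univ _), hAc]; simp; omega
        -- For two blocks the exponent is 1 + i₁: the 1 gives the minus sign in front of ½[F, F],
        -- and i₁ = |A| the first factor of `splitSign`.
        have hsgn : ∀ I : Composition (m + 2), I.blocks = [i + 1, j + 1] →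
            (-1 : ℤˣ) ^ (I.length * (I.length - 1) / 2 +
              ∑ s : Fin I.length, I.blocksFun s * (I.length - 1 - s)) = -(-1) ^ (i + 1) := by
          rintro ⟨_, _, _⟩ rfl
          change (-1 : ℤˣ) ^ (2 * (2 - 1) / 2 + ∑ s : Fin 2, [i + 1, j + 1].get s * (2 - 1 - s)) = _
          simp [Fin.sum_univ_two, pow_add]
        rw [hsgn _ rfl, smul_smul, splitSign, hAc, hBc, ← Units.neg_smul]
        congr 1
        rw [show (((j + 1 : ℕ) : ℤ) - 1) * -1 * ∑ i ∈ A, p i =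
          (1 - ((j + 1 : ℕ) : ℤ)) * ∑ i ∈ A, p i by ring]
        rw [neg_mul, mul_assoc]

end CompMulti

/-! ### Differential graded Lie algebras are `L_∞`-algebras -/

section DGLInfinity

variable {k : Type*} [CommRing k]
variable {L : Type*} [AddCommGroup L] [Module k L] {ℒ : ℤ → Submodule k L}
variable (D : DGLieAlgebra ℒ)

theorem toLInfinity_one_apply (v : Fin 1 → L) : D.toLInfinity 1 v = D.d (v 0) := rfl

theorem toLInfinity_two_apply (v : Fin 2 → L) : D.toLInfinity 2 v = D.bracket (v 0) (v 1) := rfl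

theorem toLInfinity_hasDegree (n : ℕ) : HasDegree ℒ ℒ (D.toLInfinity n) (2 - n) := by
  intro p a ha
  match n with
  | 0 => exact zero_mem _
  | 1 =>
    rw [toLInfinity_one_apply, Fin.sum_univ_one]
    exact D.d_degree _ _ (ha 0)
  | 2 =>
    rw [toLInfinity_two_apply, Fin.sum_univ_two]
    simpa using D.bracket_degree _ _ _ _ (ha 0) (ha 1)
  | n + 3 => exact zero_mem _

theorem chi_one {n : ℕ} (p : Fin n → ℤ) : chi 1 p = 1 := by
  refine Finset.prod_eq_one fun i _ => Finset.prod_eq_one fun j _ => if_neg fun h => ?_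
  exact lt_asymm h.1 h.2

theorem chi_swap_two (p : Fin 2 → ℤ) :
    chi (Equiv.swap 0 1) p = -(p 0 * p 1).negOnePow := by
  simp [chi, Fin.prod_univ_two, mul_comm]

theorem toLInfinity_antisymm (n : ℕ) : IsGradedAntisymmetric ℒ (D.toLInfinity n) := by
  intro σ p a ha
  match n with
  | 0 => rw [toLInfinity_eq_zero D (by simp) (by simp)]; simp
  | 1 =>
    have : σ = 1 := Subsingleton.elim _ _
    rw [this, chi_one, one_smul]; rfl
  | 2 =>
    have : σ = 1 ∨ σ = Equiv.swap 0 1 := by revert σ; decide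
    rcases this with rfl | rfl
    · rw [chi_one, one_smul]; rfl
    · rw [toLInfinity_two_apply, toLInfinity_two_apply, chi_swap_two,
        D.antisymm _ _ _ _ (ha 0) (ha 1), smul_neg, Units.neg_smul, neg_neg, smul_smul,
        Int.units_mul_self, one_smul]
      simp
  | n + 3 => rw [toLInfinity_eq_zero D (by simp) (by simp)]; simp

theorem insertion_eq_zero {n r : ℕ} (h : (r ≠ 1 ∧ r ≠ 2) ∨ (n - r + 1 ≠ 1 ∧ n - r + 1 ≠ 2))
    (v : Fin r → L) (w : Fin (n - r) → L) :
    D.toLInfinity (n - r + 1) (Fin.cons (D.toLInfinity r v) w) = 0 := by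
  rcases h with h | h
  · exact MultilinearMap.map_coord_zero _ 0 (by
      rw [Fin.cons_zero, toLInfinity_eq_zero D h.1 h.2]; rfl)
  · rw [toLInfinity_eq_zero D h.1 h.2]; rfl

theorem sum_shuffles_toLInfinity_eq_zero {n : ℕ} (p : Fin n → ℤ) (a : Fin n → L) (r : Fin (n + 1))
    (hr : ((r : ℕ) ≠ 1 ∧ (r : ℕ) ≠ 2) ∨ (n - r + 1 ≠ 1 ∧ n - r + 1 ≠ 2)) :
    ∑ σ ∈ shuffles r n, (((r : ℤ) * ((n : ℤ) - r)).negOnePow * chi σ p) •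
      D.toLInfinity (n - r + 1) (Fin.cons (D.toLInfinity r (fun i : Fin r => a (σ ⟨i, by omega⟩)))
        (fun i : Fin (n - r) => a (σ ⟨r + i, by omega⟩))) = 0 :=
  Finset.sum_eq_zero fun σ _ => by rw [insertion_eq_zero D hr, smul_zero]

theorem insertionSum_toLInfinity_one (p : Fin 1 → ℤ) (a : Fin 1 → L) :
    insertionSum D.toLInfinity D.toLInfinity 1 p a = 0 := by
  rw [insertionSum, Fin.sum_univ_two, sum_shuffles_toLInfinity_eq_zero D p a 0 (by simp), zero_add]
  refine Finset.sum_eq_zero fun σ _ => ?_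
  change _ • D.d (D.d _) = 0
  rw [D.d_d, smul_zero]

theorem insertionSum_toLInfinity_two (p : Fin 2 → ℤ) (a : Fin 2 → L) (ha : ∀ i, a i ∈ ℒ (p i)) :
    insertionSum D.toLInfinity D.toLInfinity 2 p a = 0 := by
  have h1 : shuffles 1 2 = {1, Equiv.swap 0 1} := by decide
  have h2 : shuffles 2 2 = {1} := by decide
  rw [insertionSum, Fin.sum_univ_three, sum_shuffles_toLInfinity_eq_zero D p a 0 (by simp),
    zero_add]
  change ∑ σ ∈ shuffles 1 2, (((1 : ℤ) * (2 - 1)).negOnePow * chi σ p) •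
      D.bracket (D.d (a (σ 0))) (a (σ 1)) +
    ∑ σ ∈ shuffles 2 2, (((2 : ℤ) * (2 - 2)).negOnePow * chi σ p) •
      D.d (D.bracket (a (σ 0)) (a (σ 1))) = 0
  rw [h1, h2, Finset.sum_pair (by decide), Finset.sum_singleton, chi_one, chi_swap_two]
  simp only [Equiv.Perm.one_apply, Equiv.swap_apply_left, Equiv.swap_apply_right]
  have hs : ((1 : ℤ) * (2 - 1)).negOnePow = -1 := by simp
  have hs' : ((2 : ℤ) * (2 - 2)).negOnePow = 1 := by simp
  rw [D.leibniz _ _ _ (ha 0), D.antisymm _ _ _ _ (D.d_degree _ _ (ha 1)) (ha 0), hs, hs',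
    smul_neg, smul_smul, mul_one, mul_one, one_smul, neg_mul_neg, one_mul, Units.neg_smul,
    one_smul, ← Int.negOnePow_add]
  have h3 : (p 0 * p 1 + (p 1 + 1) * p 0).negOnePow = (p 0).negOnePow := by
    rw [Int.negOnePow_eq_iff]
    exact ⟨p 0 * p 1, by ring⟩
  rw [h3]
  abel

theorem insertionSum_toLInfinity_three (p : Fin 3 → ℤ) (a : Fin 3 → L) (ha : ∀ i, a i ∈ ℒ (p i)) :
    insertionSum D.toLInfinity D.toLInfinity 3 p a = 0 := by
  have h1 : shuffles 2 3 = {1, Equiv.swap 1 2, finRotate 3} := by decide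
  have e1 : (Equiv.swap 1 2 : Equiv.Perm (Fin 3)) 0 = 0 := by decide
  have e2 : (Equiv.swap 1 2 : Equiv.Perm (Fin 3)) 1 = 2 := by decide
  have e3 : (Equiv.swap 1 2 : Equiv.Perm (Fin 3)) 2 = 1 := by decide
  have f1 : finRotate 3 0 = 1 := by decide
  have f2 : finRotate 3 1 = 2 := by decide
  have f3 : finRotate 3 2 = 0 := by decide
  have h2 : chi (Equiv.swap 1 2) p = -(p 1 * p 2).negOnePow := by
    simp only [chi, Fin.prod_univ_three, e1, e2, e3]
    simp [mul_comm]
  have h3 : chi (finRotate 3) p = (p 0 * p 1 + p 0 * p 2).negOnePow := by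
    simp only [chi, Fin.prod_univ_three, f1, f2, f3]
    simp [mul_comm, Int.negOnePow_add]
  rw [insertionSum, Fin.sum_univ_four, sum_shuffles_toLInfinity_eq_zero D p a 0 (by simp),
    sum_shuffles_toLInfinity_eq_zero D p a 1 (by simp),
    sum_shuffles_toLInfinity_eq_zero D p a 3 (by simp)]
  simp only [zero_add, add_zero]
  change ∑ σ ∈ shuffles 2 3, (((2 : ℤ) * (3 - 2)).negOnePow * chi σ p) •
      D.bracket (D.bracket (a (σ 0)) (a (σ 1))) (a (σ 2)) = 0
  rw [h1, Finset.sum_insert (by decide), Finset.sum_pair (by decide), chi_one, h2, h3]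
  simp only [Equiv.Perm.one_apply, e1, e2, e3, f1, f2, f3]
  have hs : ((2 : ℤ) * (3 - 2)).negOnePow = 1 := Int.negOnePow_even _ (by decide)
  -- `bracket_jacobi_cyclic` takes shifted degrees.
  have hx : ∀ i, a i ∈ ℒ (p i - 1 + 1) := fun i => by rw [sub_add_cancel]; exact ha i
  have h := bracket_jacobi_cyclic D (hx 0) (hx 1) (hx 2)
  have h' := congrArg (fun y => (p 1 - 1).negOnePow • y) h
  simp only [smul_add, smul_smul, smul_zero, ← Int.negOnePow_add] at h'
  rw [hs, ← h']
  simp only [one_mul, ← Int.negOnePow_succ]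
  have s1 : (p 1 - 1 + (p 1 - 1)).negOnePow = 1 := Int.negOnePow_even _ ⟨p 1 - 1, rfl⟩
  have s2 : (p 1 - 1 + (p 2 - 1 + (p 1 - 1) * (p 2 - 1))).negOnePow =
      (p 1 * p 2 + 1).negOnePow := by
    rw [Int.negOnePow_eq_iff]
    exact ⟨-1, by ring⟩
  have s3 : (p 1 - 1 + (p 2 - 1 + (p 0 - 1) * (p 1 - 1) + (p 0 - 1) * (p 2 - 1))).negOnePow =
      (p 0 * p 1 + p 0 * p 2).negOnePow := by
    rw [Int.negOnePow_eq_iff]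
    exact ⟨-p 0, by ring⟩
  rw [s1, s2, s3]
  abel

/-- Both r and n - r + 1 must be 1 or 2, so only n = 1, 2, 3 matter: d² = 0, the Leibniz rule and
the Jacobi identity. -/
theorem insertionSum_toLInfinity (n : ℕ) (p : Fin n → ℤ) (a : Fin n → L)
    (ha : ∀ i, a i ∈ ℒ (p i)) : insertionSum D.toLInfinity D.toLInfinity n p a = 0 := by
  by_cases hn : n = 1 ∨ n = 2 ∨ n = 3
  · rcases hn with rfl | rfl | rfl
    · exact insertionSum_toLInfinity_one D p a
    · exact insertionSum_toLInfinity_two D p a ha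
    · exact insertionSum_toLInfinity_three D p a ha
  · exact Finset.sum_eq_zero fun r _ => sum_shuffles_toLInfinity_eq_zero D p a r (by omega)

/-- A differential graded Lie algebra is an `L_∞`-algebra. -/
theorem isLInfinityAlgebra_toLInfinity [DirectSum.Decomposition ℒ] :
    IsLInfinityAlgebra ℒ D.toLInfinity where
  graded := DirectSum.Decomposition.isInternal ℒ
  zero := rfl
  degree := toLInfinity_hasDegree D
  antisymm := toLInfinity_antisymm D
  jacobi := insertionSum_toLInfinity D

end DGLInfinity

/-! ### The harmonic submodule -/

section Harmonic

variable {k : Type*} [CommRing k]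
variable {L : Type*} [AddCommGroup L] [Module k L] {ℒ : ℤ → Submodule k L}
variable {D : DGLieAlgebra ℒ} {η : L →ₗ[k] L}

/-- Applying d to dηx + ηdx = 0 leaves dηdx = dx; applying η instead gives the companion
`eta_of_mem_harmonic`. -/
theorem d_of_mem_harmonic (hη : IsSplitting D η) {x : L} (hx : x ∈ harmonic D η) : D.d x = 0 := by
  have h : D.d (η x) + η (D.d x) = 0 := hx
  have h1 := congrArg D.d h
  rwa [map_add, D.d_d, hη.d_η_d, zero_add, map_zero] at h1

theorem eta_of_mem_harmonic (hη : IsSplitting D η) {x : L} (hx : x ∈ harmonic D η) : η x = 0 := by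
  have h : D.d (η x) + η (D.d x) = 0 := hx
  have h1 := congrArg η h
  rwa [map_add, hη.η_η, hη.η_d_η, add_zero, map_zero] at h1

theorem mem_harmonic_of {x : L} (h1 : D.d x = 0) (h2 : η x = 0) : x ∈ harmonic D η := by
  change D.d (η x) + η (D.d x) = 0
  rw [h1, h2, map_zero, map_zero, add_zero]

variable [DirectSum.Decomposition ℒ]

/-- The operator [d, η] has degree zero, hence commutes with taking homogeneous components. -/
theorem decompose_mem_harmonic (hη : IsSplitting D η) {x : L} (hx : x ∈ harmonic D η) (i : ℤ) :
    (DirectSum.decompose ℒ x i : L) ∈ harmonic D η := by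
  have key : ∀ (T : L →ₗ[k] L), (∀ j y, y ∈ ℒ j → T y ∈ ℒ j) → ∀ y,
      T (DirectSum.decompose ℒ y i) = DirectSum.decompose ℒ (T y) i := by
    intro T hT y
    induction y using DirectSum.Decomposition.inductionOn ℒ with
    | zero => simp
    | @homogeneous j m =>
      by_cases hij : j = i
      · subst hij
        rw [DirectSum.decompose_of_mem_same ℒ m.2, DirectSum.decompose_of_mem_same ℒ (hT _ _ m.2)]
      · rw [DirectSum.decompose_of_mem_ne ℒ m.2 hij,
          DirectSum.decompose_of_mem_ne ℒ (hT _ _ m.2) hij, map_zero]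
    | add y z hy hz => simp [hy, hz]
  have h := key (D.d ∘ₗ η + η ∘ₗ D.d) (fun j y hy => add_mem
    (by have := D.d_degree _ _ (hη.degree _ _ hy); rwa [sub_add_cancel] at this)
    (by have := hη.degree _ _ (D.d_degree _ _ hy); rwa [add_sub_cancel_right] at this)) x
  rw [harmonic, LinearMap.mem_ker, h, LinearMap.mem_ker.1 hx]
  simp

theorem isInternal_inducedGrading (hη : IsSplitting D η) :
    DirectSum.IsInternal (inducedGrading ℒ (harmonic D η)) := by
  rw [DirectSum.isInternal_submodule_iff_iSupIndep_and_iSup_eq_top]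
  have hi := (DirectSum.isInternal_submodule_iff_iSupIndep_and_iSup_eq_top ℒ).1
    (DirectSum.Decomposition.isInternal ℒ)
  constructor
  · intro i
    rw [Submodule.disjoint_def]
    intro x hx hx'
    have h1 := Submodule.disjoint_def.1 (hi.1 i) x hx
    refine Subtype.ext (h1 ?_)
    have h2 : (x : L) ∈ (⨆ j, ⨆ (_ : j ≠ i), inducedGrading ℒ (harmonic D η) j).map
        (harmonic D η).subtype := ⟨x, hx', rfl⟩
    simp only [Submodule.map_iSup] at h2
    exact (iSup_mono fun j => iSup_mono fun _ => Submodule.map_comap_le _ _ :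
      (⨆ j, ⨆ (_ : j ≠ i), (inducedGrading ℒ (harmonic D η) j).map (harmonic D η).subtype) ≤
        ⨆ j, ⨆ (_ : j ≠ i), ℒ j) h2
  · classical
    rw [eq_top_iff]
    rintro x -
    have hx : x = ∑ i ∈ (DirectSum.decompose ℒ (x : L)).support,
        (⟨DirectSum.decompose ℒ (x : L) i, decompose_mem_harmonic hη x.2 i⟩ : harmonic D η) := by
      apply Subtype.ext
      rw [AddSubmonoidClass.coe_finsetSum]
      exact (DirectSum.sum_support_decompose ℒ (x : L)).symm
    rw [hx]
    refine Submodule.sum_mem _ fun i _ => Submodule.mem_iSup_of_mem i ?_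
    exact (DirectSum.decompose ℒ (x : L) i).2

/-- Makes the term ηd of 1 - [d, η] disappear from μ₂. The Leibniz rule asks only for a homogeneous
first argument, so the induction is on `x` alone. -/
theorem d_bracket_of_mem_harmonic (hη : IsSplitting D η) (x y : harmonic D η) :
    D.d (D.bracket (x : L) (y : L)) = 0 := by
  have hx : x ∈ ⨆ i, inducedGrading ℒ (harmonic D η) i :=
    (isInternal_inducedGrading hη).submodule_iSup_eq_top ▸ Submodule.mem_top
  induction hx using Submodule.iSup_induction' with
  | zero => simp
  | add x x' _ _ hx hx' => simp [hx, hx']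
  | mem i x hx =>
    rw [D.leibniz i (x : L) y hx, d_of_mem_harmonic hη x.2, d_of_mem_harmonic hη y.2]
    simp

end Harmonic

/-! ### The minimal model -/

section Embeddings

variable {n : ℕ}

/-- The embedding `0 ↦ 0`, `i + 1 ↦ e i + 1`. -/
def consEmb {s : ℕ} (e : Fin s ↪o Fin n) : Fin (s + 1) ↪o Fin (n + 1) :=
  OrderEmbedding.ofStrictMono (Fin.cons 0 fun i => (e i).succ) fun i j => by
    refine Fin.cases (fun h => ?_) (fun j => ?_) j
    · exact absurd h (Fin.not_lt_zero i)
    · refine Fin.cases (fun _ => ?_) (fun i h => ?_) i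
      · simp
      · simpa using h

theorem map_consEmb {s : ℕ} (e : Fin s ↪o Fin n) :
    Finset.univ.map (consEmb e).toEmbedding = consSet (Finset.univ.map e.toEmbedding) := by
  ext x
  simp only [Finset.mem_map, Finset.mem_univ, true_and, consSet, Finset.mem_insert]
  rw [Fin.exists_fin_succ]
  refine or_congr eq_comm ⟨?_, ?_⟩
  · rintro ⟨i, rfl⟩
    exact ⟨e i, ⟨i, rfl⟩, rfl⟩
  · rintro ⟨_, ⟨i, rfl⟩, rfl⟩
    exact ⟨i, rfl⟩

theorem cons_comp_consEmb {X : Type*} (m : X) (a : Fin n → X) {s : ℕ} (e : Fin s ↪o Fin n) :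
    (Fin.cons m fun i => a (e i) : Fin (s + 1) → X) =
      fun i => (Fin.cons m a : Fin (n + 1) → X) (consEmb e i) := by
  funext i
  refine Fin.cases ?_ (fun i => ?_) i <;> rfl

end Embeddings

section

variable {k : Type*} [CommRing k]

/-- Bilinear identities on a graded module may be checked on homogeneous elements. -/
theorem multilinear_two_ext {M N : Type*} [AddCommGroup M] [Module k M] [AddCommGroup N]
    [Module k N] {ℳ : ℤ → Submodule k M} (hℳ : ⨆ i, ℳ i = ⊤)
    (f : MultilinearMap k (fun _ : Fin 2 => M) N) (B : M →ₗ[k] M →ₗ[k] N)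
    (h : ∀ i j x y, x ∈ ℳ i → y ∈ ℳ j → f ![x, y] = B x y) (x y : M) : f ![x, y] = B x y := by
  have hleft : ∀ x x' y, f ![x + x', y] = f ![x, y] + f ![x', y] := fun x x' y =>
    f.cons_add ![y] x x'
  have hright : ∀ x y y', f ![x, y + y'] = f ![x, y] + f ![x, y'] := fun x y y' =>
    (f.curryLeft x).cons_add ![] y y'
  have hx : x ∈ ⨆ i, ℳ i := hℳ ▸ Submodule.mem_top
  have hy : y ∈ ⨆ i, ℳ i := hℳ ▸ Submodule.mem_top
  induction hx using Submodule.iSup_induction' with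
  | zero => rw [map_zero, LinearMap.zero_apply]; exact f.map_coord_zero 0 rfl
  | add x x' _ _ hx hx' => rw [hleft, hx, hx', map_add, LinearMap.add_apply]
  | mem i x hx =>
    induction hy using Submodule.iSup_induction' with
    | zero => rw [map_zero]; exact f.map_coord_zero 1 rfl
    | add y y' _ _ hy hy' => rw [hright, hy, hy', map_add]
    | mem j y hy => exact h i j x y hx hy

end

/-! ### Degrees, antisymmetry and structure equations of the model -/

section Model

variable {k : Type*} [CommRing k] [Algebra ℚ k]
variable {L : Type*} [AddCommGroup L] [Module k L]
variable {ℒ : ℤ → Submodule k L} [DirectSum.Decomposition ℒ]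
variable {D : DGLieAlgebra ℒ} {η : L →ₗ[k] L}

theorem modelMap_hasDegree (hη : IsSplitting D η) (n : ℕ) :
    HasDegree (inducedGrading ℒ (harmonic D η)) ℒ (modelMap D η n) (1 - n) := by
  intro p a ha
  match n with
  | 0 => exact zero_mem _
  | 1 =>
    have h : (a 0 : L) ∈ ℒ (p 0) := ha 0
    simpa [modelMap] using h
  | n + 2 =>
    have h := treeSum_hasDegree_self ℒ (etaBracket_homogeneous D hη) (n + 1) p _ ha
    have hn : ((n + 1 : ℕ) : ℤ) * -1 = 1 - ((n + 2 : ℕ) : ℤ) := by push_cast; ring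
    rw [hn] at h
    exact Submodule.smul_mem _ _ h

theorem modelMap_antisymm (n : ℕ) :
    IsGradedAntisymmetric (inducedGrading ℒ (harmonic D η)) (modelMap D η n) := by
  intro σ p a ha
  match n with
  | 0 => exact (smul_zero _).symm
  | 1 => rw [Subsingleton.elim σ 1, chi_one, one_smul]; rfl
  | n + 2 =>
    have h := treeSum_antisymm ℒ (-1, etaBracket D η) (-1, etaBracket D η) (n + 1) σ p _ ha
    refine (congrArg (algebraMap ℚ k ((1 / 2) ^ (n + 1)) • ·) h).trans ?_
    exact smul_comm _ _ _

theorem minimalModel_hasDegree (hη : IsSplitting D η) (n : ℕ) :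
    HasDegree (inducedGrading ℒ (harmonic D η)) (inducedGrading ℒ (harmonic D η))
      (minimalModel D hη n) (2 - n) := by
  intro p a ha
  match n with
  | 0 => exact zero_mem _
  | 1 => exact zero_mem _
  | n + 2 =>
    have h := treeSum_hasDegree ℒ (projBracket_homogeneous D hη) (etaBracket_homogeneous D hη) n
      p _ ha
    have hn : (0 : ℤ) + (n : ℤ) * -1 = 2 - ((n + 2 : ℕ) : ℤ) := by push_cast; ring
    rw [hn] at h
    exact Submodule.smul_mem (ℒ _) _ h

theorem minimalModel_antisymm (hη : IsSplitting D η) (n : ℕ) :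
    IsGradedAntisymmetric (inducedGrading ℒ (harmonic D η)) (minimalModel D hη n) := by
  intro σ p a ha
  match n with
  | 0 => exact (smul_zero _).symm
  | 1 => exact (smul_zero _).symm
  | n + 2 =>
    have h := treeSum_antisymm ℒ (0, projBracket D η) (-1, etaBracket D η) (n + 1) σ p _ ha
    refine Subtype.ext (Eq.trans ?_ (map_unit_smul (harmonic D η).subtype _ _).symm)
    refine (congrArg (algebraMap ℚ k (-(1 / 2) ^ (n + 1)) • ·) h).trans ?_
    exact smul_comm _ _ _

section Insertion

variable {n : ℕ} {p : Fin n → ℤ} {x : Fin n → harmonic D η}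

/-- The operation `μ_r` in the first argument of another tree sum. -/
theorem coe_cons_minimalModel (hη : IsSplitting D η) (hx : ∀ i, (x i : L) ∈ ℒ (p i)) {r : ℕ}
    (e : Fin r ↪o Fin n) :
    (fun i => (((Fin.cons (minimalModel D hη r fun i => x (e i)) x :
      Fin (n + 1) → harmonic D η) i : harmonic D η) : L)) =
      insertModel D η p (fun i => (x i : L)) (Finset.univ.map e.toEmbedding) := by
  funext i
  refine Fin.cases ?_ (fun i => ?_) i
  · exact minimalModel_apply hη hx e
  · rfl

theorem modelMap_cons (hη : IsSplitting D η) (hx : ∀ i, (x i : L) ∈ ℒ (p i)) {r s : ℕ}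
    (e : Fin r ↪o Fin n) (e' : Fin s ↪o Fin n) :
    modelMap D η (s + 1) (Fin.cons (minimalModel D hη r fun i => x (e i)) fun i => x (e' i)) =
      treeOn ℒ (Fin.cons (shiftDeg p (Finset.univ.map e.toEmbedding) + 2) p : Fin (n + 1) → ℤ)
        (insertModel D η p (fun i => (x i : L)) (Finset.univ.map e.toEmbedding))
        (-1, etaBracket D η) (-1, etaBracket D η) (consSet (Finset.univ.map e'.toEmbedding)) := by
  have hc := coe_cons_minimalModel hη hx e
  rw [cons_comp_consEmb, modelMap_apply (p := (Fin.cons (shiftDeg p (Finset.univ.map e.toEmbedding)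
    + 2) p : Fin (n + 1) → ℤ)) _ (consEmb e'), map_consEmb, hc]
  intro i
  have := insertModel_mem hη hx (Finset.univ.map e.toEmbedding) i
  rwa [← hc] at this

theorem minimalModel_cons (hη : IsSplitting D η) (hx : ∀ i, (x i : L) ∈ ℒ (p i)) {r s : ℕ}
    (e : Fin r ↪o Fin n) (e' : Fin s ↪o Fin n) :
    (minimalModel D hη (s + 1)
      (Fin.cons (minimalModel D hη r fun i => x (e i)) fun i => x (e' i)) : L) =
      modelOn D η (Fin.cons (shiftDeg p (Finset.univ.map e.toEmbedding) + 2) p : Fin (n + 1) → ℤ)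
        (insertModel D η p (fun i => (x i : L)) (Finset.univ.map e.toEmbedding))
        (consSet (Finset.univ.map e'.toEmbedding)) := by
  have hc := coe_cons_minimalModel hη hx e
  rw [cons_comp_consEmb, minimalModel_apply (p := (Fin.cons (shiftDeg p
    (Finset.univ.map e.toEmbedding) + 2) p : Fin (n + 1) → ℤ)) hη _ (consEmb e'), map_consEmb, hc]
  intro i
  have := insertModel_mem hη hx (Finset.univ.map e.toEmbedding) i
  rwa [← hc] at this

theorem insertionSum_minimalModel (hη : IsSplitting D η) (hx : ∀ i, (x i : L) ∈ ℒ (p i)) :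
    insertionSum (minimalModel D hη) (minimalModel D hη) n p x = 0 := by
  -- The identity is checked in `L`, after composing the outer operation with the inclusion of `H`.
  have h := insertionSum_eq
    (fun n => (harmonic D η).subtype.compMultilinearMap (minimalModel D hη n))
    (minimalModel D hη) p x
    (fun A => modelOn D η (Fin.cons (shiftDeg p A + 2) p : Fin (n + 1) → ℤ)
      (insertModel D η p (fun i => (x i : L)) A) (consSet (Finset.univ \ A)))
    fun r s e e' he => by rw [← he]; exact minimalModel_cons hη hx e e'
  rw [jacobi_modelOn hη hx fun i => d_of_mem_harmonic hη (x i).2] at h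
  apply Subtype.ext
  rw [Submodule.coe_zero, ← h, insertionSum, insertionSum, AddSubmonoidClass.coe_finsetSum]
  refine Finset.sum_congr rfl fun r _ => ?_
  rw [AddSubmonoidClass.coe_finsetSum]
  exact Finset.sum_congr rfl fun σ _ => map_unit_smul (harmonic D η).subtype _ _

end Insertion

/-- `H` is an `L_∞`-algebra. -/
theorem isLInfinityAlgebra_minimalModel (hη : IsSplitting D η) :
    IsLInfinityAlgebra (inducedGrading ℒ (harmonic D η)) (minimalModel D hη) where
  graded := isInternal_inducedGrading hη
  zero := rfl
  degree := minimalModel_hasDegree hη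
  antisymm := minimalModel_antisymm hη
  jacobi _ _ _ ha := insertionSum_minimalModel hη ha

/-- The maps `fₙ` form an `L_∞`-morphism. -/
theorem isLInfinityMorphism_modelMap (hη : IsSplitting D η) :
    IsLInfinityMorphism (inducedGrading ℒ (harmonic D η)) ℒ (minimalModel D hη) D.toLInfinity
      (modelMap D η) where
  source := isLInfinityAlgebra_minimalModel hη
  target := isLInfinityAlgebra_toLInfinity D
  zero := rfl
  degree := modelMap_hasDegree hη
  antisymm := modelMap_antisymm
  comm n p x hx := by
    rw [sum_compMulti D modelMap_antisymm hx (treeOn_empty ℒ p (fun i => (x i : L)) _ _)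
      fun r e => modelMap_apply hx e]
    refine (morphism_eq_treeOn hη hx (fun i => d_of_mem_harmonic hη (x i).2) _).trans ?_
    refine (insertionSum_eq _ _ _ _ _ fun r s e e' he => ?_).symm
    rw [← he]
    exact modelMap_cons hη hx e e'

theorem isLInfinityQuasiIso_modelMap (hη : IsSplitting D η) :
    IsLInfinityQuasiIso (inducedGrading ℒ (harmonic D η)) ℒ (minimalModel D hη) D.toLInfinity
      (modelMap D η) where
  morphism := isLInfinityMorphism_modelMap hη
  quasiIso := by
    have h : unary (modelMap D η 1) ∘ₗ unary (minimalModel D hη 1) =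
        unary (D.toLInfinity 1) ∘ₗ unary (modelMap D η 1) := by
      ext x
      exact (d_of_mem_harmonic hη x.2).symm
    refine ⟨h, ?_, ?_⟩
    · rw [injective_iff_map_eq_zero]
      intro z hz
      obtain ⟨⟨x, hx⟩, rfl⟩ := Submodule.Quotient.mk_surjective _ z
      obtain ⟨y, hy⟩ := (Submodule.Quotient.mk_eq_zero _).1 hz
      have hy' : D.d y = (x : L) := hy
      have hx0 : x = 0 := by
        apply Subtype.ext
        -- x = dy = dηdy = dηx, and η kills harmonic elements.
        rw [← hy', ← hη.d_η_d, hy', eta_of_mem_harmonic hη x.2, map_zero, Submodule.coe_zero]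
      subst hx0
      exact Submodule.Quotient.mk_zero _
    · intro z
      obtain ⟨⟨x, hx⟩, rfl⟩ := Submodule.Quotient.mk_surjective _ z
      have hx' : D.d x = 0 := hx
      -- The harmonic representative of the class of a closed x; it differs from x by the boundary
      -- of -ηx.
      refine ⟨Submodule.Quotient.mk ⟨⟨x - D.d (η x), mem_harmonic_of ?_ ?_⟩, rfl⟩, ?_⟩
      · rw [map_sub, hx', D.d_d, sub_zero]
      · rw [map_sub, hη.η_d_η, sub_self]
      · refine (Submodule.Quotient.eq _).2 ⟨-η x, ?_⟩
        change D.d (-η x) = x - D.d (η x) - x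
        rw [map_neg]
        abel

/-! ### The operations in low degrees -/

/-- Only the splittings into two singletons count; by antisymmetry they agree, which cancels the ½.
The minus sign is the single left turn of the tree with two leaves. -/
theorem treeOn_pair {p : Fin 2 → ℤ} {a : Fin 2 → L} (ha : ∀ i, a i ∈ ℒ (p i)) (m : ℤ)
    (T : L →ₗ[k] L) (b : ℤ × (L →ₗ[k] L →ₗ[k] L)) :
    treeOn ℒ p a (m, D.bracket.compr₂ T) b Finset.univ = -T (D.bracket (a 0) (a 1)) := by
  have hp : (Finset.univ : Finset (Fin 2)).powerset = {∅, {0}, {1}, Finset.univ} := by decide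
  have h0 : (Finset.univ : Finset (Fin 2)) \ {0} = {1} := by decide
  have h1 : (Finset.univ : Finset (Fin 2)) \ {1} = {0} := by decide
  rw [treeOn_eq ℒ ha _ _ (by simp), hp, Finset.sum_insert (by decide),
    Finset.sum_insert (by decide), Finset.sum_pair (by decide), h0, h1, Finset.sdiff_self,
    treeOn_empty]
  simp only [treeOn_singleton, map_zero, LinearMap.zero_apply, smul_zero, zero_add, add_zero,
    LinearMap.compr₂_apply]
  have s0 : splitSign p b.1 {0} {1} = -1 := by simp [splitSign, cross, pairSign]
  have s1 : splitSign p b.1 {1} {0} = (p 0 * p 1).negOnePow := by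
    simp [splitSign, cross, pairSign, mul_comm]
  rw [s0, s1, D.antisymm _ _ _ _ (ha 1) (ha 0), map_neg, map_unit_smul, smul_neg, smul_smul,
    mul_comm (p 1), Int.units_mul_self, one_smul, Units.neg_smul, one_smul, ← two_smul k,
    half_smul_two_smul]

theorem modelMap_one (x : harmonic D η) : modelMap D η 1 ![x] = (x : L) := rfl

theorem minimalModel_one (hη : IsSplitting D η) (x : harmonic D η) :
    minimalModel D hη 1 ![x] = 0 := rfl

theorem modelMap_two (hη : IsSplitting D η) (x y : harmonic D η) :
    modelMap D η 2 ![x, y] = -η (D.bracket (x : L) (y : L)) := by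
  refine multilinear_two_ext (isInternal_inducedGrading hη).submodule_iSup_eq_top _
    (-(etaBracket D η).compl₁₂ (harmonic D η).subtype (harmonic D η).subtype) ?_ x y
  intro i j x y hx hy
  have ha : ∀ l, ((![x, y] l : harmonic D η) : L) ∈ ℒ (![i, j] l) := by
    intro l
    fin_cases l
    · exact hx
    · exact hy
  have h := modelMap_apply ha (OrderIso.refl (Fin 2)).toOrderEmbedding
  refine h.trans ((congrArg _ ?_).trans (treeOn_pair ha (-1) η (-1, etaBracket D η)))
  ext; simp

theorem minimalModel_two (hη : IsSplitting D η) (x y : harmonic D η) :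
    (minimalModel D hη 2 ![x, y] : L) =
      D.bracket (x : L) (y : L) - D.d (η (D.bracket (x : L) (y : L))) := by
  have key := multilinear_two_ext (isInternal_inducedGrading hη).submodule_iSup_eq_top
    ((harmonic D η).subtype.compMultilinearMap (minimalModel D hη 2))
    ((projBracket D η).compl₁₂ (harmonic D η).subtype (harmonic D η).subtype) ?_ x y
  · refine key.trans ?_
    change projHarmonic D η (D.bracket (x : L) (y : L)) = _
    rw [projHarmonic_apply, d_bracket_of_mem_harmonic hη, map_zero, add_zero]
  intro i j x y hx hy
  have ha : ∀ l, ((![x, y] l : harmonic D η) : L) ∈ ℒ (![i, j] l) := by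
    intro l
    fin_cases l
    · exact hx
    · exact hy
  have h := minimalModel_apply hη ha (OrderIso.refl (Fin 2)).toOrderEmbedding
  have hu : Finset.univ.map (OrderIso.refl (Fin 2)).toOrderEmbedding.toEmbedding =
      Finset.univ := by ext; simp
  rw [hu, modelOn, if_neg (by simp)] at h
  refine h.trans ?_
  rw [neg_eq_iff_eq_neg]
  exact treeOn_pair ha 0 (projHarmonic D η) (-1, etaBracket D η)

end Model

end

end LInfinity

theorem mainTheorem4 {k : Type*} [CommRing k] [Algebra ℚ k]
    {L : Type*} [AddCommGroup L] [Module k L]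
    (ℒ : ℤ → Submodule k L) [DirectSum.Decomposition ℒ]
    (D : LInfinity.DGLieAlgebra ℒ) (η : L →ₗ[k] L) (hη : LInfinity.IsSplitting D η) :
    LInfinity.IsLInfinityQuasiIso
        (LInfinity.inducedGrading ℒ (LInfinity.harmonic D η)) ℒ
        (LInfinity.minimalModel D hη) D.toLInfinity (LInfinity.modelMap D η) ∧
      (∀ x : LInfinity.harmonic D η, LInfinity.modelMap D η 1 ![x] = (x : L)) ∧
      (∀ x y : LInfinity.harmonic D η,
        LInfinity.modelMap D η 2 ![x, y] = -η (D.bracket (x : L) (y : L))) ∧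
      (∀ x : LInfinity.harmonic D η, LInfinity.minimalModel D hη 1 ![x] = 0) ∧
      (∀ x y : LInfinity.harmonic D η,
        (LInfinity.minimalModel D hη 2 ![x, y] : L) =
          D.bracket (x : L) (y : L) - D.d (η (D.bracket (x : L) (y : L)))) :=
  ⟨LInfinity.isLInfinityQuasiIso_modelMap hη, LInfinity.modelMap_one,
    LInfinity.modelMap_two hη, LInfinity.minimalModel_one hη, LInfinity.minimalModel_two hη⟩
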